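/- Let $k$ be an algebraically closed field of characteristic zero and let $G$ be a finite solvable group which is \emph{special}: there is a filtration $$G=G_0\supsetneq G_1\supsetneq\cdots\supsetneq G_r=1$$ by normal subgroups of $G$ such that, for every $i=0,\dots,r-1$, the projection $p_i\colon G/G_{i+1}\to G/G_i$ has abelian kernel and admits a section, i.e. a group homomorphism $s_i\colon G/G_i\to G/G_{i+1}$ with $p_i\circ s_i=\mathrm{id}$. Let $V$ be a finite-dimensional faithful linear representation of $G$ over $k$, and let $V/G=\operatorname{Spec} k[V]^G$. Then $V/G$ admits a \emph{toric rational tower}: there are an integer $n\ge 0$, varieties (integral separated schemes of finite type) $X_0=V/G,X_1,\dots,X_n$ over $k$, and dominant rational maps over $k$ $$X_n\stackrel{\pi_n}{\dashrightarrow}X_{n-1}\dashrightarrow\cdots\dashrightarrow X_1\stackrel{\pi_1}{\dashrightarrow}X_0=V/G$$ such that 1. $X_n$ is rational over $k$, i.e. $k$-birational to an affine space over $k$; 2. for every $i=1,\dots,n$, the generic fiber of $\pi_i$, a scheme over the function field $k(X_{i-1})$, is irreducible, is geometrically rational (its base change to an algebraic closure of $k(X_{i-1})$ is rational), and is birational over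 $k(X_{i-1})$ to a torsor under an algebraic torus over $k(X_{i-1})$. -/

import Mathlib

open CategoryTheory CategoryTheory.Limits AlgebraicGeometry
open scoped TensorProduct

universe u w

noncomputable section

namespace ToricTower

/-! ### Special groups -/

/-- The projection `G/N → G/M` for normal subgroups `N ≤ M` of `G`. -/
def quotientProj {G : Type w} [Group G] (N M : Subgroup G) [N.Normal] [M.Normal] (h : N ≤ M) :
    G ⧸ N →* G ⧸ M :=
  QuotientGroup.map N M (MonoidHom.id G) h

/-- `G` has a filtration `G = G₀ ⊋ G₁ ⊋ ⋯ ⊋ Gᵣ = 1` by normal subgroups of `G` such that every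
projection `G/Gᵢ₊₁ → G/Gᵢ` has abelian kernel and a section (a homomorphism splitting it).
A finite solvable group with this property is called special. -/
def IsSpecial (G : Type w) [Group G] : Prop :=
  ∃ (r : ℕ) (N : Fin (r + 1) → Subgroup G) (_ : ∀ i, (N i).Normal),
    N 0 = ⊤ ∧ N (Fin.last r) = ⊥ ∧
    ∀ i : Fin r, ∃ h : N i.succ < N i.castSucc,
      IsMulCommutative (quotientProj (N i.succ) (N i.castSucc) h.le).ker ∧
      ∃ s : G ⧸ N i.castSucc →* G ⧸ N i.succ,
        (quotientProj (N i.succ) (N i.castSucc) h.le).comp s = MonoidHom.id _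

/-! ### Varieties -/

/-- A variety over `k`: an integral separated scheme of finite type over `k`. -/
structure Variety (k : Type u) [Field k] where
  /-- The underlying scheme. -/
  scheme : Scheme.{u}
  /-- The structure morphism. -/
  hom : scheme ⟶ Spec (CommRingCat.of k)
  [isIntegral : IsIntegral scheme]
  [isSeparated : IsSeparated hom]
  [locallyOfFiniteType : LocallyOfFiniteType hom]
  [quasiCompact : QuasiCompact hom]

namespace Variety

variable {k : Type u} [Field k]

attribute [instance] isIntegral isSeparated locallyOfFiniteType quasiCompact

instance (X : Variety k) : X.scheme.Over (Spec (CommRingCat.of k)) := ⟨X.hom⟩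

instance (X : Variety k) : X.scheme.IsSeparated where
  isSeparated_terminal_from := by
    rw [← terminal.comp_from X.hom]
    infer_instance

/-- `X` is rational over `k`: birational over `k` to an affine space over `k`. -/
def IsRational (X : Variety k) : Prop := Scheme.IsRationalOver X.hom

end Variety

/-! ### The quotient of a linear representation -/

section Quotient

variable {k V : Type u} [Field k] [AddCommGroup V] [Module k V] {G : Type w} [Group G]

/-- The action of `G` on the coordinate ring `k[V] = Sym(V*)` of `V`, which extends the action
on `V*` contragredient to the one on `V`. -/
def coordAction (ρ : Representation k G V) :
    G →* (SymmetricAlgebra k (Module.Dual k V) →ₐ[k] SymmetricAlgebra k (Module.Dual k V)) where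
  toFun g := SymmetricAlgebra.lift (SymmetricAlgebra.ι k (Module.Dual k V) ∘ₗ ρ.dual g)
  map_one' := by
    apply SymmetricAlgebra.algHom_ext
    ext x
    simp only [map_one]
    simp
  map_mul' g h := by
    apply SymmetricAlgebra.algHom_ext
    ext x
    simp only [map_mul]
    simp

/-- The ring of invariants `k[V]^G`. -/
def invariants (ρ : Representation k G V) :
    Subalgebra k (SymmetricAlgebra k (Module.Dual k V)) where
  carrier := {f | ∀ g, coordAction ρ g f = f}
  mul_mem' ha hb g := by rw [map_mul, ha g, hb g]
  add_mem' ha hb g := by rw [map_add, ha g, hb g]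
  algebraMap_mem' c g := (coordAction ρ g).commutes c

/-- The ring of invariants of a finite group is finitely generated. -/
theorem finiteType_invariants [FiniteDimensional k V] [Finite G] (ρ : Representation k G V) :
    Algebra.FiniteType k (invariants ρ) := by
  let e := SymmetricAlgebra.equivMvPolynomial (Module.finBasis k (Module.Dual k V))
  have hft : Algebra.FiniteType k (SymmetricAlgebra k (Module.Dual k V)) :=
    Algebra.FiniteType.equiv inferInstance e.symm
  let : MulSemiringAction G (SymmetricAlgebra k (Module.Dual k V)) :=
    { smul := fun g f => coordAction ρ g f
      one_smul := fun f => by change coordAction ρ 1 f = f; simp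
      mul_smul := fun g h f => by
        change coordAction ρ (g * h) f = coordAction ρ g (coordAction ρ h f); simp
      smul_zero := fun g => map_zero (coordAction ρ g)
      smul_add := fun g => map_add (coordAction ρ g)
      smul_one := fun g => map_one (coordAction ρ g)
      smul_mul := fun g => map_mul (coordAction ρ g) }
  have : SMulCommClass G (invariants ρ) (SymmetricAlgebra k (Module.Dual k V)) :=
    ⟨fun g a f => by
      change coordAction ρ g (a.1 * f) = a.1 * coordAction ρ g f
      rw [map_mul, a.2 g]⟩
  have : Algebra.IsInvariant (invariants ρ) (SymmetricAlgebra k (Module.Dual k V)) G :=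
    ⟨fun b hb => ⟨⟨b, hb⟩, rfl⟩⟩
  have : Algebra.IsIntegral (invariants ρ) (SymmetricAlgebra k (Module.Dual k V)) :=
    Algebra.IsInvariant.isIntegral _ _ G
  have : Algebra.FiniteType (invariants ρ) (SymmetricAlgebra k (Module.Dual k V)) :=
    Algebra.FiniteType.of_restrictScalars_finiteType k _ _
  have : Module.Finite (invariants ρ) (SymmetricAlgebra k (Module.Dual k V)) :=
    Algebra.IsIntegral.finite
  exact ⟨fg_of_fg_of_fg k _ _ hft.out (Module.finite_def.mp inferInstance) Subtype.val_injective⟩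

/-- The quotient variety `V/G = Spec k[V]^G`. -/
def linearQuotient [FiniteDimensional k V] [Finite G] (ρ : Representation k G V) : Variety k :=
  haveI := finiteType_invariants ρ
  haveI : LocallyOfFiniteType
      (Spec.map (CommRingCat.ofHom (algebraMap k (invariants ρ)))) := by
    rw [HasRingHomProperty.Spec_iff (P := @LocallyOfFiniteType)]
    exact RingHom.finiteType_algebraMap.mpr inferInstance
  { scheme := Spec (CommRingCat.of (invariants ρ))
    hom := Spec.map (CommRingCat.ofHom (algebraMap k (invariants ρ))) }

end Quotient

/-! ### Tori and torsors -/

/-- The affine group scheme `Spec H` over the field `K`, for a commutative Hopf algebra `H`, is an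
algebraic torus: over an algebraic closure of `K` it becomes isomorphic, as a group scheme, to
`𝔾ₘⁿ`, the spectrum of the group algebra of `ℤⁿ`. -/
def IsTorus (K H : Type u) [Field K] [CommRing H] [HopfAlgebra K H] : Prop :=
  ∃ n : ℕ, Nonempty ((AlgebraicClosure K ⊗[K] H) ≃ₐc[AlgebraicClosure K]
    AddMonoidAlgebra (AlgebraicClosure K) (Fin n → ℤ))

/-- `Spec A` is a torsor under the affine group scheme `T = Spec H` over the field `K` for the
right action `P × T → P`, `P = Spec A`, given by the coaction `ρ : A → A ⊗ H`: the scheme `P` is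
nonempty, `ρ` defines an action, and `P × T → P × P`, `(p, t) ↦ (p, p t)`, is an isomorphism.
(Every torsor under an affine group scheme is affine, so these are all torsors under `T`.) -/
structure IsTorsor {K H A : Type u} [Field K] [CommRing H] [HopfAlgebra K H] [CommRing A]
    [Algebra K A] (ρ : A →ₐ[K] A ⊗[K] H) : Prop where
  nontrivial : Nontrivial A
  coassoc : (Algebra.TensorProduct.assoc K K K A H H).toAlgHom.comp
      ((Algebra.TensorProduct.map ρ (AlgHom.id K H)).comp ρ) =
    (Algebra.TensorProduct.map (AlgHom.id K A) (Bialgebra.comulAlgHom K H)).comp ρ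
  counit : (Algebra.TensorProduct.rid K K A).toAlgHom.comp
      ((Algebra.TensorProduct.map (AlgHom.id K A) (Bialgebra.counitAlgHom K H)).comp ρ) =
    AlgHom.id K A
  bijective : Function.Bijective
    (Algebra.TensorProduct.productMap Algebra.TensorProduct.includeLeft ρ : A ⊗[K] A →ₐ[K] A ⊗[K] H)

/-- The scheme `F` over the field `K` is birational over `K` to a torsor under an algebraic torus
over `K`. -/
def IsBirationalToTorusTorsor (K : Type u) [Field K] {F : Scheme.{u}}
    (s : F ⟶ Spec (CommRingCat.of K)) : Prop :=
  ∃ (H A : Type u) (_ : CommRing H) (_ : HopfAlgebra K H) (_ : CommRing A) (_ : Algebra K A)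
    (ρ : A →ₐ[K] A ⊗[K] H), IsTorus K H ∧ IsTorsor ρ ∧
      Scheme.BirationalOver s (Spec.map (CommRingCat.ofHom (algebraMap K A)))

/-- The scheme `F` over the field `K` is geometrically rational: its base change to an algebraic
closure `K'` of `K` is rational over `K'`. -/
def IsGeometricallyRational (K : Type u) [Field K] {F : Scheme.{u}}
    (s : F ⟶ Spec (CommRingCat.of K)) : Prop :=
  Scheme.IsRationalOver
    (pullback.snd s (Spec.map (CommRingCat.ofHom (algebraMap K (AlgebraicClosure K)))))

/-! ### Toric rational towers -/

section Tower

variable {k : Type u} [Field k]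

/-- The generic fiber of a rational map `f : X ⤏ Y`, i.e. the generic fiber of the morphism to `Y`
which `f` defines on its domain of definition. -/
def genericFiber {X Y : Variety k} (f : X.scheme ⤏ Y.scheme) : Scheme.{u} :=
  pullback f.toPartialMap.hom (Y.scheme.fromSpecStalk (genericPoint Y.scheme))

/-- The structure morphism of the generic fiber, to the spectrum of the function field `k(Y)`. -/
def genericFiberHom {X Y : Variety k} (f : X.scheme ⤏ Y.scheme) :
    genericFiber f ⟶ Spec (CommRingCat.of Y.scheme.functionField) :=
  pullback.snd f.toPartialMap.hom (Y.scheme.fromSpecStalk (genericPoint Y.scheme))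

/-- One step of a toric rational tower: a dominant rational map over `k` whose generic fiber is
irreducible, geometrically rational, and birational to a torsor under an algebraic torus, over the
function field of the target. -/
structure IsToricStep {X Y : Variety k} (f : X.scheme ⤏ Y.scheme) : Prop where
  isOver : f.IsOver (Spec (CommRingCat.of k))
  isDominant : f.IsDominant
  irreducible : IrreducibleSpace (genericFiber f)
  geometricallyRational : IsGeometricallyRational Y.scheme.functionField (genericFiberHom f)
  toric : IsBirationalToTorusTorsor Y.scheme.functionField (genericFiberHom f)

/-- `X` admits a toric rational tower `Xₙ ⤏ ⋯ ⤏ X₁ ⤏ X₀ = X`, with source `Xₙ` rational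
over `k`. -/
def AdmitsToricRationalTower (X : Variety k) : Prop :=
  ∃ (n : ℕ) (Y : Fin (n + 1) → Variety k)
    (π : ∀ i : Fin n, (Y i.succ).scheme ⤏ (Y i.castSucc).scheme),
    Y 0 = X ∧ (Y (Fin.last n)).IsRational ∧ ∀ i, IsToricStep (π i)

end Tower

end ToricTower

end

/-! The proof is an induction along the filtration, and its hypothesis is
`LinearQuotientsAdmitTowers`: for a faithful linear action on a purely transcendental field, every
finitely generated model of the field of invariants admits a tower. Allowing every model, and not
only `k[V]^G`, matters because each step of a tower produces some model of the next field of
invariants. For the trivial group the model is itself rational. It remains to pass from `Q` to a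
split extension `A ⋊ Q` with `A` finite abelian.

The torus steps come from monomial actions (`admits_of_isMonomialAction`). If a finite group acts
faithfully on a field `L` with fixed field `K`, and acts semilinearly on `L[C]`, `C` a lattice,
permuting monomials up to scalars, then by Galois descent the invariants of `L[C]` form the
coordinate ring of a torsor. The torus has as its Hopf algebra the invariants of the action without
the scalars. So a tower for models of `L[C]^Q` gives a tower for models of `L^Q`.

This is used twice for `A ⋊ Q`. First, adjoin to `E` the monomials of the permutation lattice `Λ` on
the pairs (character of `A`, element of `Q`), with `A` acting on the monomials through the
characters. On `k(Λ)` the whole group already acts faithfully, so by descent (the no-name lemma) the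
linear coordinates of `E` may be replaced by invariant generators `y`. The invariants of `A` are
then `k(M)(y)`, where `M ⊆ Λ` is the sublattice of trivial character (`mem_adjoin_of_invariant`,
`IsEigenlattice.admits`).

What is left is `Q` acting on `k(M)(y)` through a lattice `M` that need not be a permutation
lattice. Embed `M` in the lattice of functions `Q → M` by orbit maps. The quotient lattice defines a
second torsor, and its function field is generated by `y` and the monomials of the function lattice,
of which those attached to a basis are permuted by `Q` (`admits_of_linearization`). This action is
linear and faithful, so the hypothesis for `Q` applies. -/

namespace ToricTower

/-! ### Galois descent -/

section Descent

variable {K L Q : Type*} [Field K] [Field L] [Algebra K L] [Group Q]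

/-- A faithful action of a group on `L` with field of invariants `K`. -/
structure IsGaloisAction (σ : Q →* (L ≃ₐ[K] L)) : Prop where
  injective : Function.Injective σ
  mem_range : ∀ l, (∀ q, σ q l = l) → l ∈ Set.range (algebraMap K L)

variable {σ : Q →* (L ≃ₐ[K] L)}

/-- Dedekind's independence of characters, applied to the distinct automorphisms `σ q`. -/
theorem eq_zero_of_sum_mul_eq_zero [Fintype Q] (hσ : Function.Injective σ) (c : Q → L)
    (h : ∀ l, ∑ q, c q * σ q l = 0) (q : Q) : c q = 0 := by
  have hli := (linearIndependent_monoidHom L L).comp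
    (fun q : Q => ((σ q : L →ₐ[K] L) : L →* L)) (by
      intro p q hpq
      apply hσ
      ext l
      exact DFunLike.congr_fun hpq l)
  refine Fintype.linearIndependent_iff.mp hli c ?_ q
  ext l
  simpa using h l

variable {M : Type*} [AddCommGroup M] [Module K M] [Module L M] [IsScalarTower K L M]

-- A linear form `φ` vanishing on the invariants kills every trace `∑ s q (l • m)`, that is, `∑ σ q
-- l * φ (s q m) = 0` for all `l`. Dedekind's lemma gives `φ m = 0`. Only faithfulness on `L` is
-- needed, so the lemma also serves for the no-name argument.
omit [IsScalarTower K L M] in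
theorem span_invariants_eq_top [Finite Q] (hσ : Function.Injective σ) (s : Representation K Q M)
    (hs : ∀ q l m, s q (l • m) = σ q l • s q m) :
    Submodule.span L {m : M | ∀ q, s q m = m} = ⊤ := by
  have := Fintype.ofFinite Q
  by_contra hne
  obtain ⟨φ, hφ, hle⟩ := Submodule.exists_le_ker_of_lt_top _ (lt_top_iff_ne_top.mpr hne)
  apply hφ
  ext m
  have key := eq_zero_of_sum_mul_eq_zero hσ (fun q => φ (s q m)) (fun l => ?_) 1
  · simpa using key
  · have hmem : ∑ q, s q (l • m) ∈ {m : M | ∀ q, s q m = m} := by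
      intro p
      rw [map_sum]
      exact Fintype.sum_equiv (Equiv.mulLeft p) _ _ (fun q => by simp)
    have := hle (Submodule.subset_span hmem)
    rw [LinearMap.mem_ker, map_sum] at this
    rw [← this]
    refine Finset.sum_congr rfl fun q _ => ?_
    rw [hs, map_smul, smul_eq_mul, mul_comm]

/-- Multiplying a relation by `l` and summing over the group replaces each coefficient `g j` by the
trace of `l * g j`, which lies in `K`. Independence over `K` makes these traces vanish for all `l`,
and Dedekind's lemma then makes `g i` vanish. -/
theorem IsGaloisAction.linearIndependent [Finite Q] (hσ : IsGaloisAction σ)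
    (s : Representation K Q M)
    (hs : ∀ q l m, s q (l • m) = σ q l • s q m) {ι : Type*} {v : ι → M}
    (hv : LinearIndependent K v) (hinv : ∀ i q, s q (v i) = v i) : LinearIndependent L v := by
  have := Fintype.ofFinite Q
  rw [linearIndependent_iff'] at hv ⊢
  intro t g hg i hi
  have htr : ∀ l : L, ∃ a : K, algebraMap K L a = ∑ q, σ q l := by
    intro l
    apply hσ.mem_range
    intro p
    rw [map_sum]
    exact Fintype.sum_equiv (Equiv.mulLeft p) _ _ (fun q => by simp)
  choose tr htr using htr
  have key : ∀ l : L, ∑ q, σ q (l * g i) = 0 := by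
    intro l
    have h1 : ∑ j ∈ t, tr (l * g j) • v j = 0 := by
      have h2 : ∑ q, s q (l • ∑ j ∈ t, g j • v j) = 0 := by simp [hg]
      rw [← h2]
      simp only [Finset.smul_sum, map_sum, smul_smul, hs, hinv]
      rw [Finset.sum_comm]
      refine Finset.sum_congr rfl fun j _ => ?_
      rw [← Finset.sum_smul, ← htr, algebraMap_smul]
    have h3 := hv t _ h1 i hi
    rw [← htr, h3, map_zero]
  have := eq_zero_of_sum_mul_eq_zero hσ.injective (fun q => σ q (g i)) (fun l => by
    rw [← key l]; simp [mul_comm]) 1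
  simpa using this

/-- Galois descent for vector spaces. -/
theorem IsGaloisAction.isBaseChange [Finite Q] (hσ : IsGaloisAction σ) (s : Representation K Q M)
    (hs : ∀ q l m, s q (l • m) = σ q l • s q m) {A : Type*} [AddCommGroup A] [Module K A]
    (f : A →ₗ[K] M) (hf : Function.Injective f)
    (hA : ∀ m, m ∈ Set.range f ↔ ∀ q, s q m = m) : IsBaseChange L f := by
  let b := Module.Free.chooseBasis K A
  have hli : LinearIndependent L (f ∘ b) :=
    hσ.linearIndependent s hs (b.linearIndependent.map' f (LinearMap.ker_eq_bot.mpr hf))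
      (fun i => (hA _).mp ⟨b i, rfl⟩)
  have hsp : ⊤ ≤ Submodule.span L (Set.range (f ∘ b)) := by
    rw [← span_invariants_eq_top hσ.injective s hs, Submodule.span_le]
    intro m hm
    obtain ⟨a, rfl⟩ := (hA m).mpr hm
    have h1 : f a ∈ Submodule.span K (Set.range (f ∘ b)) := by
      rw [Set.range_comp, ← Submodule.map_span, b.span_eq]
      exact ⟨a, trivial, rfl⟩
    exact Submodule.span_le_restrictScalars K L _ h1
  -- A `K`-basis of the invariants is an `L`-basis of `M`, which is what base change means for
  -- vector spaces.
  let bL := Module.Basis.mk hli hsp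
  have h1 := (IsBaseChange.of_basis K bL).comp_equiv b.repr
  convert h1 using 1
  refine b.ext fun i => ?_
  simp [bL]

end Descent

open TensorProduct

/-! ### Base change of tensor products -/

section BaseChange

variable {K L : Type*} [Field K] [Field L] [Algebra K L]
  {A A' B B' : Type*} [AddCommGroup A] [Module K A] [AddCommGroup A'] [Module K A']
  [AddCommGroup B] [Module K B] [Module L B] [IsScalarTower K L B]
  [AddCommGroup B'] [Module K B'] [Module L B'] [IsScalarTower K L B']

theorem isBaseChange_tensor {f : A →ₗ[K] B} {g : A' →ₗ[K] B'} (hf : IsBaseChange L f)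
    (hg : IsBaseChange L g) (h : A ⊗[K] A' →ₗ[K] B ⊗[L] B')
    (hh : ∀ a a', h (a ⊗ₜ a') = f a ⊗ₜ g a') : IsBaseChange L h := by
  refine IsBaseChange.of_equiv
    ((AlgebraTensorModule.distribBaseChange K L A A').trans
      (TensorProduct.congr hf.equiv hg.equiv)) fun x => ?_
  induction x with
  | zero => simp
  | add x y hx hy => rw [tmul_add, map_add, hx, hy, map_add]
  | tmul a a' => simp [hh, IsBaseChange.equiv_tmul]

theorem injective_of_isBaseChange {f : A →ₗ[K] B} (hf : IsBaseChange L f) :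
    Function.Injective f := by
  intro a a' h
  have h1 : hf.equiv (1 ⊗ₜ a) = hf.equiv (1 ⊗ₜ a') := by
    simp [IsBaseChange.equiv_tmul, h]
  exact Module.FaithfullyFlat.tensorProduct_mk_injective (A := K) (B := L) A (hf.equiv.injective h1)

/-- Bijectivity descends along the faithfully flat extension `L / K`. -/
theorem bijective_of_isBaseChange {f : A →ₗ[K] B} {g : A' →ₗ[K] B'} (hf : IsBaseChange L f)
    (hg : IsBaseChange L g) (φ : A →ₗ[K] A') (ψ : B →ₗ[L] B') (h : ∀ a, ψ (f a) = g (φ a))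
    (hψ : Function.Bijective ψ) : Function.Bijective φ := by
  have h1 : hg.equiv.toLinearMap ∘ₗ φ.baseChange L = ψ ∘ₗ hf.equiv.toLinearMap := by
    ext a
    simp [IsBaseChange.equiv_tmul, h]
  have h2 : Function.Bijective (φ.baseChange L) := by
    rw [← hg.equiv.bijective.of_comp_iff']
    change Function.Bijective (hg.equiv.toLinearMap ∘ₗ φ.baseChange L)
    rw [h1]
    exact hψ.comp hf.equiv.bijective
  exact (Module.FaithfullyFlat.lTensor_bijective_iff_bijective K L φ).mp h2

end BaseChange

section MapTensor

variable {K : Type*} (L : Type*) [Field K] [Field L] [Algebra K L]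
  {A A' B B' : Type*} [CommRing A] [Algebra K A] [CommRing A'] [Algebra K A']
  [CommRing B] [Algebra K B] [Algebra L B] [IsScalarTower K L B]
  [CommRing B'] [Algebra K B'] [Algebra L B'] [IsScalarTower K L B']

/-- The map `A ⊗[K] A' → B ⊗[L] B'` induced by `A → B` and `A' → B'`. -/
noncomputable def mapTensor (f : A →ₐ[K] B) (g : A' →ₐ[K] B') : A ⊗[K] A' →ₐ[K] B ⊗[L] B' :=
  Algebra.TensorProduct.productMap
    (((Algebra.TensorProduct.includeLeft : B →ₐ[L] B ⊗[L] B').restrictScalars K).comp f)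
    (((Algebra.TensorProduct.includeRight : B' →ₐ[L] B ⊗[L] B').restrictScalars K).comp g)

@[simp]
theorem mapTensor_tmul (f : A →ₐ[K] B) (g : A' →ₐ[K] B') (x : A) (y : A') :
    mapTensor L f g (x ⊗ₜ y) = f x ⊗ₜ g y := by
  simp [mapTensor]

theorem isBaseChange_mapTensor {f : A →ₐ[K] B} {g : A' →ₐ[K] B'}
    (hf : IsBaseChange L f.toLinearMap) (hg : IsBaseChange L g.toLinearMap) :
    IsBaseChange L (mapTensor L f g).toLinearMap :=
  isBaseChange_tensor hf hg _ (fun a b => by simp)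

end MapTensor

/-! ### Twisted group algebras -/

section Twisted

/-- The subalgebra of invariants of a group acting by algebra automorphisms. -/
def invariantSubalgebra {K B Q : Type*} [Field K] [CommRing B] [Algebra K B] [Group Q]
    (s : Q →* (B ≃ₐ[K] B)) : Subalgebra K B where
  carrier := {b | ∀ q, s q b = b}
  mul_mem' ha hb q := by rw [map_mul, ha q, hb q]
  add_mem' ha hb q := by rw [map_add, ha q, hb q]
  algebraMap_mem' c q := (s q).commutes c

/-- The canonical map from the tensor product of two algebras of invariants over `K` to the tensor
product over `L`. -/
noncomputable abbrev tensorVal {K Q B : Type*} (L : Type*) [Field K] [Field L] [Algebra K L]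
    [Group Q] [CommRing B] [Algebra K B] [Algebra L B] [IsScalarTower K L B]
    (s s₀ : Q →* (B ≃ₐ[K] B)) :
    invariantSubalgebra s ⊗[K] invariantSubalgebra s₀ →ₐ[K] B ⊗[L] B :=
  mapTensor L (invariantSubalgebra s).val (invariantSubalgebra s₀).val

theorem isBaseChange_invariantSubalgebra {K L Q B : Type*} [Field K] [Field L] [Algebra K L]
    [Group Q] [Finite Q] [CommRing B] [Algebra K B] [Algebra L B] [IsScalarTower K L B]
    {σ : Q →* (L ≃ₐ[K] L)} (hσ : IsGaloisAction σ) {s : Q →* (B ≃ₐ[K] B)}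
    (hs : ∀ q l b, s q (l • b) = σ q l • s q b) :
    IsBaseChange L (invariantSubalgebra s).val.toLinearMap := by
  refine hσ.isBaseChange
    (s := { toFun := fun q => (s q).toLinearMap, map_one' := by ext; simp,
            map_mul' := fun p q => by ext; simp }) hs _ Subtype.val_injective ?_
  intro m
  constructor
  · rintro ⟨x, rfl⟩
    exact x.2
  · intro h
    exact ⟨⟨m, h⟩, rfl⟩

end Twisted

/-! ### Descent of the Hopf algebra and of its coaction -/

section Coaction

/-- An algebra map into `Y` with values in the image of an injective map `X → Y`, as a map
to `X`. -/
noncomputable def liftAlgHom {K X Y Z : Type*} [Field K] [CommRing X] [CommRing Y] [CommRing Z]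
    [Algebra K X] [Algebra K Y] [Algebra K Z] (i : X →ₐ[K] Y) (hi : Function.Injective i)
    (g : Z →ₐ[K] Y) (hg : ∀ z, g z ∈ i.range) : Z →ₐ[K] X :=
  (AlgEquiv.ofInjective i hi).symm.toAlgHom.comp (g.codRestrict i.range hg)

theorem liftAlgHom_spec {K X Y Z : Type*} [Field K] [CommRing X] [CommRing Y] [CommRing Z]
    [Algebra K X] [Algebra K Y] [Algebra K Z] (i : X →ₐ[K] Y) (hi : Function.Injective i)
    (g : Z →ₐ[K] Y) (hg : ∀ z, g z ∈ i.range) (z : Z) : i (liftAlgHom i hi g hg z) = g z := by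
  have h := (AlgEquiv.ofInjective i hi).apply_symm_apply ((g.codRestrict i.range hg) z)
  exact congrArg Subtype.val h

section MapTensor

variable {K L : Type*} [Field K] [Field L] [Algebra K L]
  {A A' A'' B B' B'' : Type*} [CommRing A] [Algebra K A] [CommRing A'] [Algebra K A']
  [CommRing A''] [Algebra K A'']
  [CommRing B] [Algebra K B] [Algebra L B] [IsScalarTower K L B]
  [CommRing B'] [Algebra K B'] [Algebra L B'] [IsScalarTower K L B']
  [CommRing B''] [Algebra K B''] [Algebra L B''] [IsScalarTower K L B'']

theorem mapTensor_assoc (f : A →ₐ[K] B) (g : A' →ₐ[K] B') (h : A'' →ₐ[K] B'')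
    (x : (A ⊗[K] A') ⊗[K] A'') :
    mapTensor L f (mapTensor L g h) (Algebra.TensorProduct.assoc K K K A A' A'' x) =
      Algebra.TensorProduct.assoc L L L B B' B'' (mapTensor L (mapTensor L f g) h x) := by
  induction x with
  | zero => simp
  | add x y hx hy => simp only [map_add, hx, hy]
  | tmul x z =>
    induction x with
    | zero => simp
    | add x y hx hy => simp only [map_add, add_tmul, hx, hy]
    | tmul x y => simp

theorem mapTensor_map_left (f : A →ₐ[K] B) (g : A' →ₐ[K] B') (h : A'' →ₐ[K] B'')
    (φ : A →ₐ[K] A'') (ψ : B →ₐ[L] B'') (hc : ∀ a, h (φ a) = ψ (f a)) (x : A ⊗[K] A') :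
    mapTensor L h g (Algebra.TensorProduct.map φ (.id K A') x) =
      Algebra.TensorProduct.map ψ (.id L B') (mapTensor L f g x) := by
  induction x with
  | zero => simp
  | add x y hx hy => simp only [map_add, hx, hy]
  | tmul x y => simp [hc]

theorem mapTensor_map_right (f : A →ₐ[K] B) (g : A' →ₐ[K] B') (h : A'' →ₐ[K] B'')
    (φ : A' →ₐ[K] A'') (ψ : B' →ₐ[L] B'') (hc : ∀ a, h (φ a) = ψ (g a)) (x : A ⊗[K] A') :
    mapTensor L f h (Algebra.TensorProduct.map (.id K A) φ x) =
      Algebra.TensorProduct.map (.id L B) ψ (mapTensor L f g x) := by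
  induction x with
  | zero => simp
  | add x y hx hy => simp only [map_add, hx, hy]
  | tmul x y => simp [hc]

theorem apply_rid_eq (f : A →ₐ[K] B) (x : A ⊗[K] K) :
    f (Algebra.TensorProduct.rid K K A x) =
      Algebra.TensorProduct.rid L L B (mapTensor L f (Algebra.ofId K L) x) := by
  induction x with
  | zero => simp
  | add x y hx hy => simp only [map_add, hx, hy]
  | tmul x y => simp [Algebra.ofId_apply]

theorem apply_lid_eq (f : A →ₐ[K] B) (x : K ⊗[K] A) :
    f (Algebra.TensorProduct.lid K A x) =
      Algebra.TensorProduct.lid L B (mapTensor L (Algebra.ofId K L) f x) := by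
  induction x with
  | zero => simp
  | add x y hx hy => simp only [map_add, hx, hy]
  | tmul x y => simp [Algebra.ofId_apply]

end MapTensor

variable {K L Q B : Type*} [Field K] [Field L] [Algebra K L] [Group Q] [CommRing B]
  [HopfAlgebra L B] [Algebra K B] [IsScalarTower K L B]

/-- Two semilinear actions on a Hopf algebra `B` over `L`: the second one by automorphisms of the
Hopf algebra, the first one such that the comultiplication is equivariant as a coaction of `B` with
the second action. -/
structure IsTwistedAction (σ : Q →* (L ≃ₐ[K] L)) (s s₀ : Q →* (B ≃ₐ[K] B)) : Prop where
  map_smul : ∀ q (l : L) b, s q (l • b) = σ q l • s q b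
  map_smul₀ : ∀ q (l : L) b, s₀ q (l • b) = σ q l • s₀ q b
  comul_mem : ∀ x : invariantSubalgebra s,
    Bialgebra.comulAlgHom L B x.1 ∈ (tensorVal L s s₀).range
  comul_mem₀ : ∀ x : invariantSubalgebra s₀,
    Bialgebra.comulAlgHom L B x.1 ∈ (tensorVal L s₀ s₀).range
  counit_apply : ∀ q x, Bialgebra.counitAlgHom L B (s₀ q x) = σ q (Bialgebra.counitAlgHom L B x)
  antipode_apply : ∀ q x, HopfAlgebra.antipode L (s₀ q x) = s₀ q (HopfAlgebra.antipode L x)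

variable {σ : Q →* (L ≃ₐ[K] L)} {s s₀ : Q →* (B ≃ₐ[K] B)}

theorem IsTwistedAction.untwisted (hs : IsTwistedAction σ s s₀) : IsTwistedAction σ s₀ s₀ where
  map_smul := hs.map_smul₀
  map_smul₀ := hs.map_smul₀
  comul_mem := hs.comul_mem₀
  comul_mem₀ := hs.comul_mem₀
  counit_apply := hs.counit_apply
  antipode_apply := hs.antipode_apply

theorem tensorVal_injective [Finite Q] (hs : IsTwistedAction σ s s₀) (hσ : IsGaloisAction σ) :
    Function.Injective (tensorVal L s s₀) :=
  injective_of_isBaseChange (isBaseChange_mapTensor L (isBaseChange_invariantSubalgebra hσ hs.map_smul) (isBaseChange_invariantSubalgebra hσ hs.map_smul₀))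

/-- The coaction on the invariants of a twisted group algebra of the invariants of the untwisted
one. -/
noncomputable def coaction [Finite Q] (hs : IsTwistedAction σ s s₀) (hσ : IsGaloisAction σ) :
    invariantSubalgebra s →ₐ[K] invariantSubalgebra s ⊗[K] invariantSubalgebra s₀ :=
  liftAlgHom (tensorVal L s s₀) (tensorVal_injective hs hσ)
    (((Bialgebra.comulAlgHom L B).restrictScalars K).comp
      (invariantSubalgebra s).val)
    hs.comul_mem

variable [Finite Q] (hs : IsTwistedAction σ s s₀) (hσ : IsGaloisAction σ)

theorem tensorVal_coaction (x : invariantSubalgebra s) :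
    tensorVal L s s₀ (coaction hs hσ x) =
      Bialgebra.comulAlgHom L B x.1 :=
  liftAlgHom_spec _ _ _ _ x

/-- The triple tensor product of invariants over `K` embeds in `B ⊗ (B ⊗ B)` over `L`, where the
identity is the coassociativity of `B`. -/
theorem coaction_coassoc : (Algebra.TensorProduct.assoc K K K _ _ _).toAlgHom.comp
      ((Algebra.TensorProduct.map (coaction hs hσ) (AlgHom.id K _)).comp
        (coaction hs hσ)) =
    (Algebra.TensorProduct.map (AlgHom.id K _) (coaction hs.untwisted hσ)).comp
      (coaction hs hσ) := by
  ext x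
  have hinj : Function.Injective (mapTensor L (invariantSubalgebra s).val (tensorVal L s₀ s₀)) :=
    injective_of_isBaseChange (isBaseChange_mapTensor L (isBaseChange_invariantSubalgebra hσ hs.map_smul)
      (isBaseChange_mapTensor L (isBaseChange_invariantSubalgebra hσ hs.map_smul₀) (isBaseChange_invariantSubalgebra hσ hs.map_smul₀)))
  apply hinj
  change mapTensor L _ _ (Algebra.TensorProduct.assoc K K K _ _ _ (Algebra.TensorProduct.map
    (coaction hs hσ) (AlgHom.id K _) (coaction hs hσ x))) =
    mapTensor L _ _ (Algebra.TensorProduct.map (AlgHom.id K _) (coaction hs.untwisted hσ)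
      (coaction hs hσ x))
  rw [mapTensor_assoc, mapTensor_map_left (invariantSubalgebra s).val _ _ _
    (Bialgebra.comulAlgHom L B) (fun y => tensorVal_coaction hs hσ y),
    mapTensor_map_right _ (invariantSubalgebra s₀).val _ _
    (Bialgebra.comulAlgHom L B) (fun y => tensorVal_coaction hs.untwisted hσ y),
    tensorVal_coaction]
  exact Coalgebra.coassoc_apply (R := L) x.1

/-- The counit of the invariants of the untwisted group algebra. -/
noncomputable def invariantCounit (hs : IsTwistedAction σ s s₀)
    (hσ : IsGaloisAction σ) : invariantSubalgebra s₀ →ₐ[K] K :=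
  liftAlgHom (Algebra.ofId K L) (algebraMap K L).injective
    (((Bialgebra.counitAlgHom L B).restrictScalars K).comp
      (invariantSubalgebra s₀).val)
    (fun x => hσ.mem_range _ fun q => by
      change σ q (Bialgebra.counitAlgHom L B x.1) = Bialgebra.counitAlgHom L B x.1
      rw [← hs.counit_apply, x.2 q])

omit [Finite Q] in
theorem invariantCounit_spec (x : invariantSubalgebra s₀) :
    Algebra.ofId K L (invariantCounit hs hσ x) =
      Bialgebra.counitAlgHom L B x.1 :=
  liftAlgHom_spec _ _ _ _ x

/-- Compared inside `B`, where it is the counit axiom of the Hopf algebra `B` over `L`. -/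
theorem coaction_counit : (Algebra.TensorProduct.rid K K _).toAlgHom.comp
      ((Algebra.TensorProduct.map (AlgHom.id K _) (invariantCounit hs hσ)).comp
        (coaction hs hσ)) = AlgHom.id K _ := by
  ext x
  change (invariantSubalgebra s).val (Algebra.TensorProduct.rid K K _ (Algebra.TensorProduct.map
    (AlgHom.id K _) (invariantCounit hs hσ) (coaction hs hσ x))) = x.1
  rw [apply_rid_eq (L := L), mapTensor_map_right _ (invariantSubalgebra s₀).val _ _
    (Bialgebra.counitAlgHom L B) (fun y => invariantCounit_spec hs hσ y),
    tensorVal_coaction]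
  have h := Coalgebra.lTensor_counit_comul (R := L) x.1
  exact (congrArg (Algebra.TensorProduct.rid L L B) h).trans (by simp)

theorem coaction_counit_left : (Algebra.TensorProduct.lid K _).toAlgHom.comp
      ((Algebra.TensorProduct.map (invariantCounit hs hσ) (AlgHom.id K _)).comp
        (coaction hs.untwisted hσ)) = AlgHom.id K _ := by
  ext x
  change (invariantSubalgebra s₀).val (Algebra.TensorProduct.lid K _ (Algebra.TensorProduct.map
    (invariantCounit hs hσ) (AlgHom.id K _) (coaction hs.untwisted hσ x))) = x.1
  rw [apply_lid_eq (L := L), mapTensor_map_left (invariantSubalgebra s₀).val _ _ _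
    (Bialgebra.counitAlgHom L B) (fun y => invariantCounit_spec hs hσ y),
    tensorVal_coaction]
  have h := Coalgebra.rTensor_counit_comul (R := L) x.1
  exact (congrArg (Algebra.TensorProduct.lid L B) h).trans (by simp)

/-- The antipode of the invariants of the untwisted group algebra. -/
noncomputable def invariantAntipode (hs : IsTwistedAction σ s s₀) :
    invariantSubalgebra s₀ →ₗ[K] invariantSubalgebra s₀ where
  toFun x := ⟨HopfAlgebra.antipode L x.1, fun q => by rw [← hs.antipode_apply, x.2 q]⟩
  map_add' x y := Subtype.ext (by simp)
  map_smul' c x := Subtype.ext (by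
    change HopfAlgebra.antipode L (c • x.1) = c • HopfAlgebra.antipode L x.1
    rw [← algebraMap_smul L c, map_smul, algebraMap_smul])

/-- The Hopf algebra of a torus split by `L`: the invariants of the group algebra of its character
group. -/
noncomputable abbrev invariantHopf : HopfAlgebra K (invariantSubalgebra s₀) :=
  letI : Bialgebra K (invariantSubalgebra s₀) :=
    Bialgebra.ofAlgHom (coaction hs.untwisted hσ) (invariantCounit hs hσ)
      (coaction_coassoc hs.untwisted hσ)
      (by
        have h := coaction_counit_left hs hσ
        ext1 x
        apply (Algebra.TensorProduct.lid K _).injective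
        exact (DFunLike.congr_fun h x).trans (by simp))
      (by
        have h := coaction_counit hs.untwisted hσ
        ext1 x
        apply (Algebra.TensorProduct.rid K K _).injective
        exact (DFunLike.congr_fun h x).trans (by simp))
  { antipode := invariantAntipode hs
    mul_antipode_rTensor_comul := by
      have h1 : ∀ z, (invariantSubalgebra s₀).val (LinearMap.mul' K _
          ((invariantAntipode hs).rTensor _ z)) =
          LinearMap.mul' L _ ((HopfAlgebra.antipode L).rTensor _ (tensorVal L s₀ s₀ z)) := by
        intro z
        induction z with
        | zero => simp
        | add x y hx hy => simp only [map_add, hx, hy]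
        | tmul x y => simp [invariantAntipode]
      refine LinearMap.ext fun x => Subtype.ext ?_
      refine (h1 (coaction hs.untwisted hσ x)).trans ?_
      rw [tensorVal_coaction]
      refine (HopfAlgebra.mul_antipode_rTensor_comul_apply x.1).trans ?_
      change algebraMap L _ (Bialgebra.counitAlgHom L B x.1) =
        algebraMap K _ (invariantCounit hs hσ x)
      rw [← invariantCounit_spec hs hσ, Algebra.ofId_apply, ← IsScalarTower.algebraMap_apply]
    mul_antipode_lTensor_comul := by
      have h1 : ∀ z, (invariantSubalgebra s₀).val (LinearMap.mul' K _
          ((invariantAntipode hs).lTensor _ z)) =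
          LinearMap.mul' L _ ((HopfAlgebra.antipode L).lTensor _ (tensorVal L s₀ s₀ z)) := by
        intro z
        induction z with
        | zero => simp
        | add x y hx hy => simp only [map_add, hx, hy]
        | tmul x y => simp [invariantAntipode]
      refine LinearMap.ext fun x => Subtype.ext ?_
      refine (h1 (coaction hs.untwisted hσ x)).trans ?_
      rw [tensorVal_coaction]
      refine (HopfAlgebra.mul_antipode_lTensor_comul_apply x.1).trans ?_
      change algebraMap L _ (Bialgebra.counitAlgHom L B x.1) =
        algebraMap K _ (invariantCounit hs hσ x)
      rw [← invariantCounit_spec hs hσ, Algebra.ofId_apply, ← IsScalarTower.algebraMap_apply] }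

end Coaction

theorem map_comul_one_tmul {K Ω H B' : Type*} [Field K] [Field Ω] [Algebra K Ω] [CommRing H]
    [Bialgebra K H] [CommRing B'] [Algebra Ω B'] [Algebra K B'] [IsScalarTower K Ω B']
    (e : Ω ⊗[K] H →ₐ[Ω] B') (φ : H →ₐ[K] B') (he : ∀ y, e (1 ⊗ₜ y) = φ y) (y : H) :
    Algebra.TensorProduct.map e e (Coalgebra.comul (R := Ω) ((1 : Ω) ⊗ₜ[K] y)) =
      mapTensor Ω φ φ (Coalgebra.comul (R := K) y) := by
  simp [← (Coalgebra.Repr.arbitrary K y).eq, tmul_sum, he]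

/-- The map `x ⊗ y ↦ (x ⊗ 1) Δ(y)`. -/
noncomputable def comulShear (L B : Type*) [Field L] [CommRing B] [Bialgebra L B] :
    B ⊗[L] B →ₐ[L] B ⊗[L] B :=
  Algebra.TensorProduct.productMap Algebra.TensorProduct.includeLeft (Bialgebra.comulAlgHom L B)

theorem bijective_of_isBaseChange_algHom {K L A A' B B' : Type*} [Field K] [Field L] [Algebra K L]
    [CommRing A] [Algebra K A] [CommRing A'] [Algebra K A']
    [CommRing B] [Algebra K B] [Algebra L B] [IsScalarTower K L B]
    [CommRing B'] [Algebra K B'] [Algebra L B'] [IsScalarTower K L B']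
    {f : A →ₐ[K] B} {g : A' →ₐ[K] B'} (hf : IsBaseChange L f.toLinearMap)
    (hg : IsBaseChange L g.toLinearMap) (φ : A →ₐ[K] A') (ψ : B →ₐ[L] B')
    (h : ∀ a, ψ (f a) = g (φ a)) (hψ : Function.Bijective ψ) : Function.Bijective φ :=
  bijective_of_isBaseChange hf hg φ.toLinearMap ψ.toLinearMap h hψ

/-- Over `L` the torsor becomes trivial: the map turns into `comulShear L B`, and its bijectivity
descends to `K`. -/
theorem bijective_productMap_of_isBaseChange {K L A H B : Type*} [Field K] [Field L] [Algebra K L]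
    [CommRing A] [Algebra K A] [CommRing H] [Algebra K H]
    [CommRing B] [Algebra K B] [Bialgebra L B] [IsScalarTower K L B]
    {v : A →ₐ[K] B} {w : H →ₐ[K] B} (hv : IsBaseChange L v.toLinearMap)
    (hw : IsBaseChange L w.toLinearMap) (ρ : A →ₐ[K] A ⊗[K] H)
    (hρ : ∀ a, mapTensor L v w (ρ a) = Bialgebra.comulAlgHom L B (v a))
    (hB : Function.Bijective (comulShear L B)) :
    Function.Bijective (Algebra.TensorProduct.productMap Algebra.TensorProduct.includeLeft ρ :
      A ⊗[K] A →ₐ[K] A ⊗[K] H) := by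
  have hc : ∀ x, comulShear L B (mapTensor L v v x) = mapTensor L v w
      ((Algebra.TensorProduct.productMap Algebra.TensorProduct.includeLeft ρ :
        A ⊗[K] A →ₐ[K] A ⊗[K] H) x) := by
    intro x
    induction x with
    | zero => simp only [map_zero]
    | add x y hx hy => simp only [map_add, hx, hy]
    | tmul x y =>
      simp only [comulShear, mapTensor_tmul, Algebra.TensorProduct.productMap_apply_tmul,
        Algebra.TensorProduct.includeLeft_apply, map_mul, map_one, hρ]
  exact bijective_of_isBaseChange_algHom (isBaseChange_mapTensor L hv hv)
    (isBaseChange_mapTensor L hv hw) _ _ hc hB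

/-! ### Torsors from twisted forms, and their splitting -/

section Torsor

variable {K L B : Type u} {Q : Type*} [Field K] [Field L] [Algebra K L] [Group Q] [Finite Q]
  [CommRing B] [HopfAlgebra L B] [Algebra K B] [IsScalarTower K L B]
  {σ : Q →* (L ≃ₐ[K] L)} {s s₀ : Q →* (B ≃ₐ[K] B)}

theorem bijective_productMap_coaction (hs : IsTwistedAction σ s s₀) (hσ : IsGaloisAction σ)
    (hB : Function.Bijective (comulShear L B)) :
    Function.Bijective (Algebra.TensorProduct.productMap Algebra.TensorProduct.includeLeft
      (coaction hs hσ) : invariantSubalgebra s ⊗[K] invariantSubalgebra s →ₐ[K]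
        invariantSubalgebra s ⊗[K] invariantSubalgebra s₀) :=
  bijective_productMap_of_isBaseChange (isBaseChange_invariantSubalgebra hσ hs.map_smul)
    (isBaseChange_invariantSubalgebra hσ hs.map_smul₀) _ (tensorVal_coaction hs hσ) hB

theorem isTorsor_coaction [Nontrivial B] (hs : IsTwistedAction σ s s₀) (hσ : IsGaloisAction σ)
    (hB : Function.Bijective (comulShear L B)) :
    @IsTorsor K (invariantSubalgebra s₀) (invariantSubalgebra s) _ _ (invariantHopf hs hσ) _ _
      (coaction hs hσ) := by
  refine @IsTorsor.mk K (invariantSubalgebra s₀) (invariantSubalgebra s) _ _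
    (invariantHopf hs hσ) _ _ (coaction hs hσ) inferInstance (coaction_coassoc hs hσ)
    (coaction_counit hs hσ) (bijective_productMap_coaction hs hσ hB)

variable {Ω B' : Type u} [Field Ω] [Algebra K Ω] [Algebra L Ω] [IsScalarTower K L Ω]
  [CommRing B']

/-- The base change of the algebra of invariants to a field containing the splitting field. -/
noncomputable def baseChangeInvariants [Algebra Ω B'] [Algebra L B'] [IsScalarTower L Ω B']
    (hs : ∀ q (l : L) b, s q (l • b) = σ q l • s q b)
    (hσ : IsGaloisAction σ) (β : B →ₐ[L] B') (hβ : IsBaseChange Ω β.toLinearMap) :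
    Ω ⊗[K] invariantSubalgebra s ≃ₐ[Ω] B' :=
  letI : Algebra K B' := Algebra.compHom B' (algebraMap K L)
  haveI : IsScalarTower K L B' := .of_algebraMap_eq fun _ => rfl
  haveI : IsScalarTower K Ω B' := .of_algebraMap_eq fun c => by
    rw [IsScalarTower.algebraMap_apply K L Ω, ← IsScalarTower.algebraMap_apply L Ω B']; rfl
  AlgEquiv.ofBijective
    (Algebra.TensorProduct.productLeftAlgHom (Algebra.ofId Ω B')
      ((β.restrictScalars K).comp (invariantSubalgebra s).val)) (by
    have h := (isBaseChange_invariantSubalgebra hσ hs).comp hβ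
    convert h.equiv.bijective using 1
    ext x
    induction x with
    | zero => simp
    | add x y hx hy => rw [map_add, hx, hy, map_add]
    | tmul x y => simp [IsBaseChange.equiv_tmul, Algebra.smul_def, Algebra.ofId_apply])

theorem baseChangeInvariants_tmul [Algebra Ω B'] [Algebra L B'] [IsScalarTower L Ω B']
    (hs : ∀ q (l : L) b, s q (l • b) = σ q l • s q b)
    (hσ : IsGaloisAction σ) (β : B →ₐ[L] B') (hβ : IsBaseChange Ω β.toLinearMap) (x : Ω)
    (y : invariantSubalgebra s) :
    baseChangeInvariants hs hσ β hβ (x ⊗ₜ y) = x • β y := by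
  rw [Algebra.smul_def]
  rfl

/-- Extending scalars from `K` to `L` turns the untwisted invariants into `B`, and from `L` to `Ω`
turns `B` into `B'`. With `B'` the group algebra of `ℤⁿ` over an algebraic closure, this is what
shows that the invariants define a torus. -/
theorem nonempty_bialgEquiv [Bialgebra Ω B'] [Algebra L B'] [IsScalarTower L Ω B']
    (hs : IsTwistedAction σ s s₀)
    (hσ : IsGaloisAction σ) (β : B →ₐ[L] B') (hβ : IsBaseChange Ω β.toLinearMap)
    (hΔ : ∀ b, Bialgebra.comulAlgHom Ω B' (β b) = mapTensor Ω β β (Bialgebra.comulAlgHom L B b))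
    (hε : ∀ b, Bialgebra.counitAlgHom Ω B' (β b) =
      algebraMap L Ω (Bialgebra.counitAlgHom L B b)) :
    letI := invariantHopf hs hσ
    Nonempty (Ω ⊗[K] invariantSubalgebra s₀ ≃ₐc[Ω] B') := by
  let := invariantHopf hs hσ
  let : Algebra K B' := Algebra.compHom B' (algebraMap K L)
  have : IsScalarTower K L B' := .of_algebraMap_eq fun _ => rfl
  have : IsScalarTower K Ω B' := .of_algebraMap_eq fun c => by
    rw [IsScalarTower.algebraMap_apply K L Ω, ← IsScalarTower.algebraMap_apply L Ω B']; rfl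
  let e := baseChangeInvariants hs.map_smul₀ hσ β hβ
  have he : ∀ x y, e (x ⊗ₜ y) = x • β y := baseChangeInvariants_tmul hs.map_smul₀ hσ β hβ
  refine ⟨BialgEquiv.ofAlgEquiv e ?_ ?_⟩
  · refine Algebra.TensorProduct.ext (by ext) ?_
    ext y
    change Bialgebra.counitAlgHom Ω B' (e (1 ⊗ₜ y)) = 
      Coalgebra.counit (R := Ω) ((1 : Ω) ⊗ₜ[K] y)
    rw [he, one_smul, hε, TensorProduct.counit_tmul]
    have h := invariantCounit_spec hs hσ y
    rw [← h, Algebra.ofId_apply, ← IsScalarTower.algebraMap_apply, Algebra.algebraMap_eq_smul_one]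
    rfl
  · refine Algebra.TensorProduct.ext (by ext) ?_
    ext y
    change Algebra.TensorProduct.map e.toAlgHom e.toAlgHom (Coalgebra.comul (R := Ω) ((1 : Ω) ⊗ₜ[K] y)) =
      Bialgebra.comulAlgHom Ω B' (e (1 ⊗ₜ y))
    -- Both sides are reduced to the image of the descended comultiplication of `y`, after which
    -- they can be compared on pure tensors.
    rw [he, one_smul, hΔ, ← tensorVal_coaction hs.untwisted hσ,
      map_comul_one_tmul e.toAlgHom ((β.restrictScalars K).comp (invariantSubalgebra s₀).val)
        (fun y => (he 1 y).trans (one_smul _ _))]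
    change _ = mapTensor Ω β β (tensorVal L s₀ s₀ (Coalgebra.comul (R := K) y))
    generalize Coalgebra.comul (R := K) y = z
    induction z with
    | zero => simp only [map_zero]
    | add x y hx hy => simp only [map_add, hx, hy]
    | tmul x z => simp only [mapTensor_tmul]; rfl

end Torsor

/-! ### Monomial actions on group algebras -/

section Monomial

variable {K L Q C : Type*} [Field K] [Field L] [Algebra K L] [Group Q] [AddCommGroup C]

/-- An action on `L[C]`, semilinear over an action on `L`, permuting the monomials up to factors
in `L`. -/
def IsMonomialAction (σ : Q →* (L ≃ₐ[K] L)) (a : Q → C → C) (f : Q → C → L)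
    (s : Q →* (AddMonoidAlgebra L C ≃ₐ[K] AddMonoidAlgebra L C)) : Prop :=
  ∀ q c l, s q (.single c l) = .single (a q c) (σ q l * f q c)

theorem IsMonomialAction.map_smul {σ : Q →* (L ≃ₐ[K] L)} {a : Q → C → C} {f : Q → C → L}
    {s : Q →* (AddMonoidAlgebra L C ≃ₐ[K] AddMonoidAlgebra L C)}
    (hs : IsMonomialAction σ a f s) (q : Q) (l : L)
    (b : AddMonoidAlgebra L C) : s q (l • b) = σ q l • s q b := by
  induction b using AddMonoidAlgebra.induction_linear with
  | zero => simp
  | add x y hx hy => rw [smul_add, map_add, hx, hy, map_add, smul_add]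
  | single c m => simp [hs q, mul_assoc]

omit [AddCommGroup C] in
theorem comul_single_eq (c : C) (l : L) :
    Coalgebra.comul (R := L) (AddMonoidAlgebra.single c l) =
      AddMonoidAlgebra.single c l ⊗ₜ[L] AddMonoidAlgebra.single c 1 := by
  rw [AddMonoidAlgebra.comul_single, CommSemiring.comul_apply, TensorProduct.map_tmul]
  simp only [AddMonoidAlgebra.lsingle_apply]
  rw [← mul_one l, ← smul_eq_mul, ← AddMonoidAlgebra.smul_single, tmul_smul, smul_tmul']

variable {σ : Q →* (L ≃ₐ[K] L)} {a : Q →* (C ≃ₗ[ℤ] C)} {f : Q → C → L}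
  {s : Q →* (AddMonoidAlgebra L C ≃ₐ[K] AddMonoidAlgebra L C)}

variable (σ a) in
/-- The untwisted semilinear action on a group algebra. -/
noncomputable def semilinearAction :
    Q →* (AddMonoidAlgebra L C ≃ₐ[K] AddMonoidAlgebra L C) where
  toFun q := (AddMonoidAlgebra.domCongr K L (a q).toAddEquiv).trans
    (AddMonoidAlgebra.mapAlgAut K C (σ q))
  map_one' := by
    refine AlgEquiv.ext fun x => ?_
    induction x using AddMonoidAlgebra.induction_linear with
    | zero => simp
    | add x y hx hy => rw [map_add, map_add, hx, hy]
    | single c m => simp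
  map_mul' p q := by
    refine AlgEquiv.ext fun x => ?_
    induction x using AddMonoidAlgebra.induction_linear with
    | zero => simp
    | add x y hx hy => rw [map_add, map_add, hx, hy]
    | single c m => simp

theorem isMonomialAction_semilinearAction :
    IsMonomialAction σ (fun q => a q) 1 (semilinearAction σ a) := by
  intro q c l
  simp [semilinearAction]

/-- A `K`-basis of the untwisted invariants is an `L`-basis of `L[C]`, hence a basis of `L[C] ⊗
L[C]` over the left factor. Monomials are group-like, so comultiplication intertwines `s` with the
action of `s` on the left factor and of the untwisted action on the right. Since the basis is fixed,
the coordinates of the comultiplication of an `s`-invariant are again `s`-invariant. -/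
theorem comul_mem_range_tensorVal [Finite Q] (hs : IsMonomialAction σ (fun q => a q) f s)
    (hσ : IsGaloisAction σ) (x : invariantSubalgebra s) :
    Bialgebra.comulAlgHom L _ x.1 ∈ (tensorVal L s (semilinearAction σ a)).range := by
  have hs₀ := isMonomialAction_semilinearAction (σ := σ) (a := a)
  have hb := isBaseChange_invariantSubalgebra hσ hs₀.map_smul
  let h := Module.Free.chooseBasis K (invariantSubalgebra (semilinearAction σ a))
  let hL := hb.basis h
  have hhL : ∀ i, hL i = (h i).1 := fun i => hb.basis_apply h i
  let T := Algebra.TensorProduct.basis (AddMonoidAlgebra L C) hL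
  have hinv : ∀ i q (y : AddMonoidAlgebra L C),
      hL.repr (semilinearAction σ a q y) i = σ q (hL.repr y i) := by
    intro i q y
    induction hL.mem_span y using Submodule.span_induction with
    | zero => simp
    | add x y _ _ hx hy => simp [hx, hy]
    | smul l x _ hx => rw [hs₀.map_smul]; simp [hx]
    | mem x hx =>
      obtain ⟨j, rfl⟩ := hx
      have h1 : semilinearAction σ a q (hL j) = hL j := by rw [hhL]; exact (h j).2 q
      classical
      rw [h1, hL.repr_self, Finsupp.single_apply]
      split_ifs <;> simp
  have key : ∀ i, T.repr (Coalgebra.comul (R := L) x.1) i ∈ invariantSubalgebra s := by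
    intro i q
    have h1 : ∀ y : AddMonoidAlgebra L C, s q (T.repr (Coalgebra.comul (R := L) y) i) =
        T.repr (Coalgebra.comul (R := L) (s q y)) i := by
      intro y
      induction y using AddMonoidAlgebra.induction_linear with
      | zero => simp
      | add x y hx hy => simp only [map_add, Finsupp.add_apply, hx, hy]
      | single c m =>
        rw [hs q, comul_single_eq, comul_single_eq, Algebra.TensorProduct.basis_repr_tmul,
          Algebra.TensorProduct.basis_repr_tmul]
        have h2 : hL.repr (AddMonoidAlgebra.single (a q c) 1) i =
            σ q (hL.repr (AddMonoidAlgebra.single c 1) i) := by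
          rw [← hinv, hs₀]
          simp
        simp only [Finsupp.smul_apply, Finsupp.mapRange_apply, h2, smul_eq_mul]
        rw [← Algebra.commutes, ← Algebra.smul_def, ← Algebra.commutes, ← Algebra.smul_def,
          hs.map_smul, hs q]
    rw [h1, x.2 q]
  change Coalgebra.comul (R := L) x.1 ∈ _
  rw [← T.linearCombination_repr (Coalgebra.comul (R := L) x.1), Finsupp.linearCombination_apply]
  refine Subalgebra.sum_mem _ fun i _ => ?_
  refine ⟨⟨_, key i⟩ ⊗ₜ h i, ?_⟩
  simp [T, hhL, TensorProduct.smul_tmul']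

theorem IsMonomialAction.isTwistedAction [Finite Q]
    (hs : IsMonomialAction σ (fun q => a q) f s) (hσ : IsGaloisAction σ) :
    IsTwistedAction σ s (semilinearAction σ a) where
  map_smul := hs.map_smul
  map_smul₀ := isMonomialAction_semilinearAction.map_smul
  comul_mem := comul_mem_range_tensorVal hs hσ
  comul_mem₀ := comul_mem_range_tensorVal isMonomialAction_semilinearAction hσ
  counit_apply q x := by
    change Coalgebra.counit (R := L) (A := AddMonoidAlgebra L C) _ =
      σ q (Coalgebra.counit (R := L) (A := AddMonoidAlgebra L C) x)
    induction x using AddMonoidAlgebra.induction_linear with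
    | zero => simp
    | add x y hx hy => simp only [map_add, hx, hy]
    | single c m => simp [semilinearAction]
  antipode_apply q x := by
    induction x using AddMonoidAlgebra.induction_linear with
    | zero => simp
    | add x y hx hy => simp only [map_add, hx, hy]
    | single c m => simp [semilinearAction]

/-- This is the map `(g, h) ↦ (g, g h)` on a split torus, whose inverse needs only inversion of
monomials: `δ` sends the monomial of `c` to that of `-c` tensor that of `c`. -/
theorem bijective_comulShear (L C : Type*) [Field L] [AddCommGroup C] :
    Function.Bijective (comulShear L (AddMonoidAlgebra L C)) := by
  let δ : AddMonoidAlgebra L C →ₐ[L] AddMonoidAlgebra L C ⊗[L] AddMonoidAlgebra L C :=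
    AddMonoidAlgebra.lift L _ C
      { toFun := fun c => AddMonoidAlgebra.single (-c.toAdd) 1 ⊗ₜ
          AddMonoidAlgebra.single c.toAdd 1
        map_one' := by
          simp [AddMonoidAlgebra.one_def, Algebra.TensorProduct.one_def]
        map_mul' := fun c d => by
          simp [AddMonoidAlgebra.single_mul_single, add_comm] }
  let η : AddMonoidAlgebra L C ⊗[L] AddMonoidAlgebra L C →ₐ[L]
      AddMonoidAlgebra L C ⊗[L] AddMonoidAlgebra L C :=
    Algebra.TensorProduct.productMap Algebra.TensorProduct.includeLeft δ
  have h1 : η.comp (comulShear L (AddMonoidAlgebra L C)) = AlgHom.id L _ := by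
    refine Algebra.TensorProduct.ext ?_ ?_ <;>
    · ext c
      simp [η, δ, comulShear, AddMonoidAlgebra.single_mul_single, ← AddMonoidAlgebra.one_def]
  have h2 : (comulShear L (AddMonoidAlgebra L C)).comp η = AlgHom.id L _ := by
    refine Algebra.TensorProduct.ext ?_ ?_ <;>
    · ext c
      simp [η, δ, comulShear, AddMonoidAlgebra.single_mul_single, ← AddMonoidAlgebra.one_def]
  exact Function.bijective_iff_has_inverse.mpr
    ⟨η, fun x => DFunLike.congr_fun h1 x, fun x => DFunLike.congr_fun h2 x⟩

/-! ### Splitting over a larger field -/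

section Split

variable {Ω D : Type*} [Field Ω] [Algebra L Ω] [AddCommGroup D] (e : C ≃+ D)

variable (L Ω) in
/-- The extension of scalars of a group algebra, together with an isomorphism of groups. -/
noncomputable def mapGroupAlgebra : AddMonoidAlgebra L C →ₐ[L] AddMonoidAlgebra Ω D :=
  ((AddMonoidAlgebra.domCongr L Ω e).toAlgHom).comp
    (AddMonoidAlgebra.mapAlgHom C (Algebra.ofId L Ω))

theorem mapGroupAlgebra_single (c : C) (l : L) :
    mapGroupAlgebra L Ω e (.single c l) = .single (e c) (algebraMap L Ω l) := by
  simp [mapGroupAlgebra, Algebra.ofId_apply]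

theorem isBaseChange_mapGroupAlgebra :
    IsBaseChange Ω (mapGroupAlgebra L Ω e).toLinearMap := by
  refine IsBaseChange.of_equiv ((AddMonoidAlgebra.scalarTensorEquiv L Ω).trans
    (AddMonoidAlgebra.domCongr Ω Ω e)).toLinearEquiv fun x => ?_
  simp [mapGroupAlgebra]
  rfl

theorem comulAlgHom_mapGroupAlgebra (b : AddMonoidAlgebra L C) :
    Bialgebra.comulAlgHom Ω _ (mapGroupAlgebra L Ω e b) =
      mapTensor Ω (mapGroupAlgebra L Ω e) (mapGroupAlgebra L Ω e)
        (Bialgebra.comulAlgHom L _ b) := by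
  induction b using AddMonoidAlgebra.induction_linear with
  | zero => simp
  | add x y hx hy => simp only [map_add, hx, hy]
  | single c m =>
    change Coalgebra.comul (R := Ω) (mapGroupAlgebra L Ω e (.single c m)) =
      mapTensor Ω _ _ (Coalgebra.comul (R := L) (AddMonoidAlgebra.single c m))
    rw [comul_single_eq, mapTensor_tmul, mapGroupAlgebra_single, mapGroupAlgebra_single,
      comul_single_eq, map_one]

theorem counitAlgHom_mapGroupAlgebra (b : AddMonoidAlgebra L C) :
    Bialgebra.counitAlgHom Ω _ (mapGroupAlgebra L Ω e b) =
      algebraMap L Ω (Bialgebra.counitAlgHom L _ b) := by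
  induction b using AddMonoidAlgebra.induction_linear with
  | zero => simp
  | add x y hx hy => simp only [map_add, hx, hy]
  | single c m =>
    change Coalgebra.counit (R := Ω) (mapGroupAlgebra L Ω e (.single c m)) =
      algebraMap L Ω (Coalgebra.counit (R := L) (AddMonoidAlgebra.single c m))
    rw [mapGroupAlgebra_single]
    simp

end Split

end Monomial

theorem IsGaloisAction.isAlgebraic {K L Q : Type*} [Field K] [Field L] [Algebra K L] [Group Q]
    [Finite Q] {σ : Q →* (L ≃ₐ[K] L)} (hσ : IsGaloisAction σ) : Algebra.IsAlgebraic K L := by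
  let : MulSemiringAction Q L := MulSemiringAction.compHom L σ
  have : SMulCommClass Q K L := ⟨fun q c l => _root_.map_smul (σ q) c l⟩
  have : Algebra.IsInvariant K L Q := ⟨fun l h => hσ.mem_range l h⟩
  have := Algebra.IsInvariant.isIntegral K L Q
  infer_instance

/-- The Artin–Tate argument: `B` is integral and of finite type, hence finite, over the invariants.
-/
theorem finiteType_invariantSubalgebra {K B Q : Type*} [Field K] [CommRing B] [Algebra K B]
    [Algebra.FiniteType K B] [Group Q] [Finite Q] (s : Q →* (B ≃ₐ[K] B)) :
    Algebra.FiniteType K (invariantSubalgebra s) := by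
  let : MulSemiringAction Q B := MulSemiringAction.compHom B s
  have : SMulCommClass Q (invariantSubalgebra s) B := ⟨fun q x b => by
    change s q (x.1 * b) = x.1 * s q b
    rw [map_mul, x.2 q]⟩
  have : Algebra.IsInvariant (invariantSubalgebra s) B Q := ⟨fun b hb => ⟨⟨b, hb⟩, rfl⟩⟩
  have : Algebra.IsIntegral (invariantSubalgebra s) B := Algebra.IsInvariant.isIntegral _ _ Q
  have : Algebra.FiniteType (invariantSubalgebra s) B :=
    Algebra.FiniteType.of_restrictScalars_finiteType K _ _
  have : Module.Finite (invariantSubalgebra s) B := Algebra.IsIntegral.finite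
  exact ⟨fg_of_fg_of_fg K _ _ ‹Algebra.FiniteType K B›.out (Module.finite_def.mp inferInstance)
    Subtype.val_injective⟩

theorem IsGaloisAction.finite {K L Q : Type*} [Field K] [Field L] [Algebra K L] [Group Q]
    [Finite Q] {σ : Q →* (L ≃ₐ[K] L)} (hσ : IsGaloisAction σ) : Module.Finite K L := by
  let : MulSemiringAction Q L := MulSemiringAction.compHom L σ
  have : IsGaloisGroup Q K L :=
    { faithful := ⟨fun {p q} h => hσ.injective (AlgEquiv.ext h)⟩
      commutes := ⟨fun q c l => _root_.map_smul (σ q) c l⟩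
      isInvariant := ⟨fun l h => hσ.mem_range l h⟩ }
  exact IsGaloisGroup.finiteDimensional Q K L

/-! ### The torsor of a monomial action -/

section Main

variable {K L C : Type u} {Q : Type*} [Field K] [Field L] [Algebra K L] [Group Q] [Finite Q]
  [AddCommGroup C] [Module.Free ℤ C] [Module.Finite ℤ C]
  {σ : Q →* (L ≃ₐ[K] L)} {a : Q →* (C ≃ₗ[ℤ] C)} {f : Q → C → L}
  {s : Q →* (AddMonoidAlgebra L C ≃ₐ[K] AddMonoidAlgebra L C)}

/-- The scalars `f` affect only the torsor; the torus is given by the action on exponents. It splits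
over `L`, which embeds in the algebraic closure because `L / K` is algebraic. -/
theorem IsMonomialAction.exists_isTorsor (hs : IsMonomialAction σ (fun q => a q) f s)
    (hσ : IsGaloisAction σ) :
    ∃ (H : Type u) (_ : CommRing H) (_ : HopfAlgebra K H)
      (ρ : invariantSubalgebra s →ₐ[K] invariantSubalgebra s ⊗[K] H), IsTorus K H ∧ IsTorsor ρ := by
  have := hσ.isAlgebraic
  let ι : L →ₐ[K] AlgebraicClosure K := IsAlgClosed.lift
  let := ι.toRingHom.toAlgebra
  have : IsScalarTower K L (AlgebraicClosure K) := .of_algebraMap_eq fun c => (ι.commutes c).symm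
  have ht := hs.isTwistedAction hσ
  let e := (Module.finBasis ℤ C).equivFun.toAddEquiv
  exact ⟨invariantSubalgebra (semilinearAction σ a), inferInstance, invariantHopf ht hσ,
    coaction ht hσ, ⟨_, nonempty_bialgEquiv ht hσ (mapGroupAlgebra L (AlgebraicClosure K) e)
      (isBaseChange_mapGroupAlgebra e) (comulAlgHom_mapGroupAlgebra e)
      (counitAlgHom_mapGroupAlgebra e)⟩, isTorsor_coaction ht hσ (bijective_comulShear L C)⟩

/-- The torsor has a point over `L`, so geometrically it is a split torus. This is the source of
geometric rationality. -/
theorem IsMonomialAction.exists_algEquiv (hs : IsMonomialAction σ (fun q => a q) f s)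
    (hσ : IsGaloisAction σ) : ∃ n : ℕ, Nonempty (AlgebraicClosure K ⊗[K] invariantSubalgebra s
      ≃ₐ[AlgebraicClosure K] AddMonoidAlgebra (AlgebraicClosure K) (Fin n → ℤ)) := by
  have := hσ.isAlgebraic
  let ι : L →ₐ[K] AlgebraicClosure K := IsAlgClosed.lift
  let := ι.toRingHom.toAlgebra
  have : IsScalarTower K L (AlgebraicClosure K) := .of_algebraMap_eq fun c => (ι.commutes c).symm
  let e := (Module.finBasis ℤ C).equivFun.toAddEquiv
  exact ⟨_, ⟨baseChangeInvariants hs.map_smul hσ (mapGroupAlgebra L (AlgebraicClosure K) e)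
      (isBaseChange_mapGroupAlgebra e)⟩⟩

end Main

/-! ### Affine varieties and birational maps -/

/-- The affine variety of a finitely generated domain. -/
noncomputable def affineVariety (k R : Type u) [Field k] [CommRing R] [IsDomain R] [Algebra k R]
    [Algebra.FiniteType k R] : Variety k :=
  haveI : LocallyOfFiniteType (Spec.map (CommRingCat.ofHom (algebraMap k R))) := by
    rw [HasRingHomProperty.Spec_iff (P := @LocallyOfFiniteType)]
    exact RingHom.finiteType_algebraMap.mpr inferInstance
  { scheme := Spec (CommRingCat.of R)
    hom := Spec.map (CommRingCat.ofHom (algebraMap k R)) }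

theorem isDominant_specMap {R S : Type u} [CommRing R] [IsDomain R] [CommRing S] [IsDomain S]
    (f : R →+* S) (hf : Function.Injective f) : IsDominant (Spec.map (CommRingCat.ofHom f)) :=
  ⟨(PrimeSpectrum.denseRange_comap_iff_ker_le_nilRadical f).mpr (by
    rw [(RingHom.injective_iff_ker_eq_bot f).mp hf]; exact bot_le)⟩

/-- Birationality over a base ring, for the spectra of two domains. -/
def SpecBirational (S A B : Type u) [CommRing S] [CommRing A] [CommRing B] [Algebra S A]
    [Algebra S B] : Prop :=
  Scheme.BirationalOver (Spec.map (CommRingCat.ofHom (algebraMap S A)))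
    (Spec.map (CommRingCat.ofHom (algebraMap S B)))

theorem specBirational_away (S : Type u) {A : Type u} (B : Type u) [CommRing S] [CommRing A]
    [CommRing B] [IsDomain A] [IsDomain B] [Algebra S A] [Algebra S B] [Algebra A B]
    [IsScalarTower S A B] (a : A) (ha : a ≠ 0) [IsLocalization.Away a B] :
    SpecBirational S A B := by
  have hinj : Function.Injective (algebraMap A B) :=
    IsLocalization.injective B (M := Submonoid.powers a)
      (powers_le_nonZeroDivisors_of_noZeroDivisors ha)
  have := isDominant_specMap _ hinj
  have : IsOpenImmersion (Spec.map (CommRingCat.ofHom (algebraMap A B))) :=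
    IsOpenImmersion.of_isLocalization a
  refine Scheme.BirationalOver.symm (Scheme.Hom.birationalOver
    (Spec.map (CommRingCat.ofHom (algebraMap A B))) _ _ ?_)
  rw [← Spec.map_comp, ← CommRingCat.ofHom_comp, ← IsScalarTower.algebraMap_eq]

theorem SpecBirational.symm {S A B : Type u} [CommRing S] [CommRing A] [CommRing B] [Algebra S A]
    [Algebra S B] (h : SpecBirational S A B) : SpecBirational S B A :=
  Scheme.BirationalOver.symm h

theorem SpecBirational.trans {S A B C : Type u} [CommRing S] [CommRing A] [CommRing B]
    [CommRing C] [Algebra S A] [Algebra S B] [Algebra S C] (h : SpecBirational S A B)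
    (h' : SpecBirational S B C) : SpecBirational S A C :=
  Scheme.BirationalOver.trans h h'

/-- A finitely generated extension with the same fractions is an isomorphism after inverting one
nonzero element. -/
theorem exists_pow_smul_mem_range {S R A F : Type*} [CommRing S] [CommRing R]
    [CommRing A] [Field F] [Algebra S R] [Algebra S A] [Algebra R A] [Algebra R F]
    [Algebra A F] [IsScalarTower S R A] [IsScalarTower R A F] [IsDomain R]
    [IsFractionRing R F] (hA : Function.Injective (algebraMap A F)) [Algebra.FiniteType S A] :
    ∃ r : R, r ≠ 0 ∧ ∀ x : A, ∃ n : ℕ, r ^ n • x ∈ Set.range (algebraMap R A) := by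
  classical
  obtain ⟨t, ht⟩ := ‹Algebra.FiniteType S A›.out
  obtain ⟨⟨r, hr⟩, h⟩ := IsLocalization.exist_integer_multiples_of_finset (nonZeroDivisors R)
    (t.image (algebraMap A F))
  refine ⟨r, nonZeroDivisors.ne_zero hr, fun x => ?_⟩
  have hx : x ∈ Algebra.adjoin S (t : Set A) := by rw [ht]; trivial
  induction hx using Algebra.adjoin_induction with
  | mem x hx =>
    obtain ⟨y, hy⟩ := h _ (Finset.mem_image_of_mem _ hx)
    refine ⟨1, y, hA ?_⟩
    rw [← IsScalarTower.algebraMap_apply, hy, pow_one, Algebra.smul_def, Algebra.smul_def,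
      map_mul, ← IsScalarTower.algebraMap_apply]
  | algebraMap c => exact ⟨0, algebraMap S R c, by simp [← IsScalarTower.algebraMap_apply]⟩
  | add x y _ _ hx hy =>
    obtain ⟨m, a, ha⟩ := hx
    obtain ⟨n, b, hb⟩ := hy
    refine ⟨m + n, r ^ n * a + r ^ m * b, ?_⟩
    simp only [map_add, map_mul, ha, hb, Algebra.smul_def, map_pow]
    ring
  | mul x y _ _ hx hy =>
    obtain ⟨m, a, ha⟩ := hx
    obtain ⟨n, b, hb⟩ := hy
    refine ⟨m + n, a * b, ?_⟩
    simp only [map_mul, ha, hb, Algebra.smul_def, map_pow]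
    ring

/-- With `r` a common denominator of the generators of `A`, the localizations of `R` and of `A` at
`r` coincide. -/
theorem specBirational_of_algebra (S R A F : Type u) [CommRing S] [CommRing R] [CommRing A]
    [Field F] [Algebra S R] [Algebra S A] [Algebra R A] [Algebra R F] [Algebra A F]
    [IsScalarTower S R A] [IsScalarTower R A F] [IsDomain R] [IsDomain A] [IsFractionRing R F]
    (hA : Function.Injective (algebraMap A F)) [Algebra.FiniteType S A] :
    SpecBirational S R A := by
  obtain ⟨r, hr, h⟩ := exists_pow_smul_mem_range (S := S) (R := R) hA
  have hinj : Function.Injective (algebraMap R A) :=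
    .of_comp (f := algebraMap A F) (by
      rw [← RingHom.coe_comp, ← IsScalarTower.algebraMap_eq]
      exact IsFractionRing.injective R F)
  have hr' : algebraMap R A r ≠ 0 := (map_ne_zero_iff _ hinj).mpr hr
  let B := Localization.Away (algebraMap R A r)
  have hB : Function.Injective (algebraMap A B) :=
    IsLocalization.injective B (M := Submonoid.powers (algebraMap R A r))
      (powers_le_nonZeroDivisors_of_noZeroDivisors hr')
  have : IsDomain B := IsLocalization.isDomain_localization
    (powers_le_nonZeroDivisors_of_noZeroDivisors hr')
  have : IsLocalization.Away r B := by
    refine ⟨?_, ?_, ?_⟩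
    · rintro ⟨_, n, rfl⟩
      rw [IsScalarTower.algebraMap_apply R A B]
      simp only [map_pow]
      exact (IsLocalization.Away.algebraMap_isUnit (algebraMap R A r)).pow n
    · intro z
      obtain ⟨⟨x, ⟨_, m, rfl⟩⟩, hx⟩ :=
        IsLocalization.surj (Submonoid.powers (algebraMap R A r)) z
      obtain ⟨n, y, hy⟩ := h x
      refine ⟨⟨y, ⟨r ^ (n + m), n + m, rfl⟩⟩, ?_⟩
      simp only [map_pow] at hx
      simp only [IsScalarTower.algebraMap_apply R A B, hy, Algebra.smul_def, map_pow, map_mul]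
      rw [← hx]
      ring
    · intro x y hxy
      refine ⟨1, ?_⟩
      rw [IsScalarTower.algebraMap_eq R A B] at hxy
      rw [hinj (hB hxy)]
  exact (specBirational_away S B r hr).trans (specBirational_away S B _ hr').symm

/-- Two finitely generated domains with a common fraction field are birational. -/
theorem specBirational_of_isFractionRing (k R A F : Type u) [CommRing k] [CommRing R] [CommRing A]
    [Field F] [Algebra k R] [Algebra k A] [Algebra k F] [Algebra R F] [Algebra A F]
    [IsScalarTower k R F] [IsScalarTower k A F] [IsDomain R] [IsDomain A] [IsFractionRing R F]
    [IsFractionRing A F] [hR : Algebra.FiniteType k R] [hA : Algebra.FiniteType k A] :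
    SpecBirational k R A := by
  -- The compositum of `R` and `A` inside `F` is of finite type and birational to both.
  let B : Subalgebra k F := (IsScalarTower.toAlgHom k R F).range ⊔
    (IsScalarTower.toAlgHom k A F).range
  have hBfg : B.FG := by
    refine Subalgebra.FG.sup ?_ ?_
    · rw [← Algebra.map_top]; exact hR.out.map _
    · rw [← Algebra.map_top]; exact hA.out.map _
  have : Algebra.FiniteType k B := B.fg_iff_finiteType.mp hBfg
  let _ : Algebra R B := ((Subalgebra.inclusion (le_sup_left : _ ≤ B)).comp
    (IsScalarTower.toAlgHom k R F).rangeRestrict).toRingHom.toAlgebra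
  let _ : Algebra A B := ((Subalgebra.inclusion (le_sup_right : _ ≤ B)).comp
    (IsScalarTower.toAlgHom k A F).rangeRestrict).toRingHom.toAlgebra
  have : IsScalarTower R B F := .of_algebraMap_eq fun x => rfl
  have : IsScalarTower A B F := .of_algebraMap_eq fun x => rfl
  have : IsScalarTower k R B := .of_algebraMap_eq fun x => Subtype.ext <|
    IsScalarTower.algebraMap_apply k R F x
  have : IsScalarTower k A B := .of_algebraMap_eq fun x => Subtype.ext <|
    IsScalarTower.algebraMap_apply k A F x
  exact (specBirational_of_algebra k R B F Subtype.val_injective).trans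
    (specBirational_of_algebra k A B F Subtype.val_injective).symm

theorem isRationalOver_mvPolynomial (k σ : Type u) [CommRing k] :
    Scheme.IsRationalOver
      (Spec.map (CommRingCat.ofHom (algebraMap k (MvPolynomial σ k)))) := by
  have : IsDominant (AffineSpace.SpecIso σ (CommRingCat.of k)).inv := inferInstance
  exact Scheme.BirationalOver.isRationalOver _ _
    (Scheme.Hom.birationalOver (AffineSpace.SpecIso σ (CommRingCat.of k)).inv
      (𝔸(σ; Spec (CommRingCat.of k)) ↘ Spec (CommRingCat.of k)) _
      (AffineSpace.SpecIso_inv_over (n := σ) (CommRingCat.of k)))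

/-- Elements of the adjoined field are quotients of polynomial expressions in the image of `A`, and
this image is already a `k`-subalgebra. -/
theorem isFractionRing_of_adjoin_eq_top {k A F : Type*} [Field k] [CommRing A] [Field F]
    [Algebra k A] [Algebra k F] [Algebra A F] [IsScalarTower k A F]
    (hinj : Function.Injective (algebraMap A F))
    (h : IntermediateField.adjoin k (Set.range (algebraMap A F)) = ⊤) : IsFractionRing A F := by
  have : IsDomain A := hinj.isDomain
  have : FaithfulSMul A F := (faithfulSMul_iff_algebraMap_injective A F).mpr hinj
  refine IsFractionRing.of_field A F fun z => ?_
  have hz : z ∈ IntermediateField.adjoin k (Set.range (algebraMap A F)) := by rw [h]; trivial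
  rw [IntermediateField.mem_adjoin_iff_div] at hz
  have hle : Algebra.adjoin k (Set.range (algebraMap A F)) ≤
      (IsScalarTower.toAlgHom k A F).range := Algebra.adjoin_le fun _ ⟨a, ha⟩ => ⟨a, ha⟩
  obtain ⟨r, hr, s, hs, rfl⟩ := hz
  obtain ⟨a, rfl⟩ := hle hr
  obtain ⟨b, rfl⟩ := hle hs
  exact ⟨a, b, rfl⟩

theorem isRationalOver_of_adjoin_eq_top (k R F : Type u) [Field k] [CommRing R] [IsDomain R]
    [Field F] [Algebra k R] [Algebra k F] [Algebra R F] [IsScalarTower k R F]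
    [IsFractionRing R F] [Algebra.FiniteType k R] {n : ℕ} (x : Fin n → F)
    (hx : AlgebraicIndependent k x) (h : IntermediateField.adjoin k (Set.range x) = ⊤) :
    Scheme.IsRationalOver (Spec.map (CommRingCat.ofHom (algebraMap k R))) := by
  let y : ULift.{u} (Fin n) → F := fun i => x i.down
  have hy : AlgebraicIndependent k y := hx.comp _ ULift.down_injective
  let := (MvPolynomial.aeval (R := k) y).toRingHom.toAlgebra
  have : IsScalarTower k (MvPolynomial (ULift.{u} (Fin n)) k) F :=
    .of_algebraMap_eq fun c => ((MvPolynomial.aeval (R := k) y).commutes c).symm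
  have : IsFractionRing (MvPolynomial (ULift.{u} (Fin n)) k) F := by
    refine isFractionRing_of_adjoin_eq_top (k := k) hy ?_
    rw [eq_top_iff, ← h]
    refine IntermediateField.adjoin.mono _ _ _ ?_
    rintro _ ⟨i, rfl⟩
    exact ⟨MvPolynomial.X ⟨i⟩, MvPolynomial.aeval_X y _⟩
  have := isRationalOver_mvPolynomial k (ULift.{u} (Fin n))
  exact Scheme.BirationalOver.isRationalOver _ _
    (specBirational_of_isFractionRing k R (MvPolynomial (ULift.{u} (Fin n)) k) F)

/-! ### Function fields of split tori -/

section Laurent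

variable {L C F : Type*} [Field L] [AddCommGroup C] [Field F] [Algebra L F]
  [Algebra (AddMonoidAlgebra L C) F] [IsScalarTower L (AddMonoidAlgebra L C) F]

/-- A linearly independent family of exponents gives an algebraically independent family of
monomials. -/
theorem algebraicIndependent_single {ι : Type*} [Finite ι]
    (hinj : Function.Injective (algebraMap (AddMonoidAlgebra L C) F)) {b : ι → C}
    (hb : LinearIndependent ℤ b) :
    AlgebraicIndependent L fun i => algebraMap (AddMonoidAlgebra L C) F (.single (b i) 1) := by
  have := Fintype.ofFinite ι
  -- Polynomials in the monomials are group algebra elements with exponents in the image of `g`;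
  -- independence of `b` makes `g` injective.
  let g : (ι →₀ ℕ) →+ C :=
    { toFun := fun m => ∑ i, (m i : ℤ) • b i
      map_zero' := by simp
      map_add' := fun m n => by simp [add_smul, Finset.sum_add_distrib] }
  have hg : Function.Injective g := by
    intro m n h
    have h0 : ∑ i, ((m i : ℤ) - n i) • b i = 0 := by
      simp only [sub_smul, Finset.sum_sub_distrib]
      exact sub_eq_zero.mpr h
    ext i
    have := Fintype.linearIndependent_iff.mp hb _ h0 i
    omega
  have h : MvPolynomial.aeval (fun i => algebraMap (AddMonoidAlgebra L C) F (.single (b i) 1)) =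
      (IsScalarTower.toAlgHom L (AddMonoidAlgebra L C) F).comp
        (AddMonoidAlgebra.mapDomainAlgHom L L g) := by
    apply MvPolynomial.algHom_ext
    intro i
    classical
    have hi : g (Finsupp.single i 1) = b i := by
      change ∑ j, ((Finsupp.single i 1 : ι →₀ ℕ) j : ℤ) • b j = b i
      rw [Finset.sum_eq_single i]
      · simp
      · intro j _ hj
        rw [Finsupp.single_eq_of_ne hj]
        simp
      · simp
    rw [MvPolynomial.aeval_X]
    change _ = algebraMap (AddMonoidAlgebra L C) F
      (AddMonoidAlgebra.mapDomain g (AddMonoidAlgebra.single (Finsupp.single i 1) 1))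
    rw [AddMonoidAlgebra.mapDomain_single, hi]
  unfold AlgebraicIndependent
  rw [h]
  exact hinj.comp (AddMonoidAlgebra.mapDomain_injective hg)

/-- A subfield containing the coefficients and the monomials of a set of generators of the group
of exponents contains the group algebra. -/
theorem algebraMap_mem_of_closure_eq_top (E : Subfield F) (hL : ∀ l : L, algebraMap L F l ∈ E)
    {s : Set C} (hs : AddSubgroup.closure s = ⊤)
    (h : ∀ c ∈ s, algebraMap (AddMonoidAlgebra L C) F (.single c 1) ∈ E)
    (x : AddMonoidAlgebra L C) : algebraMap (AddMonoidAlgebra L C) F x ∈ E := by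
  induction x using AddMonoidAlgebra.induction_linear with
  | zero => rw [map_zero]; exact E.zero_mem
  | add x y hx hy => rw [map_add]; exact E.add_mem hx hy
  | single c l =>
    have h1 : algebraMap (AddMonoidAlgebra L C) F (.single c 1) ∈ E := by
      have hc : c ∈ AddSubgroup.closure s := by rw [hs]; trivial
      induction hc using AddSubgroup.closure_induction with
      | mem c hc => exact h c hc
      | zero => rw [← AddMonoidAlgebra.one_def, map_one]; exact E.one_mem
      | add c d _ _ hc hd =>
        rw [← mul_one (1 : L), ← AddMonoidAlgebra.single_mul_single, map_mul]
        exact E.mul_mem hc hd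
      | neg c _ hc =>
        have : algebraMap (AddMonoidAlgebra L C) F (.single (-c) 1) =
            (algebraMap (AddMonoidAlgebra L C) F (.single c 1))⁻¹ := by
          refine eq_inv_of_mul_eq_one_left ?_
          rw [← map_mul, AddMonoidAlgebra.single_mul_single, neg_add_cancel, mul_one,
            ← AddMonoidAlgebra.one_def, map_one]
        rw [this]
        exact E.inv_mem hc
    have h2 : AddMonoidAlgebra.single c l = l • AddMonoidAlgebra.single c (1 : L) := by simp
    rw [h2, Algebra.smul_def, map_mul, ← IsScalarTower.algebraMap_apply]
    exact E.mul_mem (hL l) h1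

theorem subfield_eq_top_of_closure_eq_top [IsFractionRing (AddMonoidAlgebra L C) F]
    (E : Subfield F) (hL : ∀ l : L, algebraMap L F l ∈ E)
    {s : Set C} (hs : AddSubgroup.closure s = ⊤)
    (h : ∀ c ∈ s, algebraMap (AddMonoidAlgebra L C) F (.single c 1) ∈ E) : E = ⊤ := by
  rw [eq_top_iff]
  intro z _
  obtain ⟨a, b, -, rfl⟩ := IsFractionRing.div_surjective (AddMonoidAlgebra L C) z
  exact E.div_mem (algebraMap_mem_of_closure_eq_top E hL hs h a)
    (algebraMap_mem_of_closure_eq_top E hL hs h b)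

end Laurent

theorem isDomain_addMonoidAlgebra (L C : Type*) [Field L] [AddCommGroup C] [Module.Free ℤ C]
    [Module.Finite ℤ C] : IsDomain (AddMonoidAlgebra L C) :=
  (AddMonoidAlgebra.domCongr L L
    (Module.finBasis ℤ C).equivFun.toAddEquiv).toMulEquiv.isDomain _

theorem isRationalOver_groupAlgebra (L : Type u) [Field L] (n : ℕ) :
    Scheme.IsRationalOver
      (Spec.map (CommRingCat.ofHom (algebraMap L (AddMonoidAlgebra L (Fin n → ℤ))))) := by
  let F := FractionRing (AddMonoidAlgebra L (Fin n → ℤ))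
  refine isRationalOver_of_adjoin_eq_top L _ F (fun i => algebraMap (AddMonoidAlgebra L (Fin n → ℤ)) F
    (.single (Pi.basisFun ℤ (Fin n) i) 1))
    (algebraicIndependent_single (IsFractionRing.injective _ _)
      (Pi.basisFun ℤ (Fin n)).linearIndependent) ?_
  rw [← IntermediateField.toSubfield_inj]
  refine subfield_eq_top_of_closure_eq_top (L := L) (C := Fin n → ℤ) _
    (fun l => IntermediateField.algebraMap_mem _ l) (s := Set.range (Pi.basisFun ℤ (Fin n))) ?_ ?_
  · have := (Pi.basisFun ℤ (Fin n)).span_eq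
    rw [← Submodule.span_int_eq_addSubgroupClosure, this]
    rfl
  · rintro _ ⟨i, rfl⟩
    exact IntermediateField.subset_adjoin _ _ ⟨i, rfl⟩

/-! ### Building the steps of a tower -/

section Step

variable {k : Type u} [Field k] {X Y : Variety k}

/-- The generic fiber of a rational map is defined through its domain of definition. For an honest
morphism this domain is everything, so the ordinary fiber product is recovered. Separatedness of the
target makes the two partial maps agree. -/
theorem isPullback_genericFiber (f : X.scheme ⟶ Y.scheme) (hf : f ≫ Y.hom = X.hom) :
    ∃ i : genericFiber f.toRationalMap ⟶ X.scheme,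
      IsPullback i (genericFiberHom f.toRationalMap) f
        (Y.scheme.fromSpecStalk (genericPoint Y.scheme)) := by
  have : f.IsOver (Spec (CommRingCat.of k)) := ⟨hf⟩
  have : IsSeparated (Y.scheme ↘ Spec (CommRingCat.of k)) := Y.isSeparated
  have h1 : f.toRationalMap.toPartialMap.equiv f.toPartialMap := by
    rw [← Scheme.PartialMap.toRationalMap_eq_iff, Scheme.RationalMap.toRationalMap_toPartialMap]
  have h2 := (Scheme.PartialMap.equiv_toPartialMap_iff_of_isSeparated
    (S := Spec (CommRingCat.of k))).mp h1
  have h3 : f.toRationalMap.toPartialMap.domain = ⊤ :=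
    top_le_iff.mp (Scheme.PartialMap.le_domain_toRationalMap f.toPartialMap)
  have : IsIso f.toRationalMap.toPartialMap.domain.ι := by
    rw [h3]; exact inferInstanceAs (IsIso X.scheme.topIso.hom)
  refine ⟨pullback.fst _ _ ≫ f.toRationalMap.toPartialMap.domain.ι, ?_⟩
  have h4 : IsPullback f.toRationalMap.toPartialMap.domain.ι
      f.toRationalMap.toPartialMap.hom f (𝟙 Y.scheme) :=
    IsPullback.of_horiz_isIso ⟨by rw [h2]; simp⟩
  have h5 := (IsPullback.of_hasPullback f.toRationalMap.toPartialMap.hom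
    (Y.scheme.fromSpecStalk (genericPoint Y.scheme))).paste_horiz h4
  rwa [Category.comp_id] at h5

/-- The geometric fiber is the spectrum of `A ⊗ K̄`, which is a Laurent polynomial ring over the
algebraic closure `K̄`. -/
theorem isGeometricallyRational_of_iso {K : Type u} [Field K] {Z : Scheme.{u}}
    {s : Z ⟶ Spec (CommRingCat.of K)} {A : Type u} [CommRing A] [Algebra K A]
    (ε : Z ≅ Spec (CommRingCat.of A))
    (hε : ε.hom ≫ Spec.map (CommRingCat.ofHom (algebraMap K A)) = s) {n : ℕ}
    (e : AlgebraicClosure K ⊗[K] A ≃ₐ[AlgebraicClosure K]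
        AddMonoidAlgebra (AlgebraicClosure K) (Fin n → ℤ)) : IsGeometricallyRational K s := by
  let θ : A ⊗[K] AlgebraicClosure K ≃+* AddMonoidAlgebra (AlgebraicClosure K) (Fin n → ℤ) :=
    (Algebra.TensorProduct.comm K A (AlgebraicClosure K)).toRingEquiv.trans e.toRingEquiv
  have hθ : θ.toRingHom.comp (Algebra.TensorProduct.includeRight :
      AlgebraicClosure K →ₐ[K] A ⊗[K] AlgebraicClosure K).toRingHom =
      algebraMap (AlgebraicClosure K) (AddMonoidAlgebra (AlgebraicClosure K) (Fin n → ℤ)) := by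
    refine RingHom.ext fun c => ?_
    change e (c ⊗ₜ 1) = _
    exact e.commutes c
  let q := Spec.map (CommRingCat.ofHom (algebraMap K (AlgebraicClosure K)))
  let g : pullback s q ⟶ pullback (Spec.map (CommRingCat.ofHom (algebraMap K A))) q :=
    pullback.map _ _ _ _ ε.hom (𝟙 _) (𝟙 _) (by simp [hε]) (by simp)
  have hg : IsIso g := inferInstance
  have hg' : g ≫ pullback.snd _ _ = pullback.snd _ _ :=
    (pullback.lift_snd _ _ _).trans (Category.comp_id _)
  have : IsIso (Spec.map (CommRingCat.ofHom θ.toRingHom)) :=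
    inferInstanceAs (IsIso (Spec.map θ.toCommRingCatIso.hom))
  have := isRationalOver_groupAlgebra (AlgebraicClosure K) n
  let h := Spec.map (CommRingCat.ofHom θ.toRingHom) ≫
    (pullbackSpecIso K A (AlgebraicClosure K)).inv
  have hh : h ≫ pullback.snd _ _ = Spec.map (CommRingCat.ofHom (algebraMap _ _)) := by
    rw [Category.assoc, pullbackSpecIso_inv_snd, ← Spec.map_comp, ← CommRingCat.ofHom_comp]
    exact congrArg (fun t => Spec.map (CommRingCat.ofHom t)) hθ
  exact Scheme.BirationalOver.isRationalOver _ _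
    ((Scheme.Hom.birationalOver g _ _ hg').trans (Scheme.Hom.birationalOver h _ _ hh).symm)

theorem isToricStep_of_isPullback (f : X.scheme ⟶ Y.scheme) (hf : f ≫ Y.hom = X.hom)
    [IsDominant f] {A H : Type u} [CommRing A] [IsDomain A] [Algebra Y.scheme.functionField A]
    (i : Spec (CommRingCat.of A) ⟶ X.scheme)
    (hi : IsPullback i (Spec.map (CommRingCat.ofHom (algebraMap Y.scheme.functionField A))) f
      (Y.scheme.fromSpecStalk (genericPoint Y.scheme)))
    [CommRing H] [HopfAlgebra Y.scheme.functionField H]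
    (ρ : A →ₐ[Y.scheme.functionField] A ⊗[Y.scheme.functionField] H)
    (hH : IsTorus Y.scheme.functionField H) (hρ : IsTorsor ρ) {n : ℕ}
    (e : AlgebraicClosure Y.scheme.functionField ⊗[Y.scheme.functionField] A
      ≃ₐ[AlgebraicClosure Y.scheme.functionField]
        AddMonoidAlgebra (AlgebraicClosure Y.scheme.functionField) (Fin n → ℤ)) :
    IsToricStep (X := X) (Y := Y) f.toRationalMap := by
  obtain ⟨j, hj⟩ := isPullback_genericFiber f hf
  let ε := hj.isoIsPullback _ _ hi
  have hε : ε.hom ≫ Spec.map (CommRingCat.ofHom (algebraMap Y.scheme.functionField A)) =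
      genericFiberHom f.toRationalMap := hj.isoIsPullback_hom_snd _ _ hi
  have : f.IsOver (Spec (CommRingCat.of k)) := ⟨hf⟩
  refine ⟨inferInstance, inferInstance, ?_, ?_, ⟨H, A, _, _, _, _, ρ, hH, hρ, ?_⟩⟩
  · rw [irreducibleSpace_def]
    change IsIrreducible Set.univ
    rw [← Set.range_eq_univ.mpr (Scheme.homeoOfIso ε).symm.surjective,
      ← Set.image_univ]
    exact (irreducibleSpace_def (Spec (CommRingCat.of A)) |>.mp inferInstance).image _
      (Scheme.homeoOfIso ε).symm.continuous.continuousOn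
  · exact isGeometricallyRational_of_iso ε hε e
  · exact Scheme.Hom.birationalOver ε.hom _ _ hε

theorem AdmitsToricRationalTower.cons (hX : AdmitsToricRationalTower X)
    {f : X.scheme ⤏ Y.scheme} (hf : IsToricStep f) : AdmitsToricRationalTower Y := by
  obtain ⟨n, Z, π, rfl, hr, hs⟩ := hX
  let π' : ∀ i : Fin (n + 1), ((Fin.cons Y Z : Fin (n + 2) → Variety k) i.succ).scheme ⤏
      ((Fin.cons Y Z : Fin (n + 2) → Variety k) i.castSucc).scheme :=
    Fin.cases f fun i => π i
  refine ⟨n + 1, Fin.cons Y Z, π', rfl, hr, fun i => ?_⟩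
  refine Fin.cases ?_ (fun i => ?_) i
  · exact hf
  · exact hs i

theorem AdmitsToricRationalTower.of_isRational (hX : X.IsRational) :
    AdmitsToricRationalTower X :=
  ⟨0, fun _ => X, fun i => i.elim0, rfl, hX, fun i => i.elim0⟩

/-- The function field of the spectrum of a domain. -/
abbrev SpecFunctionField (R : Type u) [CommRing R] [IsDomain R] : Type u :=
  (Spec (CommRingCat.of R)).functionField

noncomputable instance (R : Type u) [CommRing R] [IsDomain R] : Algebra R (SpecFunctionField R) :=
  haveI : IsDomain (CommRingCat.of R) := ‹IsDomain R›
  instAlgebraCarrierFunctionFieldSpec (CommRingCat.of R)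

instance (R : Type u) [CommRing R] [IsDomain R] : IsFractionRing R (SpecFunctionField R) :=
  haveI : IsDomain (CommRingCat.of R) := ‹IsDomain R›
  functionField_isFractionRing_of_affine (CommRingCat.of R)

/-- The generic fiber of `Spec R₁ → Spec R` inverts the nonzero elements of `R` in `R₁`. It is
therefore `Spec A`, and the torsor structure on `A` can be used directly. -/
theorem exists_isToricStep_affineVariety (k R R₁ A H : Type u) [Field k] [CommRing R] [IsDomain R]
    [Algebra k R] [Algebra.FiniteType k R] [CommRing R₁] [IsDomain R₁]
    [Algebra k R₁] [Algebra.FiniteType k R₁] [Algebra R R₁] [IsScalarTower k R R₁]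
    [CommRing A] [IsDomain A] [Algebra (SpecFunctionField R) A]
    [Algebra R₁ A] [Algebra R A] [IsScalarTower R R₁ A]
    [IsScalarTower R (SpecFunctionField R) A]
    (hinj : Function.Injective (algebraMap R R₁))
    [IsLocalization (Algebra.algebraMapSubmonoid R₁ (nonZeroDivisors R)) A]
    [CommRing H] [HopfAlgebra (SpecFunctionField R) H]
    (ρ : A →ₐ[SpecFunctionField R]
      A ⊗[SpecFunctionField R] H)
    (hH : IsTorus (SpecFunctionField R) H) (hρ : IsTorsor ρ) {n : ℕ}
    (e : AlgebraicClosure (SpecFunctionField R)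
        ⊗[SpecFunctionField R] A
      ≃ₐ[AlgebraicClosure (SpecFunctionField R)]
        AddMonoidAlgebra (AlgebraicClosure (SpecFunctionField R))
          (Fin n → ℤ)) :
    ∃ f : (affineVariety k R₁).scheme ⤏ (affineVariety k R).scheme,
      IsToricStep (X := affineVariety k R₁) (Y := affineVariety k R) f := by
  let φ : (affineVariety k R₁).scheme ⟶ (affineVariety k R).scheme :=
    Spec.map (CommRingCat.ofHom (algebraMap R R₁))
  have hφ : IsDominant φ := isDominant_specMap _ hinj
  have : Algebra.IsPushout R R₁ (SpecFunctionField R) A :=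
    Algebra.isPushout_of_isLocalization (nonZeroDivisors R) _ _ _
  have hp := isPullback_SpecMap_of_isPushout _ _ _ _
    (CommRingCat.isPushout_of_isPushout R R₁ (SpecFunctionField R) A)
  let : Algebra (affineVariety k R).scheme.functionField A :=
    ‹Algebra (SpecFunctionField R) A›
  let : HopfAlgebra (affineVariety k R).scheme.functionField H :=
    ‹HopfAlgebra (SpecFunctionField R) H›
  refine ⟨_, isToricStep_of_isPullback (X := affineVariety k R₁) (Y := affineVariety k R)
    φ ?_
    (Spec.map (CommRingCat.ofHom (algebraMap R₁ A))) ?_ ρ hH hρ e⟩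
  · change Spec.map _ ≫ Spec.map _ = Spec.map _
    rw [← Spec.map_comp, ← CommRingCat.ofHom_comp, ← IsScalarTower.algebraMap_eq]
  · have h : (affineVariety k R).scheme.fromSpecStalk (genericPoint (affineVariety k R).scheme) =
        Spec.map (CommRingCat.ofHom (algebraMap R (SpecFunctionField R))) :=
      Spec.fromSpecStalk_eq' _ _
    rw [h]
    exact hp

end Step

/-! ### The tower step given by a monomial action -/

/-- A finitely generated algebra over the fraction field of `R` comes from a finitely generated
`R`-algebra. -/
theorem exists_subalgebra_fg (R K A : Type*) [CommRing R] [IsDomain R] [Field K] [Algebra R K]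
    [IsFractionRing R K] [CommRing A] [Algebra K A] [Algebra R A] [IsScalarTower R K A]
    [hA : Algebra.FiniteType K A] :
    ∃ S : Subalgebra R A, S.FG ∧ ∀ x : A, ∃ r : R, r ≠ 0 ∧ r • x ∈ S := by
  obtain ⟨t, ht⟩ := hA.out
  refine ⟨Algebra.adjoin R t, ⟨t, rfl⟩, fun x => ?_⟩
  have hx : x ∈ Algebra.adjoin K (t : Set A) := by rw [ht]; trivial
  induction hx using Algebra.adjoin_induction with
  | mem x hx => exact ⟨1, one_ne_zero, by rw [one_smul]; exact Algebra.subset_adjoin hx⟩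
  | algebraMap c =>
    obtain ⟨a, b, hb, rfl⟩ := IsFractionRing.div_surjective R c
    refine ⟨b, nonZeroDivisors.ne_zero hb, ?_⟩
    have : b • algebraMap K A (algebraMap R K a / algebraMap R K b) = algebraMap R A a := by
      rw [Algebra.smul_def, IsScalarTower.algebraMap_apply R K A b, ← map_mul,
        mul_div_cancel₀ _ (IsFractionRing.to_map_ne_zero_of_mem_nonZeroDivisors hb),
        ← IsScalarTower.algebraMap_apply]
    rw [this]
    exact Subalgebra.algebraMap_mem _ _
  | add x y _ _ hx hy =>
    obtain ⟨r, hr, hx⟩ := hx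
    obtain ⟨s, hs, hy⟩ := hy
    refine ⟨r * s, mul_ne_zero hr hs, ?_⟩
    rw [smul_add]
    refine Subalgebra.add_mem _ ?_ ?_
    · rw [mul_comm, mul_smul]; exact Subalgebra.smul_mem _ hx s
    · rw [mul_smul]; exact Subalgebra.smul_mem _ hy r
  | mul x y _ _ hx hy =>
    obtain ⟨r, hr, hx⟩ := hx
    obtain ⟨s, hs, hy⟩ := hy
    refine ⟨r * s, mul_ne_zero hr hs, ?_⟩
    rw [← smul_mul_smul_comm]
    exact Subalgebra.mul_mem _ hx hy

theorem isLocalization_of_subalgebra (R K A : Type*) [CommRing R] [IsDomain R] [Field K]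
    [Algebra R K] [IsFractionRing R K] [CommRing A] [Algebra K A] [Algebra R A]
    [IsScalarTower R K A] (S : Subalgebra R A) (h : ∀ x : A, ∃ r : R, r ≠ 0 ∧ r • x ∈ S) :
    IsLocalization (Algebra.algebraMapSubmonoid S (nonZeroDivisors R)) A := by
  refine ⟨?_, ?_, ?_⟩
  · rintro ⟨_, r, hr, rfl⟩
    change IsUnit (algebraMap R A r)
    rw [IsScalarTower.algebraMap_apply R K A]
    exact (IsUnit.mk0 _ (IsFractionRing.to_map_ne_zero_of_mem_nonZeroDivisors hr)).map _
  · intro z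
    obtain ⟨r, hr, hz⟩ := h z
    refine ⟨⟨⟨_, hz⟩, ⟨algebraMap R S r, r, mem_nonZeroDivisors_of_ne_zero hr, rfl⟩⟩, ?_⟩
    change z * algebraMap R A r = r • z
    rw [Algebra.smul_def, mul_comm]
  · intro x y hxy
    exact ⟨1, by rw [Subtype.val_injective hxy]⟩

/-- A group action by algebra automorphisms is linear over a larger ring of invariant scalars. -/
noncomputable def extendScalars {k K B Q : Type*} [CommRing k] [CommRing K] [CommRing B]
    [Algebra k B] [Algebra K B] [Group Q] (s : Q →* (B ≃ₐ[k] B))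
    (h : ∀ q (c : K), s q (algebraMap K B c) = algebraMap K B c) : Q →* (B ≃ₐ[K] B) where
  toFun q := AlgEquiv.ofRingEquiv (f := (s q).toRingEquiv) (h q)
  map_one' := by ext; simp
  map_mul' p q := by ext; simp

/-- If `R` has invariant field of fractions in `L`, and every model of the algebra of invariants
of a monomial action on `L[C]` admits a tower, then `Spec R` admits a tower. -/
theorem admits_of_isMonomialAction (k R L : Type u) {C : Type u} {Q : Type*} [Field k] [CommRing R]
    [IsDomain R] [Algebra k R] [Algebra.FiniteType k R] [Field L] [Algebra k L] [Algebra R L]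
    [IsScalarTower k R L] [Group Q] [Finite Q] [AddCommGroup C] [Module.Free ℤ C]
    [Module.Finite ℤ C] (σ : Q →* (L ≃ₐ[k] L)) (hσ : Function.Injective σ)
    (hR : Function.Injective (algebraMap R L))
    (hfix : ∀ l, (∀ q, σ q l = l) ↔ ∃ a b : R, b ≠ 0 ∧ b • l = algebraMap R L a)
    (a : Q →* (C ≃ₗ[ℤ] C)) (f : Q → C → L)
    (s : Q →* (AddMonoidAlgebra L C ≃ₐ[k] AddMonoidAlgebra L C))
    (hs : IsMonomialAction σ (fun q => a q) f s)
    (H : ∀ (R₁ : Type u) [CommRing R₁] [IsDomain R₁] [Algebra k R₁] [Algebra.FiniteType k R₁]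
      [Algebra R₁ (AddMonoidAlgebra L C)] [IsScalarTower k R₁ (AddMonoidAlgebra L C)],
      Function.Injective (algebraMap R₁ (AddMonoidAlgebra L C)) →
      (∀ r q, s q (algebraMap R₁ _ r) = algebraMap R₁ _ r) →
      (∀ x, (∀ q, s q x = x) → ∃ a b : R₁, b ≠ 0 ∧ b • x = algebraMap R₁ _ a) →
      AdmitsToricRationalTower (affineVariety k R₁)) :
    AdmitsToricRationalTower (affineVariety k R) := by
  have := isDomain_addMonoidAlgebra L C
  let K := SpecFunctionField R
  have hRσ : ∀ q (r : R), σ q (algebraMap R L r) = algebraMap R L r := fun q r =>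
    (hfix _).mpr ⟨r, 1, one_ne_zero, one_smul _ _⟩ q
  have hRL : ∀ r : nonZeroDivisors R, IsUnit (algebraMap R L r) := fun r =>
    IsUnit.mk0 _ ((map_ne_zero_iff _ hR).mpr (nonZeroDivisors.ne_zero r.2))
  -- The fraction field of `R` embeds in `L`, and `hfix` identifies its image with the fixed field
  -- of `Q`.
  let _ : Algebra K L := (IsLocalization.lift (M := nonZeroDivisors R) (S := K) hRL).toAlgebra
  have htow : IsScalarTower R K L := .of_algebraMap_eq fun r =>
    (IsLocalization.lift_eq (M := nonZeroDivisors R) (S := K) hRL r).symm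
  have hdiv : ∀ x y : R, y ≠ 0 → algebraMap K L (algebraMap R K x / algebraMap R K y) =
      algebraMap R L x / algebraMap R L y := fun x y hy => by
    rw [map_div₀, ← IsScalarTower.algebraMap_apply, ← IsScalarTower.algebraMap_apply]
  have hKσ : ∀ q (c : K), σ q (algebraMap K L c) = algebraMap K L c := by
    intro q c
    obtain ⟨x, y, hy, rfl⟩ := IsFractionRing.div_surjective R c
    rw [hdiv _ _ (nonZeroDivisors.ne_zero hy), map_div₀, hRσ, hRσ]
  let σK := extendScalars σ hKσ
  have hσK : IsGaloisAction σK :=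
    { injective := fun p q h => hσ (AlgEquiv.ext fun l => DFunLike.congr_fun h l)
      mem_range := fun l hl => by
        obtain ⟨x, y, hy, h⟩ := (hfix l).mp hl
        refine ⟨algebraMap R K x / algebraMap R K y, ?_⟩
        rw [hdiv _ _ hy, ← h, Algebra.smul_def,
          mul_div_cancel_left₀ _ ((map_ne_zero_iff _ hR).mpr hy)] }
  have hKs : ∀ q (c : K), s q (algebraMap K (AddMonoidAlgebra L C) c) =
      algebraMap K (AddMonoidAlgebra L C) c := by
    intro q c
    rw [IsScalarTower.algebraMap_apply K L (AddMonoidAlgebra L C),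
      Algebra.algebraMap_eq_smul_one, hs.map_smul, map_one, hKσ]
  let sK := extendScalars s hKs
  have hsK : IsMonomialAction σK (fun q => a q) f sK := hs
  have := hσK.finite
  have : AddGroup.FG C := Module.Finite.iff_addGroup_fg.mp inferInstance
  have : AddMonoid.FG C := AddGroup.fg_iff_addMonoid_fg.mp this
  have : Algebra.FiniteType L (AddMonoidAlgebra L C) := AddMonoidAlgebra.finiteType_of_fg L C
  have : Algebra.FiniteType K (AddMonoidAlgebra L C) :=
    Algebra.FiniteType.trans (S := L) inferInstance inferInstance
  have := finiteType_invariantSubalgebra sK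
  -- The invariants are of finite type over `K` but not in general over `k`. The variety of the next
  -- stage is the spectrum of a finitely generated `R`-subalgebra `S` with the same generic fiber.
  obtain ⟨S, hSfg, hS⟩ := exists_subalgebra_fg R K (invariantSubalgebra sK)
  have : Algebra.FiniteType R S := S.fg_iff_finiteType.mp hSfg
  have := isLocalization_of_subalgebra R K (invariantSubalgebra sK) S hS
  obtain ⟨H', _, _, ρ, hH', hρ⟩ := hsK.exists_isTorsor hσK
  obtain ⟨n, ⟨e⟩⟩ := hsK.exists_algEquiv hσK
  let _ : Algebra k S := ((algebraMap R S).comp (algebraMap k R)).toAlgebra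
  have : IsScalarTower k R S := .of_algebraMap_eq fun _ => rfl
  have : Algebra.FiniteType k S := Algebra.FiniteType.trans (S := R) inferInstance inferInstance
  let algSB : Algebra S (AddMonoidAlgebra L C) :=
    (((invariantSubalgebra sK).val.toRingHom).comp S.val.toRingHom).toAlgebra
  have htow' : @IsScalarTower k S (AddMonoidAlgebra L C) _ algSB.toSMul _ :=
    @IsScalarTower.of_algebraMap_eq k S (AddMonoidAlgebra L C) _ _ _ _ algSB _ <| fun c => by
    change algebraMap k (AddMonoidAlgebra L C) c =
      algebraMap R (AddMonoidAlgebra L C) (algebraMap k R c)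
    exact IsScalarTower.algebraMap_apply k R (AddMonoidAlgebra L C) c
  have hRB : Function.Injective (algebraMap R (AddMonoidAlgebra L C)) := by
    rw [IsScalarTower.algebraMap_eq R L (AddMonoidAlgebra L C)]
    exact (FaithfulSMul.algebraMap_injective L (AddMonoidAlgebra L C)).comp hR
  have hRS : Function.Injective (algebraMap R S) := fun x y h => hRB (congrArg (fun z => z.1.1) h)
  obtain ⟨g, hg⟩ := exists_isToricStep_affineVariety k R S (invariantSubalgebra sK) H' hRS ρ hH' hρ e
  -- Every invariant is a fraction of elements of `S`, with denominator in `R`, so `S` is one of the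
  -- models to which `H` applies.
  refine AdmitsToricRationalTower.cons (@H S _ _ _ _ algSB htow' ?_ ?_ ?_) hg
  · exact Subtype.val_injective.comp Subtype.val_injective
  · exact fun r q => r.1.2 q
  · intro x hx
    obtain ⟨r, hr, h⟩ := hS ⟨x, hx⟩
    refine ⟨⟨_, h⟩, algebraMap R S r, (map_ne_zero_iff _ hRS).mpr hr, ?_⟩
    rw [Algebra.smul_def]
    change algebraMap R (AddMonoidAlgebra L C) r * x = r • x
    rw [Algebra.smul_def]

/-! ### Group actions on rings and fields -/

section Actions

variable {k Q : Type*} [Group Q]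

/-- A homomorphism to the algebra endomorphisms gives an action by algebra automorphisms. -/
noncomputable def actionOfEnd [CommSemiring k] {B : Type*} [Semiring B] [Algebra k B]
    (t : Q →* (B →ₐ[k] B)) : Q →* (B ≃ₐ[k] B) :=
  (AlgEquiv.algHomUnitsEquiv k B).toMonoidHom.comp t.toHomUnits

@[simp]
theorem actionOfEnd_apply [CommSemiring k] {B : Type*} [Semiring B] [Algebra k B]
    (t : Q →* (B →ₐ[k] B)) (q : Q) (b : B) : actionOfEnd t q b = t q b := rfl

/-- A homomorphism to the linear endomorphisms gives an action by linear automorphisms. -/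
noncomputable def linearActionOfEnd [CommRing k] {M : Type*} [AddCommGroup M] [Module k M]
    (t : Q →* Module.End k M) : Q →* (M ≃ₗ[k] M) :=
  (LinearMap.GeneralLinearGroup.generalLinearEquiv k M).toMonoidHom.comp t.toHomUnits

/-- The restriction of an action to an invariant intermediate field. -/
noncomputable def restrictAction [Field k] {E : Type*} [Field E] [Algebra k E]
    (σ : Q →* (E ≃ₐ[k] E)) (F : IntermediateField k E) (h : ∀ q, ∀ e ∈ F, σ q e ∈ F) :
    Q →* (F ≃ₐ[k] F) :=
  actionOfEnd
    { toFun := fun q => AlgHom.codRestrict ((σ q).toAlgHom.comp F.val) F.toSubalgebra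
        fun e => h q _ e.2
      map_one' := AlgHom.ext fun e => Subtype.ext <| by
        change σ 1 e.1 = e.1
        simp
      map_mul' := fun p q => AlgHom.ext fun e => Subtype.ext <| by
        change σ (p * q) e.1 = σ p (σ q e.1)
        simp }

@[simp]
theorem coe_restrictAction_apply [Field k] {E : Type*} [Field E] [Algebra k E]
    (σ : Q →* (E ≃ₐ[k] E)) (F : IntermediateField k E) (h : ∀ q, ∀ e ∈ F, σ q e ∈ F) (q : Q)
    (e : F) : (restrictAction σ F h q e : E) = σ q e := rfl

/-- The extension of an action on a domain to its field of fractions. -/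
noncomputable def fractionAction [CommRing k] {B E : Type*} [CommRing B] [Algebra k B] [Field E]
    [Algebra k E] [Algebra B E] [IsScalarTower k B E] [IsFractionRing B E]
    (s : Q →* (B ≃ₐ[k] B)) : Q →* (E ≃ₐ[k] E) where
  toFun q := IsFractionRing.algEquivOfAlgEquiv (s q)
  map_one' := by
    ext x
    obtain ⟨x, y, -, rfl⟩ := IsFractionRing.div_surjective B x
    simp [map_div₀]
  map_mul' p q := by
    ext x
    obtain ⟨x, y, -, rfl⟩ := IsFractionRing.div_surjective B x
    simp [map_div₀]

@[simp]
theorem fractionAction_algebraMap [CommRing k] {B E : Type*} [CommRing B] [Algebra k B] [Field E]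
    [Algebra k E] [Algebra B E] [IsScalarTower k B E] [IsFractionRing B E]
    (s : Q →* (B ≃ₐ[k] B)) (q : Q) (b : B) :
    (fractionAction s : Q →* (E ≃ₐ[k] E)) q (algebraMap B E b) = algebraMap B E (s q b) := by
  simp [fractionAction]

/-- An invariant fraction is a quotient of invariants. -/
theorem exists_invariant_smul_eq [Finite Q] [CommRing k] {B E : Type*} [CommRing B] [IsDomain B]
    [Algebra k B] [Field E]
    [Algebra k E] [Algebra B E] [IsScalarTower k B E] [IsFractionRing B E]
    (s : Q →* (B ≃ₐ[k] B)) {e : E}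
    (he : ∀ q, (fractionAction s : Q →* (E ≃ₐ[k] E)) q e = e) :
    ∃ x y : B, (∀ q, s q x = x) ∧ (∀ q, s q y = y) ∧ y ≠ 0 ∧ y • e = algebraMap B E x := by
  have := Fintype.ofFinite Q
  classical
  obtain ⟨x, y, hy, rfl⟩ := IsFractionRing.div_surjective B e
  have hy0 : y ≠ 0 := nonZeroDivisors.ne_zero hy
  have hinj := IsFractionRing.injective B E
  -- The denominator is replaced by its norm, which is invariant; then the numerator is invariant as
  -- well.
  let z := ∏ q, s q y
  have hz : ∀ q, s q z = z := by
    intro p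
    rw [map_prod]
    exact Fintype.prod_equiv (Equiv.mulLeft p) _ _ (fun q => by simp)
  have hz0 : z ≠ 0 := Finset.prod_ne_zero_iff.mpr fun q _ => (map_ne_zero_iff _ (s q).injective).mpr hy0
  have hzy : z = y * ∏ q ∈ Finset.univ.erase 1, s q y := by
    change ∏ q, s q y = _
    rw [← Finset.mul_prod_erase Finset.univ _ (Finset.mem_univ (1 : Q))]
    simp
  have key : z • (algebraMap B E x / algebraMap B E y) =
      algebraMap B E (x * ∏ q ∈ Finset.univ.erase 1, s q y) := by
    have : algebraMap B E y ≠ 0 := (map_ne_zero_iff _ hinj).mpr hy0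
    rw [Algebra.smul_def, hzy, map_mul, map_mul]
    field_simp
  refine ⟨_, z, fun q => hinj ?_, hz, hz0, key⟩
  rw [← fractionAction_algebraMap s, ← key, Algebra.smul_def, map_mul, he,
    fractionAction_algebraMap, hz]

theorem injective_fractionAction [CommRing k] {B E : Type*} [CommRing B] [Algebra k B] [Field E]
    [Algebra k E] [Algebra B E] [IsScalarTower k B E] [IsFractionRing B E]
    {s : Q →* (B ≃ₐ[k] B)} (hs : Function.Injective s) :
    Function.Injective (fractionAction s : Q →* (E ≃ₐ[k] E)) := by
  intro p q h
  refine hs (AlgEquiv.ext fun b => IsFractionRing.injective B E ?_)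
  rw [← fractionAction_algebraMap s, ← fractionAction_algebraMap s, h]

end Actions

/-! ### Monomial actions from cocycles -/

section MonomialAction

variable {k L Q C : Type*} [Field k] [Field L] [Algebra k L] [Group Q] [AddCommGroup C]

/-- The monomial action on `L[C]` given by a cocycle. -/
noncomputable def monomialAction (σ : Q →* (L ≃ₐ[k] L)) (a : Q →* (C ≃ₗ[ℤ] C))
    (f : Q → Multiplicative C →* L)
    (hf : ∀ p q c, f (p * q) (.ofAdd c) = σ p (f q (.ofAdd c)) * f p (.ofAdd (a q c))) :
    Q →* (AddMonoidAlgebra L C ≃ₐ[k] AddMonoidAlgebra L C) :=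
  let g (q : Q) : Multiplicative C →* AddMonoidAlgebra L C :=
    { toFun := fun c => .single (a q c.toAdd) (f q c)
      map_one' := by simp [AddMonoidAlgebra.one_def]
      map_mul' := fun c d => by simp [AddMonoidAlgebra.single_mul_single] }
  let t (q : Q) : AddMonoidAlgebra L C →ₐ[k] AddMonoidAlgebra L C :=
    AddMonoidAlgebra.liftNCAlgHom
      ((IsScalarTower.toAlgHom k L (AddMonoidAlgebra L C)).comp (σ q).toAlgHom) (g q)
      fun _ _ => Commute.all _ _
  have ht (q : Q) (c : C) (l : L) :
      t q (.single c l) = .single (a q c) (σ q l * f q (.ofAdd c)) := by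
    simp [t, g, AddMonoidAlgebra.liftNC_single, AddMonoidAlgebra.single_mul_single]
  actionOfEnd
    { toFun := t
      map_one' := by
        -- The cocycle identity at `p = q = 1` gives an idempotent value, which is nonzero because
        -- `f 1` is a homomorphism on a group.
        have h1 : ∀ c, f 1 (.ofAdd c) = 1 := fun c => by
          have h := hf 1 1 c
          have h0 : f 1 (.ofAdd c) ≠ 0 := fun h0 => by
            have h2 := map_mul (f 1) (.ofAdd c) (.ofAdd (-c))
            rw [h0, zero_mul, ← ofAdd_add, add_neg_cancel, ofAdd_zero, map_one] at h2
            exact one_ne_zero h2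
          simpa [h0] using h
        refine AlgHom.ext fun x => ?_
        induction x using AddMonoidAlgebra.induction_linear with
        | zero => simp
        | add x y hx hy => rw [map_add, map_add, hx, hy]
        | single c l => rw [ht, h1]; simp
      map_mul' := fun p q => by
        refine AlgHom.ext fun x => ?_
        induction x using AddMonoidAlgebra.induction_linear with
        | zero => simp
        | add x y hx hy => rw [map_add, map_add, hx, hy]
        | single c l =>
          rw [ht, AlgHom.mul_apply, ht, ht, hf, map_mul, map_mul, map_mul]
          simp [mul_assoc] }

theorem isMonomialAction_monomialAction (σ : Q →* (L ≃ₐ[k] L)) (a : Q →* (C ≃ₗ[ℤ] C))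
    (f : Q → Multiplicative C →* L)
    (hf : ∀ p q c, f (p * q) (.ofAdd c) = σ p (f q (.ofAdd c)) * f p (.ofAdd (a q c))) :
    IsMonomialAction σ (fun q => a q) (fun q c => f q (.ofAdd c)) (monomialAction σ a f hf) := by
  intro q c l
  simp [monomialAction, AddMonoidAlgebra.liftNC_single, AddMonoidAlgebra.single_mul_single]

theorem IsMonomialAction.map_algebraMap {σ : Q →* (L ≃ₐ[k] L)} {a : Q → C → C} {f : Q → C → L}
    {s : Q →* (AddMonoidAlgebra L C ≃ₐ[k] AddMonoidAlgebra L C)}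
    (hs : IsMonomialAction σ a f s) (q : Q) (l : L) :
    s q (algebraMap L _ l) = algebraMap L _ (σ q l) := by
  rw [Algebra.algebraMap_eq_smul_one, hs.map_smul, map_one, ← Algebra.algebraMap_eq_smul_one]

theorem IsMonomialAction.injective {σ : Q →* (L ≃ₐ[k] L)} {a : Q → C → C} {f : Q → C → L}
    {s : Q →* (AddMonoidAlgebra L C ≃ₐ[k] AddMonoidAlgebra L C)}
    (hs : IsMonomialAction σ a f s) (hσ : Function.Injective σ) : Function.Injective s := by
  intro p q h
  refine hσ (AlgEquiv.ext fun l => FaithfulSMul.algebraMap_injective L (AddMonoidAlgebra L C) ?_)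
  rw [← hs.map_algebraMap, ← hs.map_algebraMap, h]

end MonomialAction

/-- A family of generators of a field with at most as many members as the transcendence degree is
algebraically independent. -/
theorem algebraicIndependent_of_le_trdeg {k E ι : Type*} [Field k] [Field E] [Algebra k E]
    [Finite ι] (x : ι → E) (h : IntermediateField.adjoin k (Set.range x) = ⊤)
    (hle : (Nat.card ι : Cardinal) ≤ Algebra.trdeg k E) : AlgebraicIndependent k x := by
  have : IsFractionRing (Algebra.adjoin k (Set.range x)) E := by
    refine isFractionRing_of_adjoin_eq_top (k := k) Subtype.val_injective ?_
    rw [eq_top_iff, ← h]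
    refine IntermediateField.adjoin.mono _ _ _ fun y hy => ⟨⟨y, Algebra.subset_adjoin hy⟩, rfl⟩
  have : Algebra.IsAlgebraic (Algebra.adjoin k (Set.range x)) E :=
    IsLocalization.isAlgebraic _ (nonZeroDivisors (Algebra.adjoin k (Set.range x)))
  refine (Algebra.IsAlgebraic.isTranscendenceBasis_of_lift_le_trdeg_of_finite k x ?_).1
  rw [← Nat.cast_card, Cardinal.lift_natCast, Cardinal.nat_le_lift_iff]
  exact hle

/-! ### Towers for quotients of linear fields -/

/-- The ring `R` has the invariants of the action on `E` as its field of fractions. -/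
structure IsInvariantModel {k E Q : Type*} [Field k] [Field E] [Algebra k E] [Group Q]
    (σ : Q →* (E ≃ₐ[k] E)) (R : Type*) [CommRing R] [Algebra R E] : Prop where
  injective : Function.Injective (algebraMap R E)
  invariant_iff : ∀ e, (∀ q, σ q e = e) ↔ ∃ a b : R, b ≠ 0 ∧ b • e = algebraMap R E a

/-- Invariant fractions are fractions of invariants of `B`, and these are fractions of elements of
`R`. It carries a model of the invariants of `L[C]` over to the function field, where the next step
takes place. -/
theorem isInvariantModel_fractionAction {k B E Q : Type*} [Field k] [CommRing B] [IsDomain B]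
    [Algebra k B] [Field E] [Algebra k E] [Algebra B E] [IsScalarTower k B E] [IsFractionRing B E]
    [Group Q] [Finite Q] (s : Q →* (B ≃ₐ[k] B)) (R : Type*) [CommRing R] [IsDomain R] [Algebra R B]
    [Algebra R E] [IsScalarTower R B E] (hinj : Function.Injective (algebraMap R B))
    (hinv : ∀ r q, s q (algebraMap R B r) = algebraMap R B r)
    (hfrac : ∀ x, (∀ q, s q x = x) → ∃ a b : R, b ≠ 0 ∧ b • x = algebraMap R B a) :
    IsInvariantModel (fractionAction s : Q →* (E ≃ₐ[k] E)) R := by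
  have hRE : Function.Injective (algebraMap R E) := by
    rw [IsScalarTower.algebraMap_eq R B E]
    exact (IsFractionRing.injective B E).comp hinj
  refine ⟨hRE, fun e => ⟨fun he => ?_, ?_⟩⟩
  · obtain ⟨u, v, hu, hv, hv0, h⟩ := exists_invariant_smul_eq s he
    obtain ⟨a, c, hc, hac⟩ := hfrac u hu
    obtain ⟨a', c', hc', hac'⟩ := hfrac v hv
    have ha' : a' ≠ 0 := by
      rintro rfl
      rw [map_zero, Algebra.smul_def] at hac'
      exact mul_ne_zero ((map_ne_zero_iff _ hinj).mpr hc') hv0 hac'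
    refine ⟨c' * a, c * a', mul_ne_zero hc ha', ?_⟩
    rw [Algebra.smul_def, map_mul, map_mul, IsScalarTower.algebraMap_apply R B E a',
      IsScalarTower.algebraMap_apply R B E a, ← hac, ← hac', Algebra.smul_def, Algebra.smul_def,
      map_mul, map_mul, ← h, Algebra.smul_def, ← IsScalarTower.algebraMap_apply,
      ← IsScalarTower.algebraMap_apply]
    ring
  · rintro ⟨a, c, hc, h⟩ q
    refine mul_left_cancel₀ ((map_ne_zero_iff _ hRE).mpr hc) ?_
    rw [← Algebra.smul_def c e, h]
    have key : ∀ r : R, fractionAction s q (algebraMap R E r) = algebraMap R E r := fun r => by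
      rw [IsScalarTower.algebraMap_apply R B E, fractionAction_algebraMap, hinv]
    rw [← key c, ← map_mul, ← Algebra.smul_def, h, key]

/-- Every model of the invariants of a faithful linear action of `G` on a rational function field
admits a toric rational tower. -/
def LinearQuotientsAdmitTowers (k : Type u) [Field k] (G : Type w) [Group G] : Prop :=
  ∀ (E : Type u) [Field E] [Algebra k E] (σ : G →* (E ≃ₐ[k] E)), Function.Injective σ →
    ∀ (n : ℕ) (x : Fin n → E), AlgebraicIndependent k x →
    IntermediateField.adjoin k (Set.range x) = ⊤ →
    (∀ g i, σ g (x i) ∈ Submodule.span k (Set.range x)) →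
    ∀ (R : Type u) [CommRing R] [IsDomain R] [Algebra k R] [Algebra.FiniteType k R] [Algebra R E]
      [IsScalarTower k R E], IsInvariantModel σ R → AdmitsToricRationalTower (affineVariety k R)

/-- With no group acting, the fraction field of `R` is the purely transcendental field `E`, and the
tower has length zero. -/
theorem linearQuotientsAdmitTowers_of_subsingleton (k : Type u) [Field k] (G : Type w) [Group G]
    [Subsingleton G] : LinearQuotientsAdmitTowers k G := by
  intro E _ _ σ _ n x hx htop _ R _ _ _ _ _ _ hR
  have : FaithfulSMul R E := (faithfulSMul_iff_algebraMap_injective R E).mpr hR.injective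
  have : IsFractionRing R E := by
    refine IsFractionRing.of_field R E fun z => ?_
    obtain ⟨a, b, hb, h⟩ := (hR.invariant_iff z).mp fun q => by
      rw [Subsingleton.elim q 1, map_one, AlgEquiv.one_apply]
    refine ⟨a, b, ?_⟩
    rw [← h, Algebra.smul_def, mul_div_cancel_left₀ _ ((map_ne_zero_iff _ hR.injective).mpr hb)]
  exact .of_isRational (isRationalOver_of_adjoin_eq_top k R E x hx htop)

theorem LinearQuotientsAdmitTowers.of_mulEquiv {k : Type u} [Field k] {G G' : Type*} [Group G]
    [Group G'] (h : LinearQuotientsAdmitTowers k G) (e : G' ≃* G) :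
    LinearQuotientsAdmitTowers k G' := by
  intro E _ _ σ hσ n x hx htop hspan R _ _ _ _ _ _ hR
  refine h E (σ.comp e.symm.toMonoidHom) (hσ.comp e.symm.injective) n x hx htop
    (fun g i => hspan _ _) R ⟨hR.injective, fun z => ?_⟩
  rw [← hR.invariant_iff]
  exact (e.symm.surjective.forall (p := fun q => σ q z = z)).symm

/-! ### The lattice of functions modulo orbit maps -/

section Lattice

variable {M Q : Type*} [AddCommGroup M] [Group Q] (α : Q →* (M ≃ₗ[ℤ] M))

variable (M Q) in
/-- The lattice of functions on `Q` vanishing at `1`. -/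
abbrev BasedFunctions : Submodule ℤ (Q → M) := LinearMap.ker (LinearMap.proj 1)

/-- The projection to the functions vanishing at `1`, along the orbit maps `q ↦ q m`. -/
def basedProj : (Q → M) →ₗ[ℤ] BasedFunctions M Q where
  toFun n := ⟨fun p => n p - α p (n 1), by simp⟩
  map_add' m n := by
    ext p
    simp only [Pi.add_apply, map_add, Submodule.coe_add]
    abel
  map_smul' c n := by
    ext p
    simp [smul_sub]

@[simp]
theorem basedProj_apply (n : Q → M) (p : Q) : (basedProj α n : Q → M) p = n p - α p (n 1) := rfl

variable (M) in
/-- Right translation of functions. -/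
def translate (q : Q) : (Q → M) →ₗ[ℤ] (Q → M) := LinearMap.funLeft ℤ M fun p => p * q

@[simp]
theorem translate_apply (q : Q) (n : Q → M) (p : Q) : translate M q n p = n (p * q) := rfl

theorem basedFunctions_one (c : BasedFunctions M Q) : (c : Q → M) 1 = 0 := c.2

/-- The action on the functions vanishing at `1`, as a quotient of the functions by the orbit
maps. -/
noncomputable def basedAction : Q →* (BasedFunctions M Q ≃ₗ[ℤ] BasedFunctions M Q) :=
  linearActionOfEnd
    { toFun := fun q => (basedProj α ∘ₗ translate M q) ∘ₗ (BasedFunctions M Q).subtype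
      map_one' := by
        ext c p
        simp [basedFunctions_one]
      map_mul' := fun p q => by
        ext c r
        simp [mul_assoc] }

@[simp]
theorem basedAction_apply (q : Q) (c : BasedFunctions M Q) (p : Q) :
    (basedAction α q c : Q → M) p = (c : Q → M) (p * q) - α p ((c : Q → M) q) := by
  change (c : Q → M) (p * q) - α p ((c : Q → M) (1 * q)) = _
  rw [one_mul]

/-- The kernel of `basedProj` is the lattice of orbit maps, which right translation preserves;
`basedAction` is the action induced on the quotient. -/
theorem basedAction_basedProj (q : Q) (n : Q → M) :
    basedAction α q (basedProj α n) = basedProj α (translate M q n) := by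
  ext p
  simp

theorem finrank_basedFunctions_add [Finite Q] [Module.Free ℤ M] [Module.Finite ℤ M] :
    Module.finrank ℤ (BasedFunctions M Q) + Module.finrank ℤ M = Nat.card Q * Module.finrank ℤ M := by
  have := Fintype.ofFinite Q
  have h := Submodule.finrank_quotient_add_finrank (BasedFunctions M Q)
  rw [((LinearMap.proj 1 : (Q → M) →ₗ[ℤ] M).quotKerEquivOfSurjective
    (LinearMap.proj_surjective 1)).finrank_eq] at h
  rw [add_comm, h, Module.finrank_pi_fintype, Finset.sum_const, Finset.card_univ,
    Nat.card_eq_fintype_card, smul_eq_mul]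

end Lattice

/-! ### Linearization of a lattice action -/

section Linearize

variable {k L M : Type u} {Q : Type w} [Field k] [Field L] [Algebra k L] [Group Q]
  [AddCommGroup M] (σ : Q →* (L ≃ₐ[k] L)) (α : Q →* (M ≃ₗ[ℤ] M))
  (τ : Multiplicative M →* L)
  (hτ : ∀ q m, σ q (τ (.ofAdd m)) = τ (.ofAdd (α q m)))

/-- The monomial action on the group algebra of `BasedFunctions M Q` with cocycle given by `τ`. -/
noncomputable def basedMonomialAction : Q →* (AddMonoidAlgebra L (BasedFunctions M Q) ≃ₐ[k]
    AddMonoidAlgebra L (BasedFunctions M Q)) :=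
  monomialAction σ (basedAction α)
    (fun q => τ.comp (AddMonoidHom.toMultiplicative
      ((LinearMap.proj q ∘ₗ (BasedFunctions M Q).subtype).toAddMonoidHom)))
    (by
      intro p q c
      simp only [MonoidHom.comp_apply, AddMonoidHom.toMultiplicative_apply_apply, toAdd_ofAdd,
        LinearMap.toAddMonoidHom_coe, LinearMap.comp_apply, LinearMap.proj_apply,
        Submodule.subtype_apply, hτ, ← map_mul, ← ofAdd_add, basedAction_apply]
      congr 2
      abel)

theorem basedMonomialAction_single (q : Q) (c : BasedFunctions M Q) (l : L) :
    basedMonomialAction σ α τ hτ q (.single c l) =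
      .single (basedAction α q c) (σ q l * τ (.ofAdd ((c : Q → M) q))) :=
  isMonomialAction_monomialAction _ _ _ _ q c l

/-- The monomials permuted by the action. -/
noncomputable def basedMonomial (n : Q → M) : AddMonoidAlgebra L (BasedFunctions M Q) :=
  .single (basedProj α n) (τ (.ofAdd (n 1)))

/-- The cocycle is chosen for this: its exponent `n q - α q (n 1)` added to `α q (n 1)` gives `n q`,
the value at `1` of the translate. -/
theorem basedMonomialAction_basedMonomial (q : Q) (n : Q → M) :
    basedMonomialAction σ α τ hτ q (basedMonomial α τ n) =
      basedMonomial α τ (translate M q n) := by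
  rw [basedMonomial, basedMonomialAction_single, basedAction_basedProj, hτ, ← map_mul,
    ← ofAdd_add, basedMonomial]
  simp

theorem basedMonomial_zero : basedMonomial (Q := Q) α τ 0 = 1 := by
  simp [basedMonomial, AddMonoidAlgebra.one_def]

theorem basedMonomial_add (m n : Q → M) :
    basedMonomial α τ (m + n) = basedMonomial α τ m * basedMonomial α τ n := by
  simp [basedMonomial, AddMonoidAlgebra.single_mul_single]

/-- Orbit maps are the copy of `M` inside the function lattice, and their monomials are the elements
of `L` given by `τ`. -/
theorem basedMonomial_orbit (m : M) :
    basedMonomial α τ (fun q => α q m) = algebraMap L _ (τ (.ofAdd m)) := by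
  have : basedProj α (fun q => α q m) = 0 := by
    ext p
    simp
  simp [basedMonomial, this]

theorem basedMonomial_coe (c : BasedFunctions M Q) :
    basedMonomial α τ (c : Q → M) = .single c 1 := by
  have : basedProj α (c : Q → M) = c := by
    ext p
    simp [basedFunctions_one]
  simp [basedMonomial, this, basedFunctions_one]

end Linearize

section Linearize

variable {k L M E : Type u} {Q : Type} [Field k] [Field L] [Algebra k L] [Group Q]
  [AddCommGroup M] [Field E] [Algebra k E] [Algebra L E]
  [Algebra (AddMonoidAlgebra L (BasedFunctions M Q)) E]
  [IsScalarTower k L E]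
  [IsScalarTower L (AddMonoidAlgebra L (BasedFunctions M Q)) E]
  (α : Q →* (M ≃ₗ[ℤ] M)) (τ : Multiplicative M →* L)

/-- The generators of the linearization. -/
noncomputable def linearGenerators {ι κ : Type*} [DecidableEq Q] (b : ι → M) (y : κ → L) :
    (Q × ι) ⊕ κ → E :=
  Sum.elim (fun p => algebraMap (AddMonoidAlgebra L (BasedFunctions M Q)) E
    (basedMonomial α τ (Pi.single p.1 (b p.2)))) (fun i => algebraMap L E (y i))

-- Monomials are multiplicative in the exponent, so the exponents whose monomial lies in `F` form a
-- subgroup.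
omit [Algebra L E] [IsScalarTower L (AddMonoidAlgebra L (BasedFunctions M Q)) E] in
theorem algebraMap_basedMonomial_mem [Finite Q] [DecidableEq Q] (F : Subfield E) {ι : Type*}
    (b : Module.Basis ι ℤ M) (h : ∀ q i, algebraMap (AddMonoidAlgebra L (BasedFunctions M Q)) E
      (basedMonomial α τ (Pi.single q (b i))) ∈ F) (n : Q → M) :
    algebraMap (AddMonoidAlgebra L (BasedFunctions M Q)) E (basedMonomial α τ n) ∈ F := by
  have := Fintype.ofFinite Q
  let H : AddSubgroup (Q → M) :=
    { carrier := {n | algebraMap (AddMonoidAlgebra L (BasedFunctions M Q)) E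
        (basedMonomial α τ n) ∈ F}
      zero_mem' := by
        rw [Set.mem_ofPred_eq, basedMonomial_zero, map_one]
        exact F.one_mem
      add_mem' := fun {m n} hm hn => by
        rw [Set.mem_ofPred_eq, basedMonomial_add, map_mul]
        exact F.mul_mem hm hn
      neg_mem' := fun {n} hn => by
        have h1 : algebraMap (AddMonoidAlgebra L (BasedFunctions M Q)) E
            (basedMonomial α τ (-n)) = (algebraMap _ E (basedMonomial α τ n))⁻¹ := by
          refine eq_inv_of_mul_eq_one_left ?_
          rw [← map_mul, ← basedMonomial_add, neg_add_cancel, basedMonomial_zero, map_one]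
        rw [Set.mem_ofPred_eq, h1]
        exact F.inv_mem hn }
  have hs : ∀ q (m : M), Pi.single q m ∈ H := by
    intro q m
    induction b.mem_span m using Submodule.span_induction with
    | mem x hx => obtain ⟨i, rfl⟩ := hx; exact h q i
    | zero => rw [Pi.single_zero]; exact H.zero_mem
    | add x y _ _ hx hy => rw [Pi.single_add]; exact H.add_mem hx hy
    | smul c x _ hx => rw [Pi.single_smul]; exact H.zsmul_mem hx c
  rw [← Finset.univ_sum_single n]
  exact H.sum_mem fun q _ => hs q _

/-- The generators give all monomials of the function lattice. Orbit maps then give the image of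
`τ`, hence with `y` all of `L`, and functions vanishing at `1` give the monomials of `L[C]`. -/
theorem adjoin_linearGenerators [Finite Q] [DecidableEq Q]
    [IsFractionRing (AddMonoidAlgebra L (BasedFunctions M Q)) E] {ι κ : Type*}
    (b : Module.Basis ι ℤ M) (y : κ → L)
    (htop : IntermediateField.adjoin k (Set.range τ ∪ Set.range y) = ⊤) :
    IntermediateField.adjoin k
      (Set.range (linearGenerators α τ b y : (Q × ι) ⊕ κ → E)) = ⊤ := by
  set F := IntermediateField.adjoin k (Set.range (linearGenerators α τ b y : (Q × ι) ⊕ κ → E))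
  have h1 : ∀ n : Q → M, algebraMap (AddMonoidAlgebra L (BasedFunctions M Q)) E
      (basedMonomial α τ n) ∈ F.toSubfield :=
    algebraMap_basedMonomial_mem α τ F.toSubfield b fun q i =>
      IntermediateField.subset_adjoin _ _ ⟨.inl (q, i), rfl⟩
  have h2 : ∀ l : L, algebraMap L E l ∈ F := by
    intro l
    have hl : l ∈ IntermediateField.adjoin k (Set.range τ ∪ Set.range y) := by rw [htop]; trivial
    have hle : IntermediateField.adjoin k (Set.range τ ∪ Set.range y) ≤
        F.comap (IsScalarTower.toAlgHom k L E) := by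
      rw [IntermediateField.adjoin_le_iff]
      rintro _ (⟨m, rfl⟩ | ⟨i, rfl⟩)
      · have := h1 fun q => α q m.toAdd
        rw [basedMonomial_orbit, ← IsScalarTower.algebraMap_apply] at this
        exact this
      · exact IntermediateField.subset_adjoin _ _ ⟨.inr i, rfl⟩
    exact hle hl
  rw [← IntermediateField.toSubfield_inj]
  refine subfield_eq_top_of_closure_eq_top (L := L) (C := BasedFunctions M Q) _ h2
    (s := Set.univ) (by simp) fun c _ => ?_
  rw [← basedMonomial_coe α τ]
  exact h1 _

/-- The transcendence degree grows by at least the rank of the based functions, which is `Nat.card Q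
- 1` times that of `M`. -/
theorem card_linearGenerators_le_trdeg [Finite Q] [Module.Free ℤ M] [Module.Finite ℤ M]
    [IsFractionRing (AddMonoidAlgebra L (BasedFunctions M Q)) E] {d : ℕ}
    (hd : ((Module.finrank ℤ M + d : ℕ) : Cardinal) ≤ Algebra.trdeg k L) :
    ((Nat.card Q * Module.finrank ℤ M + d : ℕ) : Cardinal) ≤ Algebra.trdeg k E := by
  have h1 := algebraicIndependent_single (L := L) (F := E) (IsFractionRing.injective _ _)
    (Module.finBasis ℤ (BasedFunctions M Q)).linearIndependent
  have h2 := h1.lift_cardinalMk_le_trdeg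
  rw [Cardinal.mk_fin, Cardinal.lift_natCast, Cardinal.nat_le_lift_iff] at h2
  rw [← trdeg_add_eq k L, ← finrank_basedFunctions_add, add_assoc, add_comm, Nat.cast_add]
  exact add_le_add hd h2

end Linearize

/-- Reduction of the quotient of `L` by `Q` to the quotient of a linear field. -/
theorem admits_of_linearization {k L M : Type u} {Q : Type} [Field k] [Field L] [Algebra k L]
    [Group Q] [Finite Q] [AddCommGroup M] [Module.Free ℤ M] [Module.Finite ℤ M]
    (hQ : LinearQuotientsAdmitTowers k Q) (σ : Q →* (L ≃ₐ[k] L)) (hσ : Function.Injective σ)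
    (α : Q →* (M ≃ₗ[ℤ] M)) (τ : Multiplicative M →* L)
    (hτ : ∀ q m, σ q (τ (.ofAdd m)) = τ (.ofAdd (α q m))) {d : ℕ} (y : Fin d → L)
    (hy : ∀ q i, σ q (y i) = y i)
    (htop : IntermediateField.adjoin k (Set.range τ ∪ Set.range y) = ⊤)
    (hd : ((Module.finrank ℤ M + d : ℕ) : Cardinal) ≤ Algebra.trdeg k L)
    (R : Type u) [CommRing R] [IsDomain R] [Algebra k R] [Algebra.FiniteType k R] [Algebra R L]
    [IsScalarTower k R L] (hR : IsInvariantModel σ R) :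
    AdmitsToricRationalTower (affineVariety k R) := by
  classical
  have := Fintype.ofFinite Q
  let s := basedMonomialAction σ α τ hτ
  have hs : IsMonomialAction σ (fun q => basedAction α q) (fun q c => τ (.ofAdd ((c : Q → M) q))) s :=
    basedMonomialAction_single σ α τ hτ
  refine admits_of_isMonomialAction k R L σ hσ hR.injective hR.invariant_iff (basedAction α) _ s hs ?_
  intro R₁ _ _ _ _ _ _ hinj hinv hfrac
  have := isDomain_addMonoidAlgebra L (BasedFunctions M Q)
  let E := FractionRing (AddMonoidAlgebra L (BasedFunctions M Q))
  let b := Module.finBasis ℤ M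
  let x : (Q × Fin (Module.finrank ℤ M)) ⊕ Fin d → E := linearGenerators α τ b y
  have hx : IntermediateField.adjoin k (Set.range x) = ⊤ := adjoin_linearGenerators α τ b y htop
  let ε := (Fintype.equivFin ((Q × Fin (Module.finrank ℤ M)) ⊕ Fin d)).symm
  have hrange : Set.range (x ∘ ε) = Set.range x := ε.surjective.range_comp x
  -- Independence comes from counting: the generators are no more numerous than the transcendence
  -- degree.
  have hai : AlgebraicIndependent k x := by
    refine algebraicIndependent_of_le_trdeg x hx ?_
    have := card_linearGenerators_le_trdeg (k := k) (L := L) (M := M) (E := E) (Q := Q) hd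
    simpa [Nat.card_sum, Nat.card_prod] using this
  refine hQ E (fractionAction s) (injective_fractionAction (hs.injective hσ)) _ (x ∘ ε)
    (hai.comp _ ε.injective) (by rw [hrange, hx]) ?_ R₁ ?_
  · intro q i
    rw [hrange]
    refine Submodule.subset_span ?_
    rcases h : ε i with ⟨p, j⟩ | j
    · refine ⟨.inl (p * q⁻¹, j), ?_⟩
      simp only [Function.comp_apply, h]
      change algebraMap _ E _ = fractionAction s q (algebraMap _ E _)
      rw [fractionAction_algebraMap, basedMonomialAction_basedMonomial]
      congr 2
      ext r
      simp [Pi.single_apply, eq_mul_inv_iff_mul_eq]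
    · refine ⟨.inr j, ?_⟩
      simp only [Function.comp_apply, h]
      change algebraMap L E _ = fractionAction s q (algebraMap L E _)
      rw [IsScalarTower.algebraMap_apply L (AddMonoidAlgebra L (BasedFunctions M Q)) E,
        fractionAction_algebraMap, hs.map_algebraMap, hy]
  · exact isInvariantModel_fractionAction s R₁ hinj hinv hfrac

/-! ### Invariants of extensions by abelian groups -/

/-- A semilinear representation spanned by `n` vectors has at most `n` invariant generators. -/
theorem exists_invariant_generators {k E G : Type*} [Field k] [Field E] [Algebra k E] [Group G]
    [Finite G] (σ : G →* (E ≃ₐ[k] E)) (F : IntermediateField k E)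
    (hF : ∀ g, ∀ e ∈ F, σ g e ∈ F) (hinj : Function.Injective (restrictAction σ F hF)) {n : ℕ}
    (x : Fin n → E) (hx : ∀ g i, σ g (x i) ∈ Submodule.span k (Set.range x)) :
    ∃ d ≤ n, ∃ y : Fin d → E, (∀ g i, σ g (y i) = y i) ∧
      ∀ i, x i ∈ Submodule.span F (Set.range y) := by
  let V := Submodule.span F (Set.range x)
  have hV : ∀ g, ∀ v ∈ V, σ g v ∈ V := by
    intro g v hv
    induction hv using Submodule.span_induction with
    | mem v hv =>
      obtain ⟨i, rfl⟩ := hv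
      exact Submodule.span_le_restrictScalars k F _ (hx g i)
    | zero => rw [map_zero]; exact V.zero_mem
    | add v w _ _ hv hw => rw [map_add]; exact V.add_mem hv hw
    | smul c v _ hv =>
      have : σ g (c • v) = (restrictAction σ F hF g c) • σ g v := by
        simp [IntermediateField.smul_def]
      rw [this]
      exact V.smul_mem _ hv
  let s : Representation k G V :=
    { toFun := fun g =>
        { toFun := fun v => ⟨σ g v, hV g v v.2⟩
          map_add' := fun v w => Subtype.ext (map_add (σ g) _ _)
          map_smul' := fun c v => Subtype.ext (_root_.map_smul (σ g) c v.1) }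
      map_one' := by ext v; simp
      map_mul' := fun g h => by ext v; simp }
  have hs : ∀ g (c : F) v, s g (c • v) = restrictAction σ F hF g c • s g v := by
    intro g c v
    refine Subtype.ext ?_
    change σ g (c • (v : E)) = restrictAction σ F hF g c • σ g v
    simp [IntermediateField.smul_def]
  -- No-name lemma: the `F`-span of the `x i` is a semilinear representation of a group faithful on
  -- `F`, so it has invariant generators.
  have htop := span_invariants_eq_top hinj s hs
  have := Module.Finite.span_of_finite F (Set.finite_range x)
  obtain ⟨f, hf, hspan, -⟩ := Submodule.exists_fun_fin_finrank_span_eq F {v : V | ∀ g, s g v = v}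
  refine ⟨_, ?_, fun i => f i, fun g i => congrArg Subtype.val (hf i g), fun i => ?_⟩
  · rw [htop, finrank_top]
    have h := finrank_range_le_card (R := F) x
    rw [Fintype.card_fin] at h
    exact h
  · have hi : (⟨x i, Submodule.subset_span ⟨i, rfl⟩⟩ : V) ∈ Submodule.span F (Set.range f) := by
      rw [hspan, htop]; trivial
    have := Submodule.mem_map_of_mem (f := V.subtype) hi
    rw [Submodule.map_span, ← Set.range_comp] at this
    exact this

/-- Adjoining algebraic elements needs no inverses, and `S` is already closed under products. -/
theorem span_eq_top_of_adjoin_eq_top {F E : Type*} [Field F] [Field E] [Algebra F E]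
    (S : Submonoid E) (hS : ∀ e ∈ S, IsAlgebraic F e)
    (h : IntermediateField.adjoin F (S : Set E) = ⊤) : Submodule.span F (S : Set E) = ⊤ := by
  have h1 := IntermediateField.adjoin_toSubalgebra_of_isAlgebraic (F := F) (S := (S : Set E)) hS
  have h2 := Algebra.adjoin_eq_span F (S : Set E)
  rw [← h1, Submonoid.closure_eq, h, IntermediateField.top_toSubalgebra,
    Algebra.top_toSubmodule] at h2
  exact h2.symm

theorem span_eq_top_of_adjoin_union_eq_top {k E : Type*} [Field k] [Field E] [Algebra k E]
    (F : IntermediateField k E) (S : Submonoid E) (hS : ∀ e ∈ S, IsAlgebraic F e) (Y : Set E)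
    (hY : Y ⊆ F) (h : IntermediateField.adjoin k ((S : Set E) ∪ Y) = ⊤) :
    Submodule.span F (S : Set E) = ⊤ := by
  refine span_eq_top_of_adjoin_eq_top S hS ?_
  rw [← IntermediateField.restrictScalars_eq_top_iff (K := k),
    IntermediateField.restrictScalars_adjoin, eq_top_iff, ← h, Set.union_comm]
  exact IntermediateField.adjoin.mono _ _ _ (Set.union_subset_union_left _ hY)

/-- The invariants of an action on a field. -/
def invariantField {k E A : Type*} [Field k] [Field E] [Algebra k E] [Group A]
    (σ : A →* (E ≃ₐ[k] E)) : IntermediateField k E where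
  carrier := {e | ∀ a, σ a e = e}
  mul_mem' hx hy a := by rw [map_mul, hx a, hy a]
  add_mem' hx hy a := by rw [map_add, hx a, hy a]
  algebraMap_mem' c a := (σ a).commutes c
  inv_mem' x hx a := by rw [map_inv₀, hx a]

/-- The invariants of a diagonalizable action on a field generated by eigenvectors. -/
theorem mem_adjoin_of_invariant {k E A Λ : Type*} [Field k] [CharZero k] [Field E] [Algebra k E]
    [Group A] [Finite A] [AddCommGroup Λ] (σ : A →* (E ≃ₐ[k] E)) (u : Multiplicative Λ →* E)
    (ψ : Multiplicative Λ →* (A →* kˣ)) (h : ∀ a m, σ a (u m) = (ψ m a : k) • u m) (Y : Set E)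
    (hY : ∀ a, ∀ y ∈ Y, σ a y = y)
    (htop : IntermediateField.adjoin k (Set.range u ∪ Y) = ⊤) {z : E} (hz : ∀ a, σ a z = z) :
    z ∈ IntermediateField.adjoin k (u '' {m | ψ m = 1} ∪ Y) := by
  classical
  have := Fintype.ofFinite A
  set F := IntermediateField.adjoin k (u '' {m | ψ m = 1} ∪ Y) with hFdef
  have hF : ∀ a (c : F), σ a c = c := by
    intro a c
    have hle : F ≤ invariantField σ := by
      rw [IntermediateField.adjoin_le_iff]
      rintro y (⟨m, hm, rfl⟩ | hy) a
      · rw [h, show ψ m = 1 from hm]; simp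
      · exact hY a y hy
    exact hle c.2 a
  -- Characters of `A` are killed by the order of `A`, so each eigenvector is algebraic over the
  -- candidate field `F`.
  have hpow : ∀ m, u m ^ Nat.card A ∈ F := by
    intro m
    rw [← map_pow]
    refine IntermediateField.subset_adjoin _ _ (.inl ⟨_, ?_, rfl⟩)
    rw [Set.mem_ofPred_eq, map_pow]
    ext a
    rw [MonoidHom.pow_apply, ← map_pow, pow_card_eq_one', map_one]
    rfl
  have hint : ∀ e ∈ Set.range u, IsIntegral F e := by
    rintro _ ⟨m, rfl⟩
    refine IsIntegral.of_pow Nat.card_pos (n := Nat.card A) ?_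
    exact isIntegral_algebraMap (x := (⟨_, hpow m⟩ : F))
  have htop' : Submodule.span F (Set.range u) = ⊤ := by
    exact span_eq_top_of_adjoin_union_eq_top F (MonoidHom.mrange u)
      (fun e he => (hint e he).isAlgebraic) Y
      (fun y hy => IntermediateField.subset_adjoin _ _ (.inr hy)) htop
  -- The eigenvectors span `E` over `F`. The trace of one with nontrivial character is zero, and the
  -- others lie in `F` already.
  have key : ∀ e : E, ∑ a, σ a e ∈ F := by
    intro e
    have he : e ∈ Submodule.span F (Set.range u) := by rw [htop']; trivial
    induction he using Submodule.span_induction with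
    | mem e he =>
      obtain ⟨m, rfl⟩ := he
      simp only [h, ← Finset.sum_smul]
      by_cases hm : ψ m = 1
      · exact IntermediateField.smul_mem _ (IntermediateField.subset_adjoin _ _ (.inl ⟨m, hm, rfl⟩))
      · have : ∑ a, (ψ m a : k) = 0 := by
          refine sum_hom_units_eq_zero ((Units.coeHom k).comp (ψ m)) fun h0 => hm ?_
          ext a
          exact DFunLike.congr_fun h0 a
        rw [this, zero_smul]
        exact F.zero_mem
    | zero => simp
    | add e e' _ _ he he' =>
      simp only [map_add, Finset.sum_add_distrib]
      exact F.add_mem he he'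
    | smul c e _ he =>
      simp only [IntermediateField.smul_def, smul_eq_mul, map_mul, hF, ← Finset.mul_sum]
      exact F.mul_mem c.2 he
  have h5 := key z
  simp only [hz, Finset.sum_const, Finset.card_univ] at h5
  -- The trace of an invariant is its multiple by the order of `A`, which is invertible in
  -- characteristic zero.
  have h6 : z = ((Fintype.card A : k)⁻¹) • (Fintype.card A • z) := by
    rw [← Nat.cast_smul_eq_nsmul k, smul_smul, inv_mul_cancel₀ (by simp), one_smul]
  rw [h6]
  exact IntermediateField.smul_mem _ h5

theorem map_ne_zero_of_group {G E : Type*} [Group G] [Field E] (u : G →* E) (m : G) :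
    u m ≠ 0 := fun h0 => by
  have h1 := map_mul u m m⁻¹
  rw [h0, zero_mul, mul_inv_cancel, map_one] at h1
  exact one_ne_zero h1

/-- Normality of `A` in the semidirect product. -/
theorem invariantField_inl_stable {k E A Q : Type*} [Field k] [Field E] [Algebra k E] [Group A]
    [Group Q] {φ : Q →* MulAut A} (σ : A ⋊[φ] Q →* (E ≃ₐ[k] E)) (q : Q) (e : E)
    (he : e ∈ invariantField (σ.comp SemidirectProduct.inl)) :
    σ.comp SemidirectProduct.inr q e ∈ invariantField (σ.comp SemidirectProduct.inl) := by
  intro a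
  have h1 : (SemidirectProduct.inl a * SemidirectProduct.inr q : A ⋊[φ] Q) =
      SemidirectProduct.inr q * SemidirectProduct.inl (φ q⁻¹ a) := by
    ext <;> simp
  change σ (SemidirectProduct.inl a) (σ (SemidirectProduct.inr q) e) = σ (SemidirectProduct.inr q) e
  rw [← AlgEquiv.mul_apply, ← map_mul, h1, map_mul, AlgEquiv.mul_apply]
  exact congrArg _ (he _)

/-! ### Lattices of eigenvectors for a split extension -/

section Eigen

variable {k E Λ A Q : Type*} [Field k] [Field E] [Algebra k E] [Group A] [Group Q]
  {φ : Q →* MulAut A} [AddCommGroup Λ]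
  {α : Q →* (Λ ≃ₗ[ℤ] Λ)} {ψ : Multiplicative Λ →* (A →* kˣ)}
  {σ : A ⋊[φ] Q →* (E ≃ₐ[k] E)} {u : Multiplicative Λ →* E}

/-- The lattice `Λ` parametrizes eigenvectors of `A` in `E`, with characters given by `ψ`, which
are permuted by `Q`. -/
structure IsEigenlattice (α : Q →* (Λ ≃ₗ[ℤ] Λ)) (ψ : Multiplicative Λ →* (A →* kˣ))
    (σ : A ⋊[φ] Q →* (E ≃ₐ[k] E)) (u : Multiplicative Λ →* E) : Prop where
  injective : Function.Injective α
  equivariant : ∀ q m a, ψ (.ofAdd (α q m)) (φ q a) = ψ (.ofAdd m) a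
  eq_one : ∀ a, (∀ m, ψ m a = 1) → a = 1
  eq_of_eq_smul : ∀ (c : k) m m', u m = c • u m' → m = m'
  apply_eq : ∀ g m, σ g (u (.ofAdd m)) =
    (ψ (.ofAdd (α g.right m)) g.left : k) • u (.ofAdd (α g.right m))

namespace IsEigenlattice

variable (h : IsEigenlattice α ψ σ u)
include h

theorem apply_inl (a : A) (m : Multiplicative Λ) :
    σ (SemidirectProduct.inl a) (u m) = (ψ m a : k) • u m := by
  have := h.apply_eq (SemidirectProduct.inl a) m.toAdd
  simpa using this

theorem apply_inr (q : Q) (m : Λ) :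
    σ (SemidirectProduct.inr q) (u (.ofAdd m)) = u (.ofAdd (α q m)) := by
  have := h.apply_eq (SemidirectProduct.inr q) m
  simpa using this

theorem adjoin_stable (g : A ⋊[φ] Q) (e : E) (he : e ∈ IntermediateField.adjoin k (Set.range u)) :
    σ g e ∈ IntermediateField.adjoin k (Set.range u) := by
  have hle : IntermediateField.adjoin k (Set.range u) ≤
      (IntermediateField.adjoin k (Set.range u)).comap (σ g : E →ₐ[k] E) := by
    rw [IntermediateField.adjoin_le_iff]
    rintro _ ⟨m, rfl⟩
    change σ g (u (.ofAdd m.toAdd)) ∈ IntermediateField.adjoin k (Set.range u)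
    rw [h.apply_eq]
    exact IntermediateField.smul_mem _ (IntermediateField.subset_adjoin k _ (Set.mem_range_self _))
  exact hle he

/-- An element fixing all eigenvectors fixes their exponents, so its component in `Q` is trivial.
Its component in `A` is then killed by all the characters, hence trivial. -/
theorem injective_restrictAction : Function.Injective
    (restrictAction σ (IntermediateField.adjoin k (Set.range u)) h.adjoin_stable) := by
  rw [injective_iff_map_eq_one]
  intro g hg
  have h1 : ∀ m : Λ, u (.ofAdd m) =
      (ψ (.ofAdd (α g.right m)) g.left : k) • u (.ofAdd (α g.right m)) := by
    intro m
    rw [← h.apply_eq]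
    have := congrArg Subtype.val (DFunLike.congr_fun hg
      (⟨u (.ofAdd m), IntermediateField.subset_adjoin _ _ ⟨_, rfl⟩⟩ :
        IntermediateField.adjoin k (Set.range u)))
    rw [coe_restrictAction_apply] at this
    exact this.symm
  have h2 : ∀ m : Λ, α g.right m = m := fun m =>
    (Multiplicative.ofAdd.injective (h.eq_of_eq_smul _ _ _ (h1 m))).symm
  have h3 : g.right = 1 := h.injective (LinearEquiv.ext fun m => by rw [h2, map_one]; rfl)
  refine SemidirectProduct.ext (h.eq_one _ fun m => ?_) h3
  have h4 := h1 m.toAdd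
  rw [h2] at h4
  refine Units.ext (smul_left_injective k (map_ne_zero_of_group u m) ?_)
  simpa using h4.symm

omit h in
variable (ψ) in
/-- The sublattice of invariant eigenvectors. -/
def kerLattice : Submodule ℤ Λ where
  carrier := {m | ∀ a, ψ (.ofAdd m) a = 1}
  add_mem' {m n} hm hn a := by
    rw [ofAdd_add, map_mul, MonoidHom.mul_apply, hm a, hn a, one_mul]
  zero_mem' a := by rw [ofAdd_zero, map_one, MonoidHom.one_apply]
  smul_mem' c m hm a := by
    rw [ofAdd_zsmul, map_zpow, MonoidHom.zpow_apply, hm a, one_zpow]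

theorem kerLattice_stable (q : Q) (m : Λ) (hm : m ∈ kerLattice ψ) : α q m ∈ kerLattice ψ := by
  intro a
  have h1 := h.equivariant q m (φ q⁻¹ a)
  rw [← MulAut.mul_apply, ← map_mul, mul_inv_cancel, map_one, MulAut.one_apply,
    hm] at h1
  exact h1

/-- The action on the sublattice of invariant eigenvectors. -/
noncomputable def kerAction : Q →* (kerLattice ψ ≃ₗ[ℤ] kerLattice ψ) :=
  linearActionOfEnd
    { toFun := fun q => (α q).toLinearMap.restrict (h.kerLattice_stable q)
      map_one' := by ext; simp
      map_mul' := fun p q => by ext; simp }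

/-- For any `m` the multiple by the order of `A` has trivial character, so its eigenvector lies in
the field of invariants of `A`. An element of `Q` trivial there fixes that multiple, hence `m`,
because the lattice is torsion-free. -/
theorem injective_restrictAction_inr [Finite A] [Module.Free ℤ Λ] : Function.Injective
    (restrictAction (σ.comp SemidirectProduct.inr) (invariantField (σ.comp SemidirectProduct.inl))
      (invariantField_inl_stable σ)) := by
  rw [injective_iff_map_eq_one]
  intro q hq
  refine h.injective (LinearEquiv.ext fun m => ?_)
  rw [map_one]
  have hm : ψ (.ofAdd (Nat.card A • m)) = 1 := by
    rw [ofAdd_nsmul, map_pow]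
    ext a
    rw [MonoidHom.pow_apply, ← map_pow, pow_card_eq_one', map_one]
    rfl
  have hL : u (.ofAdd (Nat.card A • m)) ∈ invariantField (σ.comp SemidirectProduct.inl) := by
    intro a
    change σ (SemidirectProduct.inl a) _ = _
    rw [h.apply_inl, hm]
    simp
  have h1 := congrArg Subtype.val (DFunLike.congr_fun hq
    (⟨_, hL⟩ : invariantField (σ.comp SemidirectProduct.inl)))
  rw [coe_restrictAction_apply] at h1
  change σ (SemidirectProduct.inr q) _ = u _ at h1
  rw [h.apply_inr] at h1
  have h2 : α q (Nat.card A • m) = Nat.card A • m :=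
    Multiplicative.ofAdd.injective (h.eq_of_eq_smul 1 _ _ (by rw [h1, one_smul]))
  rw [map_nsmul, ← natCast_zsmul, ← natCast_zsmul] at h2
  exact smul_right_injective Λ (Nat.cast_ne_zero.mpr (Nat.card_pos (α := A)).ne') h2

end IsEigenlattice

end Eigen

theorem isAlgebraic_invariantField {k E A : Type*} [Field k] [Field E] [Algebra k E] [Group A]
    [Finite A] (σ : A →* (E ≃ₐ[k] E)) : Algebra.IsAlgebraic (invariantField σ) E := by
  let : MulSemiringAction A E := MulSemiringAction.compHom E σ
  have : SMulCommClass A (invariantField σ) E := ⟨fun a c e => by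
    change σ a (c.1 * e) = c.1 * σ a e
    rw [map_mul, c.2 a]⟩
  have : Algebra.IsInvariant (invariantField σ) E A := ⟨fun e he => ⟨⟨e, he⟩, rfl⟩⟩
  have := Algebra.IsInvariant.isIntegral (invariantField σ) E A
  infer_instance

theorem trdeg_invariantField {k E A : Type*} [Field k] [Field E] [Algebra k E] [Group A]
    [Finite A] (σ : A →* (E ≃ₐ[k] E)) : Algebra.trdeg k (invariantField σ) = Algebra.trdeg k E := by
  have := isAlgebraic_invariantField σ
  rw [← trdeg_add_eq k (invariantField σ) (A := E), trdeg_eq_zero_iff.mpr this, add_zero]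

namespace IsEigenlattice

/-- Once the `x i` are traded for invariant `y i`, the invariants of `A` are generated by the `y i`
and the eigenvectors of trivial character. What remains is `Q` acting on this field through the
lattice `kerLattice ψ`, the situation of `admits_of_linearization`. -/
theorem admits {k E Λ : Type u} {A Q : Type} [Field k] [CharZero k] [Field E]
    [Algebra k E] [Group A] [Finite A] [Group Q] [Finite Q] {φ : Q →* MulAut A} [AddCommGroup Λ]
    [Module.Free ℤ Λ] [Module.Finite ℤ Λ] {α : Q →* (Λ ≃ₗ[ℤ] Λ)}
    {ψ : Multiplicative Λ →* (A →* kˣ)} {σ : A ⋊[φ] Q →* (E ≃ₐ[k] E)} {u : Multiplicative Λ →* E}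
    (h : IsEigenlattice α ψ σ u) (hQ : LinearQuotientsAdmitTowers k Q)
    {n : ℕ} (x : Fin n → E)
    (hx : ∀ g i, σ g (x i) ∈ Submodule.span k (Set.range x))
    (htop : IntermediateField.adjoin k (Set.range u ∪ Set.range x) = ⊤)
    (hn : ((Module.finrank ℤ Λ + n : ℕ) : Cardinal) ≤ Algebra.trdeg k E)
    (R : Type u) [CommRing R] [IsDomain R] [Algebra k R] [Algebra.FiniteType k R] [Algebra R E]
    [IsScalarTower k R E] (hR : IsInvariantModel σ R) :
    AdmitsToricRationalTower (affineVariety k R) := by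
  have : Finite (A ⋊[φ] Q) := Finite.of_equiv _ SemidirectProduct.equivProd.symm
  obtain ⟨d, hd, y, hy, hxy⟩ := exists_invariant_generators σ
    (IntermediateField.adjoin k (Set.range u)) h.adjoin_stable h.injective_restrictAction x hx
  have htop' : IntermediateField.adjoin k (Set.range u ∪ Set.range y) = ⊤ := by
    rw [eq_top_iff, ← htop, IntermediateField.adjoin_le_iff]
    have hle := IntermediateField.adjoin.mono k _ _
      (Set.subset_union_left (s := Set.range u) (t := Set.range y))
    rintro _ (⟨m, rfl⟩ | ⟨i, rfl⟩)
    · exact IntermediateField.subset_adjoin _ _ (.inl ⟨m, rfl⟩)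
    · have hxi := hxy i
      generalize x i = v at hxi ⊢
      induction hxi using Submodule.span_induction with
      | mem v hv => exact IntermediateField.subset_adjoin _ _ (.inr hv)
      | zero => exact zero_mem _
      | add v w _ _ hv hw => exact add_mem hv hw
      | smul c v _ hv => exact mul_mem (hle c.2) hv
  let σA : A →* (E ≃ₐ[k] E) := σ.comp SemidirectProduct.inl
  let L := invariantField σA
  let σQ : Q →* (L ≃ₐ[k] L) :=
    restrictAction (σ.comp SemidirectProduct.inr) L (invariantField_inl_stable σ)
  let M := kerLattice ψ
  have hτL : ∀ m : M, u (.ofAdd m.1) ∈ L := fun m a => by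
    change σ (SemidirectProduct.inl a) _ = _
    rw [h.apply_inl, m.2 a]
    simp
  let τ : Multiplicative M →* L :=
    { toFun := fun m => ⟨u (.ofAdd m.toAdd.1), hτL _⟩
      map_one' := Subtype.ext (map_one u)
      map_mul' := fun m m' => Subtype.ext (map_mul u (.ofAdd m.toAdd.1) (.ofAdd m'.toAdd.1)) }
  have hyL : ∀ i, y i ∈ L := fun i a => hy _ i
  have hτ : ∀ q m, σQ q (τ (.ofAdd m)) = τ (.ofAdd (h.kerAction q m)) := fun q m =>
    Subtype.ext (h.apply_inr q m.1)
  have hLtop : IntermediateField.adjoin k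
      (Set.range τ ∪ Set.range fun i => (⟨y i, hyL i⟩ : L)) = ⊤ := by
    have h1 : ∀ l : L, (l : E) ∈ (IntermediateField.adjoin k
        (Set.range τ ∪ Set.range fun i => (⟨y i, hyL i⟩ : L))).map L.val := by
      intro l
      rw [IntermediateField.adjoin_map]
      refine IntermediateField.adjoin.mono _ _ _ ?_ (mem_adjoin_of_invariant σA u ψ h.apply_inl
        (Set.range y) (by rintro a _ ⟨i, rfl⟩; exact hyL i a) htop' l.2)
      rintro _ (⟨m, hm, rfl⟩ | ⟨i, rfl⟩)
      · refine ⟨τ (.ofAdd ⟨m.toAdd, fun a => ?_⟩), .inl ⟨_, rfl⟩, rfl⟩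
        exact DFunLike.congr_fun hm a
      · exact ⟨_, .inr ⟨i, rfl⟩, rfl⟩
    rw [eq_top_iff]
    intro l _
    obtain ⟨l', hl', hll'⟩ := h1 l
    rwa [Subtype.val_injective hll'] at hl'
  have hdeg : ((Module.finrank ℤ M + d : ℕ) : Cardinal) ≤ Algebra.trdeg k L := by
    rw [trdeg_invariantField]
    refine le_trans (Nat.cast_le.mpr ?_) hn
    -- Passing to the invariants of a finite group keeps the transcendence degree, while neither the
    -- rank of the lattice nor the number of other generators grows.
    exact add_le_add (Submodule.finrank_le _) hd
  have hRL : ∀ r : R, algebraMap R E r ∈ L := fun r a =>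
    (hR.invariant_iff _).mpr ⟨r, 1, one_ne_zero, one_smul _ _⟩ _
  let algRL : Algebra R L := ((algebraMap R E).codRestrict L.toSubring hRL).toAlgebra
  have htow : IsScalarTower k R L := .of_algebraMap_eq fun c => Subtype.ext <|
    IsScalarTower.algebraMap_apply k R E c
  refine admits_of_linearization hQ σQ h.injective_restrictAction_inr h.kerAction τ hτ
    (fun i => (⟨y i, hyL i⟩ : L)) (fun q i => Subtype.ext (hy _ i)) hLtop hdeg R ⟨?_, ?_⟩
  · intro r r' hrr
    exact hR.injective (congrArg Subtype.val hrr)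
  · intro l
    -- Invariants under `A ⋊ Q` are the `Q`-invariants in the invariants of `A`, so `R` is also a
    -- model for `Q`.
    have h1 : (∀ q, σQ q l = l) ↔ ∀ g, σ g l = l := by
      refine ⟨fun hl g => ?_, fun hl q => Subtype.ext (hl _)⟩
      rw [← SemidirectProduct.inl_left_mul_inr_right g, map_mul, AlgEquiv.mul_apply]
      have h2 : σ (SemidirectProduct.inr g.right) l = l := congrArg Subtype.val (hl g.right)
      rw [h2]
      exact l.2 _
    rw [h1, hR.invariant_iff]
    refine exists_congr fun a => exists_congr fun b => and_congr_right fun _ => ?_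
    rw [Algebra.smul_def, Algebra.smul_def]
    exact ⟨fun h3 => Subtype.ext h3, fun h3 => congrArg Subtype.val h3⟩

end IsEigenlattice

/-! ### The permutation lattice of labelled characters -/

section CharacterLattice

variable {k A Q : Type*} [Field k] [CommGroup A] [Group Q] (φ : Q →* MulAut A)

/-- The permutation of the characters of `A`, with labels in `Q`, given by `q`. -/
def moveCharacter (q : Q) (c : (A →* kˣ) × Q) : (A →* kˣ) × Q :=
  (c.1.comp (φ q⁻¹).toMonoidHom, q * c.2)

/-- The permutation action of `Q` on the lattice spanned by the labelled characters of `A`. -/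
noncomputable def characterAction : Q →* (((A →* kˣ) × Q →₀ ℤ) ≃ₗ[ℤ] ((A →* kˣ) × Q →₀ ℤ)) :=
  linearActionOfEnd
    { toFun := fun q => Finsupp.lmapDomain ℤ ℤ (moveCharacter φ q)
      map_one' := by
        have : moveCharacter (k := k) φ 1 = id := by
          funext c
          refine Prod.ext (MonoidHom.ext fun a => ?_) (one_mul _)
          simp [moveCharacter]
        rw [this]
        exact Finsupp.lmapDomain_id ℤ ℤ
      map_mul' := fun p q => by
        have : moveCharacter (k := k) φ (p * q) = moveCharacter φ p ∘ moveCharacter φ q := by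
          funext c
          refine Prod.ext (MonoidHom.ext fun a => ?_) (mul_assoc _ _ _)
          simp [moveCharacter]
        rw [this]
        exact Finsupp.lmapDomain_comp ℤ ℤ _ _ }

theorem characterAction_single (q : Q) (c : (A →* kˣ) × Q) (n : ℤ) :
    characterAction φ q (.single c n) = .single (moveCharacter φ q c) n :=
  Finsupp.mapDomain_single

variable (k A Q) in
/-- The product of characters given by an element of the lattice. -/
noncomputable def characterProd : Multiplicative ((A →* kˣ) × Q →₀ ℤ) →* (A →* kˣ) where
  toFun m := m.toAdd.prod fun c n => c.1 ^ n
  map_one' := Finsupp.prod_zero_index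
  map_mul' _ _ := Finsupp.prod_add_index' (fun c => zpow_zero c.1) fun c => zpow_add c.1

omit [Group Q] in
theorem characterProd_single (c : (A →* kˣ) × Q) (n : ℤ) :
    characterProd k A Q (.ofAdd (.single c n)) = c.1 ^ n :=
  Finsupp.prod_single_index (zpow_zero c.1)

/-- The labels in `Q` serve this purpose: `Q` acts on them by left multiplication, which is faithful
even if it fixes every character. -/
theorem injective_characterAction : Function.Injective (characterAction (k := k) φ) := by
  intro p q h
  have h1 := LinearEquiv.congr_fun h (.single (1, 1) 1)
  rw [characterAction_single, characterAction_single] at h1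
  have h2 := Finsupp.single_left_injective (one_ne_zero (α := ℤ)) h1
  simpa [moveCharacter] using congrArg Prod.snd h2

theorem characterProd_characterAction (q : Q) (m : (A →* kˣ) × Q →₀ ℤ) (a : A) :
    characterProd k A Q (.ofAdd (characterAction φ q m)) (φ q a) =
      characterProd k A Q (.ofAdd m) a := by
  induction m using Finsupp.induction_linear with
  | zero => simp
  | add m m' h h' =>
    rw [map_add, ofAdd_add, ofAdd_add, map_mul, map_mul, MonoidHom.mul_apply, MonoidHom.mul_apply,
      h, h']
  | single c n =>
    rw [characterAction_single, characterProd_single, characterProd_single]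
    simp [moveCharacter]

/-- All characters of `A` occur in the lattice, and they separate elements because `k` has enough
roots of unity. -/
theorem eq_one_of_characterProd [Finite A] [IsAlgClosed k] [CharZero k] (a : A)
    (h : ∀ m, characterProd k A Q m a = 1) : a = 1 := by
  by_contra ha
  have := NeZero.of_pos (Nat.pos_of_ne_zero (Monoid.exponent_ne_zero_of_finite (G := A)))
  have : NeZero ((Monoid.exponent A : ℕ) : k) := ⟨Nat.cast_ne_zero.mpr this.out⟩
  obtain ⟨χ, hχ⟩ := CommGroup.exists_apply_ne_one_of_hasEnoughRootsOfUnity A k ha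
  refine hχ ?_
  have := h (.ofAdd (.single (χ, 1) 1))
  rw [characterProd_single] at this
  simpa using this

theorem finite_characters [Finite A] [IsAlgClosed k] [CharZero k] : Finite (A →* kˣ) := by
  have := NeZero.of_pos (Nat.pos_of_ne_zero (Monoid.exponent_ne_zero_of_finite (G := A)))
  have : NeZero ((Monoid.exponent A : ℕ) : k) := ⟨Nat.cast_ne_zero.mpr this.out⟩
  exact Finite.of_equiv A (CommGroup.monoidHom_mulEquiv_of_hasEnoughRootsOfUnity A k).some.symm.toEquiv

end CharacterLattice

/-! ### Adjoining a lattice of eigenvectors -/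

section EigenExtension

variable {k E Λ A Q : Type*} [Field k] [Field E] [Algebra k E] [CommGroup A] [Group Q]
  {φ : Q →* MulAut A} [AddCommGroup Λ] (α : Q →* (Λ ≃ₗ[ℤ] Λ))
  (ψ : Multiplicative Λ →* (A →* kˣ)) (σ : A ⋊[φ] Q →* (E ≃ₐ[k] E))
  (hψ : ∀ q m a, ψ (.ofAdd (α q m)) (φ q a) = ψ (.ofAdd m) a)

/-- The action on `E[Λ]` by which `A` acts on the monomials through the characters `ψ`. -/
noncomputable def eigenAction : A ⋊[φ] Q →* (AddMonoidAlgebra E Λ ≃ₐ[k] AddMonoidAlgebra E Λ) :=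
  monomialAction σ (α.comp SemidirectProduct.rightHom)
    (fun g =>
      { toFun := fun m => algebraMap k E (ψ (.ofAdd (α g.right m.toAdd)) g.left)
        map_one' := by simp
        map_mul' := fun m m' => by simp })
    (by
      intro p q m
      simp only [MonoidHom.coe_mk, OneHom.coe_mk, toAdd_ofAdd, AlgEquiv.commutes,
        SemidirectProduct.mul_right, SemidirectProduct.mul_left, MonoidHom.comp_apply,
        SemidirectProduct.rightHom_eq_right, map_mul, LinearEquiv.mul_apply, Units.val_mul, hψ]
      rw [mul_comm])

theorem isMonomialAction_eigenAction : IsMonomialAction σ (fun g => α g.right)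
    (fun g m => algebraMap k E (ψ (.ofAdd (α g.right m)) g.left)) (eigenAction α ψ σ hψ) :=
  isMonomialAction_monomialAction _ _ _ _

variable {F : Type*} [Field F] [Algebra k F] [Algebra E F] [Algebra (AddMonoidAlgebra E Λ) F]
  [IsScalarTower k (AddMonoidAlgebra E Λ) F] [IsFractionRing (AddMonoidAlgebra E Λ) F]
  [IsScalarTower E (AddMonoidAlgebra E Λ) F]

variable (E Λ F) in
/-- The monomials in a field containing `E[Λ]`. -/
noncomputable def monomialHom : Multiplicative Λ →* F :=
  (algebraMap (AddMonoidAlgebra E Λ) F).toMonoidHom.comp (AddMonoidAlgebra.of E Λ)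

omit [Algebra E F] [IsFractionRing (AddMonoidAlgebra E Λ) F]
  [IsScalarTower E (AddMonoidAlgebra E Λ) F] in
theorem monomialHom_ofAdd (m : Λ) :
    monomialHom E Λ F (.ofAdd m) = algebraMap (AddMonoidAlgebra E Λ) F (.single m 1) := rfl

omit [Algebra E F] [IsScalarTower E (AddMonoidAlgebra E Λ) F] in
theorem isEigenlattice_fractionAction (hα : Function.Injective α)
    (h1 : ∀ a, (∀ m, ψ m a = 1) → a = 1) :
    IsEigenlattice α ψ (fractionAction (eigenAction α ψ σ hψ)) (monomialHom E Λ F) := by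
  have hB := IsFractionRing.injective (AddMonoidAlgebra E Λ) F
  have hc : ∀ (c : k) (m : Λ), c • monomialHom E Λ F (.ofAdd m) =
      algebraMap (AddMonoidAlgebra E Λ) F (.single m (algebraMap k E c)) := fun c m => by
    rw [Algebra.smul_def, IsScalarTower.algebraMap_apply k (AddMonoidAlgebra E Λ) F,
      monomialHom_ofAdd, ← map_mul, ← Algebra.smul_def c (AddMonoidAlgebra.single m (1 : E)),
      AddMonoidAlgebra.smul_single, ← Algebra.algebraMap_eq_smul_one]
  refine ⟨hα, hψ, h1, fun c m m' h => ?_, fun g m => ?_⟩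
  · have h2 : (.single m.toAdd 1 : AddMonoidAlgebra E Λ) = .single m'.toAdd (algebraMap k E c) :=
      hB ((hc c m'.toAdd).symm.trans h.symm).symm
    exact (AddMonoidAlgebra.single_inj.mp h2).elim (fun h3 => Multiplicative.toAdd.injective h3.1)
      fun h3 => absurd h3.1 one_ne_zero
  · rw [hc, monomialHom_ofAdd, fractionAction_algebraMap, isMonomialAction_eigenAction α ψ σ hψ,
      map_one, one_mul]

omit [IsScalarTower k (AddMonoidAlgebra E Λ) F] in
theorem adjoin_monomialHom_union [IsScalarTower k E F] {ι : Type*} (x : ι → E)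
    (hx : IntermediateField.adjoin k (Set.range x) = ⊤) :
    IntermediateField.adjoin k
      (Set.range (monomialHom E Λ F) ∪ Set.range fun i => algebraMap E F (x i)) = ⊤ := by
  set F' := IntermediateField.adjoin k
    (Set.range (monomialHom E Λ F) ∪ Set.range fun i => algebraMap E F (x i))
  have h2 : ∀ e : E, algebraMap E F e ∈ F' := by
    intro e
    have hle : IntermediateField.adjoin k (Set.range x) ≤
        F'.comap (IsScalarTower.toAlgHom k E F) := by
      rw [IntermediateField.adjoin_le_iff]
      rintro _ ⟨i, rfl⟩
      exact IntermediateField.subset_adjoin _ _ (.inr ⟨i, rfl⟩)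
    rw [hx] at hle
    exact hle trivial
  rw [← IntermediateField.toSubfield_inj]
  refine subfield_eq_top_of_closure_eq_top (L := E) (C := Λ) _ h2
    (s := Set.univ) (by simp) fun m _ => ?_
  exact IntermediateField.subset_adjoin _ _ (.inl ⟨.ofAdd m, rfl⟩)

end EigenExtension

theorem le_trdeg_fractionRing {k E Λ F : Type u} [Field k] [Field E] [Algebra k E]
    [AddCommGroup Λ] [Module.Free ℤ Λ] [Module.Finite ℤ Λ] [Field F] [Algebra k F] [Algebra E F]
    [IsScalarTower k E F] [Algebra (AddMonoidAlgebra E Λ) F]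
    [IsFractionRing (AddMonoidAlgebra E Λ) F] [IsScalarTower E (AddMonoidAlgebra E Λ) F]
    {n : ℕ} {x : Fin n → E} (hx : AlgebraicIndependent k x) :
    ((Module.finrank ℤ Λ + n : ℕ) : Cardinal) ≤ Algebra.trdeg k F := by
  have h1 := (algebraicIndependent_single (L := E) (F := F) (IsFractionRing.injective _ _)
    (Module.finBasis ℤ Λ).linearIndependent).lift_cardinalMk_le_trdeg
  have h2 := hx.lift_cardinalMk_le_trdeg
  rw [Cardinal.mk_fin, Cardinal.lift_natCast, Cardinal.nat_le_lift_iff] at h1 h2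
  rw [← trdeg_add_eq k E, add_comm, Nat.cast_add]
  exact add_le_add h2 h1

/-- The induction step over a split extension by an abelian group. -/
theorem LinearQuotientsAdmitTowers.semidirectProduct {k : Type u} [Field k] [IsAlgClosed k]
    [CharZero k] {A Q : Type} [CommGroup A] [Finite A] [Group Q] [Finite Q] (φ : Q →* MulAut A)
    (hQ : LinearQuotientsAdmitTowers k Q) : LinearQuotientsAdmitTowers k (A ⋊[φ] Q) := by
  intro E _ _ σ hσ n x hx htop hspan R _ _ _ _ _ _ hR
  have : Finite (A ⋊[φ] Q) := Finite.of_equiv _ SemidirectProduct.equivProd.symm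
  have : Finite (A →* kˣ) := finite_characters
  let Λ := (A →* kˣ) × Q →₀ ℤ
  let s := eigenAction (characterAction φ) (characterProd k A Q) σ
    (characterProd_characterAction φ)
  have hs := isMonomialAction_eigenAction (characterAction φ) (characterProd k A Q) σ
    (characterProd_characterAction φ)
  -- First torus step: from the field `E` to the group algebra `E[Λ]`, under the whole of `A ⋊ Q`.
  refine admits_of_isMonomialAction k R E σ hσ hR.injective hR.invariant_iff
    ((characterAction φ).comp SemidirectProduct.rightHom) _ s hs ?_
  intro R₁ _ _ _ _ _ _ hinj hinv hfrac
  have := isDomain_addMonoidAlgebra E Λ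
  let F := FractionRing (AddMonoidAlgebra E Λ)
  refine (isEigenlattice_fractionAction (F := F) (characterAction φ) (characterProd k A Q) σ
    (characterProd_characterAction φ) (injective_characterAction φ)
    (eq_one_of_characterProd (Q := Q))).admits hQ (fun i => algebraMap E F (x i)) (fun g i => ?_)
    (adjoin_monomialHom_union x htop) (le_trdeg_fractionRing hx) R₁
    (isInvariantModel_fractionAction s R₁ hinj hinv hfrac)
  rw [IsScalarTower.algebraMap_apply E (AddMonoidAlgebra E Λ) F, fractionAction_algebraMap,
    hs.map_algebraMap, ← IsScalarTower.algebraMap_apply]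
  have h1 := Submodule.mem_map_of_mem (f := (IsScalarTower.toAlgHom k E F).toLinearMap) (hspan g i)
  rwa [Submodule.map_span, ← Set.range_comp] at h1

/-- The induction step over a split surjection with abelian kernel. -/
theorem LinearQuotientsAdmitTowers.of_splitting {k : Type u} [Field k] [IsAlgClosed k] [CharZero k]
    {P H : Type w} [Group P] [Finite P] [Group H] [Finite H]
    (hH : LinearQuotientsAdmitTowers k H) (p : P →* H) (hp : IsMulCommutative p.ker) (s : H →* P)
    (hs : p.comp s = MonoidHom.id H) : LinearQuotientsAdmitTowers k P := by
  -- The finite groups are moved to the lowest universe so that the lattices built from them stay in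
  -- the universe of `k`.
  let eA : Shrink.{0} p.ker ≃* p.ker := Shrink.mulEquiv
  let eQ : Shrink.{0} H ≃* H := Shrink.mulEquiv
  let _ : CommGroup (Shrink.{0} p.ker) :=
    { (inferInstance : Group (Shrink.{0} p.ker)) with
      mul_comm := fun a b => eA.injective <| by
        rw [map_mul, map_mul]
        exact hp.is_comm.comm _ _ }
  have hs' : ∀ h, p (s h) = h := DFunLike.congr_fun hs
  let S : GroupExtension (Shrink.{0} p.ker) P (Shrink.{0} H) :=
    { inl := p.ker.subtype.comp eA.toMonoidHom
      rightHom := eQ.symm.toMonoidHom.comp p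
      inl_injective := p.ker.subtype_injective.comp eA.injective
      range_inl_eq_ker_rightHom := by
        ext x
        refine ⟨?_, fun hx => ?_⟩
        · rintro ⟨a, rfl⟩
          simp
        · have hx' : x ∈ p.ker := by simpa [MonoidHom.mem_ker] using hx
          exact ⟨eA.symm ⟨x, hx'⟩, by simp⟩
      rightHom_surjective := fun h => ⟨s (eQ h), by simp [hs']⟩ }
  let t : S.Splitting := ⟨s.comp eQ.toMonoidHom, fun h => by simp [S, hs']⟩
  exact (LinearQuotientsAdmitTowers.semidirectProduct t.conjAct
    (hH.of_mulEquiv eQ)).of_mulEquiv t.semidirectProductMulEquiv.symm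

/-- Induction on the quotients `G ⧸ N i`, from the trivial group to `G` itself; each is a split
extension of the one before by an abelian kernel. -/
theorem IsSpecial.linearQuotientsAdmitTowers (k : Type u) [Field k] [IsAlgClosed k] [CharZero k]
    {G : Type w} [Group G] [Finite G] (hG : IsSpecial G) : LinearQuotientsAdmitTowers k G := by
  obtain ⟨r, N, _, h0, hr, h⟩ := hG
  have key : ∀ i, LinearQuotientsAdmitTowers k (G ⧸ N i) := by
    intro i
    induction i using Fin.induction with
    | zero =>
      have : Subsingleton (G ⧸ N 0) := QuotientGroup.subsingleton_iff.mpr h0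
      exact linearQuotientsAdmitTowers_of_subsingleton k _
    | succ i hi =>
      obtain ⟨hlt, hcomm, s, hs⟩ := h i
      exact hi.of_splitting _ hcomm s hs
  have : (N (Fin.last r)).Normal := inferInstance
  exact (key (Fin.last r)).of_mulEquiv
    (QuotientGroup.quotientBot.symm.trans (QuotientGroup.quotientMulEquivOfEq hr.symm))

/-! ### The quotient of a linear representation -/

section Representation

variable {k V : Type u} [Field k] [AddCommGroup V] [Module k V] {G : Type w} [Group G]

theorem coordAction_ι (ρ : Representation k G V) (g : G) (f : Module.Dual k V) :
    coordAction ρ g (SymmetricAlgebra.ι k (Module.Dual k V) f) =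
      SymmetricAlgebra.ι k (Module.Dual k V) (ρ.dual g f) := by
  simp [coordAction]

theorem algebraicIndependent_ι {M ι : Type*} [AddCommGroup M] [Module k M]
    (b : Module.Basis ι k M) : AlgebraicIndependent k fun i => SymmetricAlgebra.ι k M (b i) := by
  have h := (MvPolynomial.algebraicIndependent_X ι k).map'
    (f := (SymmetricAlgebra.equivMvPolynomial b).symm.toAlgHom)
    (SymmetricAlgebra.equivMvPolynomial b).symm.injective
  convert h using 2 with i
  exact (SymmetricAlgebra.equivMvPolynomial_symm_X b i).symm

/-- A basis maps to an algebraically independent, hence linearly independent, family. -/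
theorem ι_injective {M : Type*} [AddCommGroup M] [Module k M] :
    Function.Injective (SymmetricAlgebra.ι k M) := by
  let b := Module.Basis.ofVectorSpace k M
  have h := (algebraicIndependent_ι b).linearIndependent
  intro m m' hm
  refine b.repr.injective (h ?_)
  simp_rw [← Function.comp_apply (f := SymmetricAlgebra.ι k M) (g := b), ← Function.comp_def]
  rw [← Finsupp.apply_linearCombination, ← Finsupp.apply_linearCombination,
    b.linearCombination_repr, b.linearCombination_repr, hm]

theorem injective_actionOfEnd_coordAction [FiniteDimensional k V] (ρ : Representation k G V)
    (hρ : Function.Injective ρ) : Function.Injective (actionOfEnd (coordAction ρ)) := by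
  intro g h hgh
  have h1 : ∀ f : Module.Dual k V, ρ.dual g f = ρ.dual h f := fun f => ι_injective <| by
    rw [← coordAction_ι, ← coordAction_ι]
    exact DFunLike.congr_fun hgh (SymmetricAlgebra.ι k (Module.Dual k V) f)
  -- The dual representation acts through inverses, and linear forms separate vectors.
  refine inv_injective (hρ (LinearMap.ext fun v => ?_))
  rw [← sub_eq_zero, ← Module.forall_dual_apply_eq_zero_iff k]
  intro f
  rw [map_sub, sub_eq_zero]
  exact LinearMap.congr_fun (h1 f) v

theorem adjoin_algebraMap_ι {M ι E : Type*} [AddCommGroup M] [Module k M]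
    [Field E] [Algebra k E] [Algebra (SymmetricAlgebra k M) E]
    [IsScalarTower k (SymmetricAlgebra k M) E] [IsFractionRing (SymmetricAlgebra k M) E]
    (b : Module.Basis ι k M) :
    IntermediateField.adjoin k (Set.range fun i =>
      algebraMap (SymmetricAlgebra k M) E (SymmetricAlgebra.ι k M (b i))) = ⊤ := by
  set F := IntermediateField.adjoin k (Set.range fun i =>
      algebraMap (SymmetricAlgebra k M) E (SymmetricAlgebra.ι k M (b i)))
  have h1 : ∀ m, algebraMap (SymmetricAlgebra k M) E (SymmetricAlgebra.ι k M m) ∈ F := by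
    intro m
    induction b.mem_span m using Submodule.span_induction with
    | mem x hx => obtain ⟨i, rfl⟩ := hx; exact IntermediateField.subset_adjoin _ _ ⟨i, rfl⟩
    | zero => rw [map_zero, map_zero]; exact zero_mem F
    | add x y _ _ hx hy => rw [map_add, map_add]; exact add_mem hx hy
    | smul c x _ hx =>
      rw [map_smul, Algebra.smul_def, map_mul, ← IsScalarTower.algebraMap_apply]
      exact mul_mem (F.algebraMap_mem c) hx
  have h2 : ∀ f, algebraMap (SymmetricAlgebra k M) E f ∈ F := by
    intro f
    induction f using SymmetricAlgebra.induction with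
    | algebraMap c => rw [← IsScalarTower.algebraMap_apply]; exact F.algebraMap_mem c
    | ι m => exact h1 m
    | mul x y hx hy => rw [map_mul]; exact mul_mem hx hy
    | add x y hx hy => rw [map_add]; exact add_mem hx hy
  rw [eq_top_iff]
  intro e _
  obtain ⟨x, y, -, rfl⟩ := IsFractionRing.div_surjective (SymmetricAlgebra k M) e
  exact div_mem (h2 x) (h2 y)

end Representation

end ToricTower

theorem mainTheorem1 {k : Type u} [Field k] [IsAlgClosed k] [CharZero k]
    {G : Type w} [Group G] [Finite G] [Group.IsSolvable G] (hG : ToricTower.IsSpecial G)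
    {V : Type u} [AddCommGroup V] [Module k V] [FiniteDimensional k V]
    (ρ : Representation k G V) (hρ : Function.Injective ρ) :
    ToricTower.AdmitsToricRationalTower (ToricTower.linearQuotient ρ) := by
  have := ToricTower.finiteType_invariants ρ
  let E := FractionRing (SymmetricAlgebra k (Module.Dual k V))
  let b := Module.finBasis k (Module.Dual k V)
  let ι := SymmetricAlgebra.ι k (Module.Dual k V)
  -- The coordinates of a basis of the dual generate the function field of `V`, and `k[V]^G` is
  -- itself a model of its invariants; `linearQuotient ρ` is the affine variety of that ring by
  -- definition.
  refine hG.linearQuotientsAdmitTowers k E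
    (ToricTower.fractionAction (ToricTower.actionOfEnd (ToricTower.coordAction ρ)))
    (ToricTower.injective_fractionAction (ToricTower.injective_actionOfEnd_coordAction ρ hρ)) _
    (fun i => algebraMap _ E (ι (b i)))
    ((ToricTower.algebraicIndependent_ι b).map' (f := IsScalarTower.toAlgHom k _ E)
      (IsFractionRing.injective _ E))
    (ToricTower.adjoin_algebraMap_ι b) (fun g i => ?_) (ToricTower.invariants ρ)
    (ToricTower.isInvariantModel_fractionAction _ _ Subtype.val_injective (fun r g => r.2 g)
      fun x hx => ⟨⟨x, hx⟩, 1, one_ne_zero, one_smul _ _⟩)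
  rw [ToricTower.fractionAction_algebraMap, ToricTower.actionOfEnd_apply, ToricTower.coordAction_ι]
  have h1 := Submodule.mem_map_of_mem
    (f := (IsScalarTower.toAlgHom k (SymmetricAlgebra k (Module.Dual k V)) E).toLinearMap ∘ₗ ι)
    (b.mem_span (ρ.dual g (b i)))
  rwa [Submodule.map_span, ← Set.range_comp] at h1
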